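/- **Setting.** Let $d\in\{1,2,3\}$, let $\mathcal O\subset\mathbb R^d$ be a bounded convex domain with polygonal (polyhedral) boundary, $L^2=L^2(\mathcal O;\mathbb R)$, and let $\Lambda$ be the Laplacian on $\mathcal O$ with homogeneous Dirichlet boundary condition, with $-\Lambda e_i=\lambda_i e_i$, $0<\lambda_1\le\lambda_2\le\cdots$, and $\{e_i\}$ an orthonormal basis of $L^2$. Put $\dot{\mathbb H}^1=\mathcal D((-\Lambda)^{1/2})$, $\|u\|_{\dot{\mathbb H}^1}^2=\sum_i\lambda_i\langle u,e_i\rangle_{L^2}^2$, and $\Theta u=(u,\partial_{x_1}u,\dots,\partial_{x_d}u)$. Let $\mathbf Q$ be a symmetric, positive definite, finite trace operator on $L^2$, let $\|\cdot\|_{\mathcal L_2}$ be the Hilbert–Schmidt norm of operators from $\mathbf Q^{1/2}(L^2)$ to $L^2$, i.e. $\|B\|_{\mathcal L_2}^2=\sum_i\|B\mathbf Q^{1/2}e_i\|_{L^2}^2$, and let $W(t)=\sum_k\mathbf Q^{1/2}e_k\beta_k(t)$, where the $\beta_k$ are independent standard Brownian motions with respect to a filtration $(\mathcal F_t)_{t\ge0}$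 on a probability space $(\Omega,\mathcal F,\mathbb P)$. **Assumptions.** Let $\widetilde F:\mathbb R\to\mathbb R$ be twice differentiable, $f(u)=\widetilde F'(u)$ and $f'(u)v=\widetilde F''(u)v$ (pointwise on $\mathcal O$), $F(u)=\int_{\mathcal O}\widetilde F(u(x))\,dx$, and let $g(\Theta u)$ be a Hilbert–Schmidt operator from $\mathbf Q^{1/2}(L^2)$ to $L^2$ for each $u\in\dot{\mathbb H}^1$. Suppose that there are an integer $k\ge1$, constants $c_2,c_3,c_4,\delta_0,c>0$ and polynomials $b_1,b_2,b_3$ of degrees $2k+1,2k,k$ such that for all $u,\widetilde u\in\dot{\mathbb H}^1$ $$\|f(u)\|_{L^2}\le b_1(\|u\|_{\dot{\mathbb H}^1}),\qquad \|f(u)-f(\widetilde u)\|_{L^2}\le b_2(\|u\|_{\dot{\mathbb H}^1},\|\widetilde u\|_{\dot{\mathbb H}^1})\|u-\widetilde u\|_{\dot{\mathbb H}^1},$$ $$\|g(\Theta u)\|_{\mathcal L_2}\le c_2(1+\|u\|_{\dot{\mathbb H}^1}),\qquad \|g(\Theta u)-g(\Theta\widetilde u)\|_{\mathcal L_2}\le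 b_3(\|u\|_{\dot{\mathbb H}^1},\|\widetilde u\|_{\dot{\mathbb H}^1})\|u-\widetilde u\|_{\dot{\mathbb H}^1},$$ $$F(u)+\delta_0\ge c_3\|u\|_{L^2}^2+c_4\|u\|_{L^{2k+2}}^{2k+2},\qquad F(u)+\delta_0\ge c.$$ Suppose moreover that, for some $\gamma_1>\frac12$ and some polynomial $b_5$, for all $u,v,w\in\dot{\mathbb H}^1$, $$|\langle f'(u)v,w\rangle_{L^2}|\le b_5(\|u\|_{\dot{\mathbb H}^1},\|v\|_{\dot{\mathbb H}^1},\|w\|_{\dot{\mathbb H}^1})\,\|v\|_{L^2}^{\gamma_1}\|w\|_{L^2}^{\gamma_1}.$$ Let $X_0=(u_0,v_0)$ be $\mathcal F_0$-measurable with values in $\dot{\mathbb H}^1\times L^2$ and with $\mathbb E\|u_0\|_{\dot{\mathbb H}^1}^r+\mathbb E\|v_0\|_{L^2}^r<\infty$ for all $r\ge1$ (for instance, $X_0$ deterministic). **Schemes.** Let $T>0$, $N\in\mathbb N^+$, $\tau=T/N$, $\delta W_n=W((n+1)\tau)-W(n\tau)$, and let either $\widehat u_n=u_n$ for all $n$,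 or $\widehat u_n=\frac{3u_n-u_{n-1}}2$ for all $n$, with $u_{-1}=u_0$. Starting from $(u_0,v_0)$ and an $\mathcal F_0$-measurable real random variable $q_0$, let the adapted process $(u_n,v_n,q_n)_{0\le n\le N}$ with values in $\dot{\mathbb H}^1\times L^2\times\mathbb R$ solve, for $0\le n\le N-1$, the equation $$q_{n+1}=q_n+\frac{\langle f(\widehat u_n),u_{n+1}-u_n\rangle_{L^2}}{2\sqrt{F(\widehat u_n)+\delta_0}}$$ together with, writing $\phi_n=\frac{f(\widehat u_n)}{\sqrt{F(\widehat u_n)+\delta_0}}\,\frac{q_n+q_{n+1}}2$, either (midpoint SAV scheme) $$u_{n+1}=u_n+\tfrac\tau2(v_n+v_{n+1})+\tfrac\tau2g(\Theta u_n)\delta W_n,\qquad v_{n+1}=v_n+\tfrac\tau2\Lambda(u_n+u_{n+1})-\tau\phi_n+g(\Theta u_n)\delta W_n,$$ or (exponential SAV scheme) $$\begin{pmatrix}u_{n+1}\\v_{n+1}\end{pmatrix}=E(\tau)\begin{pmatrix}u_n\\v_n\end{pmatrix}+A^{-1}(E(\tau)-I)\begin{pmatrix}0\\-\phi_n\end{pmatrix}+E(\tau)\begin{pmatrix}0\\g(\Theta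 u_n)\delta W_n\end{pmatrix},$$ where $A=\begin{pmatrix}0&I\\\Lambda&0\end{pmatrix}$ and $E(t)=\exp(tA)$. **Proposition 4.1.** Assume in addition that $|q_0-\sqrt{F(\widehat u_0)+\delta_0}|\le C_0\tau$ almost surely, with a constant $C_0$ independent of $N$ and $\tau$. Then, for both schemes, both choices of $\widehat u_n$ and every $p\ge1$, $$\sup_{j\in\{1,\dots,N\}}\mathbb E\Big[\big|\sqrt{F(\widehat u_j)+\delta_0}-q_j\big|^p\Big]\le C\,\tau^{\min(1,2\gamma_1-1)p},$$ where $C>0$ depends on $p,X_0,\mathbf Q,T$ (and on $\mathcal O$, $f$, $g$ and the constants and polynomials in the assumptions, including $C_0$), but not on $N$ and $\tau$. -/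

import Mathlib

open MeasureTheory ProbabilityTheory Filter Topology TopologicalSpace
open scoped NNReal ENNReal InnerProductSpace Distributions

noncomputable section

namespace SAVWave

/-! ### The domain, weak derivatives and the Dirichlet Laplacian -/

/-- A bounded convex domain with polygonal (polyhedral) boundary: the nonempty interior of the
convex hull of finitely many points. -/
def IsConvexPolygonalDomain {d : ℕ} (O : Opens (EuclideanSpace ℝ (Fin d))) : Prop :=
  (O : Set (EuclideanSpace ℝ (Fin d))).Nonempty ∧
    ∃ s : Finset (EuclideanSpace ℝ (Fin d)),
      (O : Set (EuclideanSpace ℝ (Fin d))) =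
        interior (convexHull ℝ (s : Set (EuclideanSpace ℝ (Fin d))))

/-- Lebesgue measure on `O`. -/
abbrev vol {d : ℕ} (O : Opens (EuclideanSpace ℝ (Fin d))) :
    Measure (EuclideanSpace ℝ (Fin d)) :=
  volume.restrict (O : Set (EuclideanSpace ℝ (Fin d)))

/-- The Hilbert space `L²(O; ℝ)`. -/
abbrev L2 {d : ℕ} (O : Opens (EuclideanSpace ℝ (Fin d))) : Type :=
  Lp ℝ 2 (vol O)

section Space

variable {d : ℕ} {O : Opens (EuclideanSpace ℝ (Fin d))}

/-- The classical partial derivative `∂φ/∂xᵢ`. -/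
def partialDeriv (i : Fin d) (φ : EuclideanSpace ℝ (Fin d) → ℝ)
    (x : EuclideanSpace ℝ (Fin d)) : ℝ :=
  fderiv ℝ φ x (EuclideanSpace.single i 1)

/-- `w` is the weak partial derivative `∂u/∂xᵢ` in `O`: integration by parts against every smooth
function compactly supported in `O`. -/
def IsWeakPartial (i : Fin d) (u w : L2 O) : Prop :=
  ∀ φ : 𝓓(O, ℝ), ∫ x, u x * partialDeriv i φ x ∂(vol O) = -∫ x, w x * φ x ∂(vol O)

open Classical in
/-- The weak partial derivative `∂u/∂xᵢ ∈ L²(O)` (it is unique when it exists, and it exists for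
all `u` in the form domain of the Dirichlet Laplacian; otherwise the value is `0`). -/
def weakPartial (i : Fin d) (u : L2 O) : L2 O :=
  if h : ∃ w : L2 O, IsWeakPartial i u w then h.choose else 0

/-- `Θ u = (u, ∂₁u, …, ∂_d u)`. -/
def Theta (u : L2 O) : L2 O × (Fin d → L2 O) :=
  (u, fun i => weakPartial i u)

/-- `u ∈ H¹₀(O)`: `u` and weak partial derivatives `w i` of it are limits in `L²(O)` of test
functions and of their partial derivatives. -/
def MemH10 (u : L2 O) : Prop :=
  ∃ (φ : ℕ → 𝓓(O, ℝ)) (w : Fin d → L2 O),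
    Tendsto (fun n => eLpNorm (fun x => φ n x - u x) 2 (vol O)) atTop (𝓝 0) ∧
    ∀ i, Tendsto (fun n => eLpNorm (fun x => partialDeriv i (φ n) x - w i x) 2 (vol O))
      atTop (𝓝 0)

/-- `(e i, lam i)` are the eigenpairs of the negative Laplacian `-Λ` on `O` with homogeneous
Dirichlet boundary condition: `e` is an orthonormal basis of `L²(O)` (this is part of the type of
`e`), `0 < λ₁ ≤ λ₂ ≤ ⋯`, and each `e i ∈ H¹₀(O)` satisfies `-Λ eᵢ = λᵢ eᵢ` weakly. -/
structure IsDirichletEigenbasis (e : HilbertBasis ℕ ℝ (L2 O)) (lam : ℕ → ℝ) : Prop where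
  pos : ∀ i, 0 < lam i
  mono : Monotone lam
  mem : ∀ i, MemH10 (e i)
  eigen : ∀ i, ∃ w : Fin d → L2 O, (∀ j, IsWeakPartial j (e i) (w j)) ∧
    ∀ φ : 𝓓(O, ℝ), ∑ j, ∫ x, w j x * partialDeriv j φ x ∂(vol O)
      = lam i * ∫ x, e i x * φ x ∂(vol O)

variable (e : HilbertBasis ℕ ℝ (L2 O)) (lam : ℕ → ℝ)

/-- The operator `∑ᵢ mᵢ ⟨eᵢ, ·⟩ eᵢ`; the value is the intended one for `u` in `specDomain e m`. -/
def specOp (m : ℕ → ℝ) (u : L2 O) : L2 O :=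
  ∑' i, (m i * ⟪e i, u⟫_ℝ) • e i

/-- The domain of the operator `∑ᵢ mᵢ ⟨eᵢ, ·⟩ eᵢ` in `L²(O)`. -/
def specDomain (m : ℕ → ℝ) : Set (L2 O) :=
  {u | Summable fun i => (m i * ⟪e i, u⟫_ℝ) ^ 2}

/-- `Ḣ¹ = D((-Λ)^{1/2})`. -/
def H1 : Set (L2 O) :=
  specDomain e fun i => √(lam i)

/-- The norm of `Ḣ¹`: `‖u‖² = ∑ᵢ λᵢ ⟨u, eᵢ⟩²`. -/
def h1norm (u : L2 O) : ℝ :=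
  √(∑' i, lam i * ⟪e i, u⟫_ℝ ^ 2)

/-- The Dirichlet Laplacian `Λ` (on `specDomain e fun i => -lam i`). -/
def laplacian (u : L2 O) : L2 O :=
  specOp e (fun i => -lam i) u

/-- The unitary group
`E(t) = [[cos(t(-Λ)^{1/2}), (-Λ)^{-1/2} sin(t(-Λ)^{1/2})],
         [-(-Λ)^{1/2} sin(t(-Λ)^{1/2}), cos(t(-Λ)^{1/2})]]` on `Ḣ¹ × L²`. -/
def waveGroup (t : ℝ) (X : L2 O × L2 O) : L2 O × L2 O :=
  (specOp e (fun i => Real.cos (t * √(lam i))) X.1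
      + specOp e (fun i => (√(lam i))⁻¹ * Real.sin (t * √(lam i))) X.2,
    specOp e (fun i => -(√(lam i) * Real.sin (t * √(lam i)))) X.1
      + specOp e (fun i => Real.cos (t * √(lam i))) X.2)

/-- The inverse `A⁻¹ (x, y) = (Λ⁻¹ y, x)` of `A = [[0, I], [Λ, 0]]`. -/
def waveGenInv (X : L2 O × L2 O) : L2 O × L2 O :=
  (specOp e (fun i => -(lam i)⁻¹) X.2, X.1)

/-! ### The covariance operator and Hilbert–Schmidt operators on `Q^{1/2}(L²)` -/

/-- `Q` is symmetric, positive definite, of finite trace, and `R = Q^{1/2}` is its positive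
square root. -/
structure IsCovariance (Q R : L2 O →L[ℝ] L2 O) : Prop where
  pos : Q.IsPositive
  posDef : ∀ x, x ≠ 0 → 0 < ⟪Q x, x⟫_ℝ
  trace : Summable fun i => ⟪Q (e i), e i⟫_ℝ
  sqrt_pos : R.IsPositive
  sqrt_sq : R ∘L R = Q

/-- The space `Q^{1/2}(L²)`, where `R = Q^{1/2}`. -/
abbrev CM (R : L2 O →L[ℝ] L2 O) : Submodule ℝ (L2 O) :=
  LinearMap.range R.toLinearMap

/-- The element `Q^{1/2} x` of `Q^{1/2}(L²)`, where `R = Q^{1/2}`. -/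
def toCM (R : L2 O →L[ℝ] L2 O) (x : L2 O) : CM R :=
  ⟨R x, LinearMap.mem_range_self R.toLinearMap x⟩

variable (R : L2 O →L[ℝ] L2 O)

/-- `B` is a Hilbert–Schmidt operator from `Q^{1/2}(L²)`, with the inner product that makes
`Q^{1/2}` an isometry from `L²`, into `L²`. -/
def IsHilbertSchmidt (B : CM R →ₗ[ℝ] L2 O) : Prop :=
  (Continuous fun x => B (toCM R x)) ∧ Summable fun i => ‖B (toCM R (e i))‖ ^ 2

/-- The Hilbert–Schmidt norm of `B : Q^{1/2}(L²) → L²`. -/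
def hsNorm (B : CM R →ₗ[ℝ] L2 O) : ℝ :=
  √(∑' i, ‖B (toCM R (e i))‖ ^ 2)

/-! ### The coefficients -/

variable (Ft : ℝ → ℝ)

open Classical in
/-- The Nemytskii operator `f(u)(x) = F̃'(u(x))`, as an element of `L²(O)` (for `u` such that this
function is square integrable). -/
def f (u : L2 O) : L2 O :=
  if h : MemLp (fun x => deriv Ft (u x)) 2 (vol O) then h.toLp _ else 0

/-- The potential `F(u) = ∫_O F̃(u(x)) dx`. -/
def F (u : L2 O) : ℝ :=
  ∫ x, Ft (u x) ∂(vol O)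

/-- The assumptions on the coefficients `f` and `g`, with the parameters `k` and `δ₀`. -/
structure CoefficientAssumption (g : L2 O × (Fin d → L2 O) → (CM R →ₗ[ℝ] L2 O))
    (k : ℕ) (δ₀ : ℝ) : Prop where
  k_pos : 1 ≤ k
  δ₀_pos : 0 < δ₀
  diff : Differentiable ℝ Ft
  f_memLp : ∀ u ∈ H1 e lam, MemLp (fun x => deriv Ft (u x)) 2 (vol O)
  f_growth : ∃ b₁ : Polynomial ℝ, b₁.natDegree ≤ 2 * k + 1 ∧
    ∀ u ∈ H1 e lam, ‖f Ft u‖ ≤ b₁.eval (h1norm e lam u)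
  f_lipschitz : ∃ b₂ : MvPolynomial (Fin 2) ℝ, b₂.totalDegree ≤ 2 * k ∧
    ∀ u ∈ H1 e lam, ∀ u' ∈ H1 e lam,
      ‖f Ft u - f Ft u'‖ ≤
        MvPolynomial.eval ![h1norm e lam u, h1norm e lam u'] b₂ * h1norm e lam (u - u')
  g_hs : ∀ u ∈ H1 e lam, IsHilbertSchmidt e R (g (Theta u))
  g_growth : ∃ c₂ : ℝ, 0 ≤ c₂ ∧ ∀ u ∈ H1 e lam,
    hsNorm e R (g (Theta u)) ≤
      c₂ * (1 + (eLpNorm u (2 * k + 2) (vol O)).toReal ^ (k + 1) + h1norm e lam u)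
  g_lipschitz : ∃ b₃ : MvPolynomial (Fin 2) ℝ, b₃.totalDegree ≤ k ∧
    ∀ u ∈ H1 e lam, ∀ u' ∈ H1 e lam,
      hsNorm e R (g (Theta u) - g (Theta u')) ≤
        MvPolynomial.eval ![h1norm e lam u, h1norm e lam u'] b₃ * h1norm e lam (u - u')
  coercive : ∃ c₃ c₄ : ℝ, 0 < c₃ ∧ 0 < c₄ ∧ ∀ u ∈ H1 e lam,
    MemLp u (2 * k + 2) (vol O) ∧ Integrable (fun x => Ft (u x)) (vol O) ∧
    c₃ * ‖u‖ ^ 2 + c₄ * (eLpNorm u (2 * k + 2) (vol O)).toReal ^ (2 * k + 2) ≤ F Ft u + δ₀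

/-! ### The driving noise -/

variable {Ω : Type*} [mΩ : MeasurableSpace Ω] (P : Measure Ω)

/-- `β k`, `k ∈ ℕ`, are independent standard Brownian motions with respect to the filtration `ℱ`:
they are adapted, and the increments of the whole family after time `s` are independent of `ℱ s`.
They define the `Q`-Wiener process `W(t) = ∑ₖ Q^{1/2} eₖ βₖ(t)`. -/
structure IsWienerFamily (ℱ : Filtration ℝ≥0 mΩ) (β : ℕ → ℝ≥0 → Ω → ℝ) : Prop where
  brownian : ∀ k, IsBrownianReal (β k) P
  indep : iIndepFun (fun k ω (t : ℝ≥0) => β k t ω) P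
  adapted : ∀ k, Adapted ℱ (β k)
  indep_past : ∀ s t, s ≤ t →
    Indep (MeasurableSpace.comap (fun ω (k : ℕ) => β k t ω - β k s ω) inferInstance) (ℱ s) P

/-- `ξ = B (W(t) - W(s)) = ∑ₖ (βₖ(t) - βₖ(s)) B Q^{1/2} eₖ`, as a limit in probability, for a
random Hilbert–Schmidt operator `B`. -/
def IsNoiseIncrement (β : ℕ → ℝ≥0 → Ω → ℝ) (s t : ℝ≥0) (B : Ω → (CM R →ₗ[ℝ] L2 O))
    (ξ : Ω → L2 O) : Prop :=
  TendstoInMeasure P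
    (fun (m : ℕ) ω => ∑ k ∈ Finset.range m, (β k t ω - β k s ω) • B ω (toCM R (e k))) atTop ξ

/-! ### The numerical schemes -/

/-- The two choices `û_n = u_n` and `û_n = (3 u_n - u_{n-1}) / 2`. -/
inductive Extrapolation
  | constant
  | linear

/-- `û_n`. As `0 - 1 = 0` for natural numbers, the convention `u_{-1} = u_0` is built in. -/
def uHat (x : Extrapolation) (u : ℕ → L2 O) (n : ℕ) : L2 O :=
  match x with
  | .constant => u n
  | .linear => (2⁻¹ : ℝ) • ((3 : ℝ) • u n - u (n - 1))

/-- The two schemes: the midpoint SAV scheme and the exponential Euler SAV scheme. -/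
inductive Scheme
  | midpoint
  | exponential

/-- `f(û) / √(F(û) + δ₀) * (q + q') / 2`. -/
def drift (δ₀ : ℝ) (û : L2 O) (q q' : ℝ) : L2 O :=
  ((q + q') / 2 / √(F Ft û + δ₀)) • f Ft û

/-- The update of the auxiliary variable, common to both schemes. -/
def AuxStep (δ₀ : ℝ) (û u u' : L2 O) (q q' : ℝ) : Prop :=
  q' = q + ⟪f Ft û, u' - u⟫_ℝ / (2 * √(F Ft û + δ₀))

/-- One step `(u, v, q) ↦ (u', v', q')` of a scheme with step size `τ`, given `û` and the value
`ξ` of `g(Θ u_n) δW_n`. -/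
def Step (δ₀ : ℝ) (s : Scheme) (τ : ℝ) (û ξ u v : L2 O) (q : ℝ) (u' v' : L2 O) (q' : ℝ) : Prop :=
  AuxStep Ft δ₀ û u u' q q' ∧
  match s with
  | .midpoint =>
      u' = u + (τ / 2) • (v + v') + (τ / 2) • ξ ∧
      u + u' ∈ specDomain e (fun i => -lam i) ∧
      v' = v + (τ / 2) • laplacian e lam (u + u') - τ • drift Ft δ₀ û q q' + ξ
  | .exponential =>
      (u', v') = waveGroup e lam τ (u, v)
        + waveGenInv e lam (waveGroup e lam τ (0, -drift Ft δ₀ û q q') - (0, -drift Ft δ₀ û q q'))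
        + waveGroup e lam τ (0, ξ)

/-- `(u_n, v_n, q_n)`, `0 ≤ n ≤ N`, is an adapted numerical solution, with values in
`Ḣ¹ × L² × ℝ`, of the scheme `s` with step size `τ` and initial value `(u₀, v₀)`. -/
structure IsNumericalSolution (g : L2 O × (Fin d → L2 O) → (CM R →ₗ[ℝ] L2 O)) (δ₀ : ℝ)
    (ℱ : Filtration ℝ≥0 mΩ) (β : ℕ → ℝ≥0 → Ω → ℝ) (s : Scheme) (x : Extrapolation)
    (N : ℕ) (τ : ℝ≥0) (u₀ v₀ : Ω → L2 O) (u v : ℕ → Ω → L2 O) (q : ℕ → Ω → ℝ) : Prop where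
  init_u : u 0 = u₀
  init_v : v 0 = v₀
  adapted_u : ∀ n ≤ N, StronglyMeasurable[ℱ (n * τ)] (u n)
  adapted_v : ∀ n ≤ N, StronglyMeasurable[ℱ (n * τ)] (v n)
  adapted_q : ∀ n ≤ N, Measurable[ℱ (n * τ)] (q n)
  mem_H1 : ∀ n ≤ N, ∀ᵐ ω ∂P, u n ω ∈ H1 e lam
  step : ∀ n < N, ∃ ξ : Ω → L2 O,
    IsNoiseIncrement e R P β (n * τ) ((n + 1 : ℕ) * τ) (fun ω => g (Theta (u n ω))) ξ ∧
    ∀ᵐ ω ∂P, Step e lam Ft δ₀ s τ (uHat x (fun m => u m ω) n) (ξ ω)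
      (u n ω) (v n ω) (q n ω) (u (n + 1) ω) (v (n + 1) ω) (q (n + 1) ω)

end Space

end SAVWave

end

/-! Write E = 1 + (‖u‖² + ‖v‖²)/2 + q², with the Ḣ¹ norm of u and the L² norm of v, and ξ for the
noise increment of a step. The update of q is made so that ⟨φ, u' - u⟩ = q'² - q² for the drift φ,
and both schemes treat the linear wave equation isometrically on Ḣ¹ × L². Hence E' = E + ⟨v, ξ⟩ +
‖ξ‖²/2 exactly (`energy_step_eq`). Given the past, ξ is a centred Gaussian whose covariance has
trace at most a constant times τE, by the linear growth of g. The term linear in ξ vanishes in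
expectation and the rest is O(τ), so every moment of E grows at most by a factor 1 + Cτ per step. By
the discrete Gronwall inequality all moments of E are bounded uniformly in the discretisation
(`energy_moments`).

The consistency argument is pathwise. Noise enters u only through a factor of order τ, so ‖u_{n+1} -
u_n‖ is τ times a polynomial in nearby energies and noise norms (`norm_step_increment_le`). In the
Taylor remainder F(u') - F(u) - ⟨f(û), u' - u⟩ = ∫₀¹ ⟨f(u + s(u' - u)) - f(û), u' - u⟩ ds, the bound
on f' gives two L² distances of order τ, each to the power γ₁, hence τ^(2γ₁). Taking square roots
adds a term of order τ². So q follows √(F(u) + δ₀) with a local error of order τ^(1+μ), where μ =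
min(1, 2γ₁ - 1). Telescoping over at most T/τ steps leaves τ^μ, and the initial error and the
replacement of u_j by û_j cost O(τ) (`exists_path_error`). The random prefactors are polynomials in
quantities with bounded moments (`hasMoments_pathBound`).

Two technical points remain. The derivative of f is only a pointwise one, so Fubini needs an L²
bound on f'(u)w, which Fatou's lemma extracts from the Lipschitz estimate (`eLpNorm_deriv_f_le`).
The coefficients are continuous only for the Ḣ¹ norm, while adaptedness refers to L²; spectral
projections bridge this gap (`H1Continuous.stronglyMeasurable_comp`). -/

noncomputable section

namespace SAVWave

/-! ### Spectral calculus and the energy balance of one step. -/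

section Spectral

variable {d : ℕ} {O : Opens (EuclideanSpace ℝ (Fin d))}
variable {e : HilbertBasis ℕ ℝ (L2 O)} {lam : ℕ → ℝ}

lemma ext_inner_basis (e : HilbertBasis ℕ ℝ (L2 O)) {x y : L2 O}
    (h : ∀ i, ⟪e i, x⟫_ℝ = ⟪e i, y⟫_ℝ) : x = y := by
  apply e.repr.injective
  ext i
  simpa [e.repr_apply_apply] using h i

lemma hasSum_norm_sq (e : HilbertBasis ℕ ℝ (L2 O)) (x : L2 O) :
    HasSum (fun i => ⟪e i, x⟫_ℝ ^ 2) (‖x‖ ^ 2) := by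
  have := e.hasSum_inner_mul_inner x x
  rw [real_inner_self_eq_norm_sq] at this
  refine this.congr_fun fun i => ?_
  rw [real_inner_comm x (e i), sq]

/-- On the domain the coefficients are square summable and the defining series converges; off it
`tsum` returns 0 and the formula is lost. -/
lemma inner_specOp {m : ℕ → ℝ} {u : L2 O} (hu : u ∈ specDomain e m) (i : ℕ) :
    ⟪e i, specOp e m u⟫_ℝ = m i * ⟪e i, u⟫_ℝ := by
  have hmem : Memℓp (fun i => m i * ⟪e i, u⟫_ℝ) 2 := by
    rw [memℓp_gen_iff (by norm_num)]
    have : Summable fun i => (m i * ⟪e i, u⟫_ℝ) ^ 2 := hu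
    simpa [← abs_mul] using this
  let c : lp (fun _ : ℕ => ℝ) 2 := ⟨_, hmem⟩
  have h1 : specOp e m u = e.repr.symm c := (e.hasSum_repr_symm c).tsum_eq
  rw [h1, ← e.repr_apply_apply, LinearIsometryEquiv.apply_symm_apply]

lemma mem_specDomain_of_le {m m' : ℕ → ℝ} {C : ℝ} {u : L2 O} (hu : u ∈ specDomain e m')
    (h : ∀ i, |m i| ≤ C * |m' i|) : u ∈ specDomain e m := by
  have h1 : Summable fun i => C ^ 2 * (m' i * ⟪e i, u⟫_ℝ) ^ 2 := Summable.mul_left _ hu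
  refine Summable.of_nonneg_of_le (fun i => sq_nonneg _) (fun i => ?_) h1
  have h2 : |m i| ^ 2 ≤ (C * |m' i|) ^ 2 := pow_le_pow_left₀ (abs_nonneg _) (h i) 2
  rw [mul_pow, sq_abs, sq_abs] at h2
  rw [mul_pow, mul_pow, ← mul_assoc]
  exact mul_le_mul_of_nonneg_right h2 (sq_nonneg _)

/-- By Parseval, a pointwise comparison of multipliers passes to norms. The bounds on the
exponential step reduce through it to elementary inequalities for sine and cosine. -/
lemma norm_specOp_le {m m' : ℕ → ℝ} {C : ℝ} (hC : 0 ≤ C) {u : L2 O} (hu : u ∈ specDomain e m')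
    (h : ∀ i, |m i| ≤ C * |m' i|) : ‖specOp e m u‖ ≤ C * ‖specOp e m' u‖ := by
  have h1 := hasSum_norm_sq e (specOp e m u)
  have h2 := (hasSum_norm_sq e (specOp e m' u)).mul_left (C ^ 2)
  have h3 : ‖specOp e m u‖ ^ 2 ≤ (C * ‖specOp e m' u‖) ^ 2 := by
    rw [mul_pow]
    refine hasSum_le (fun i => ?_) h1 h2
    rw [inner_specOp hu, inner_specOp (mem_specDomain_of_le hu h)]
    have h4 : |m i| ^ 2 ≤ (C * |m' i|) ^ 2 := pow_le_pow_left₀ (abs_nonneg _) (h i) 2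
    rw [mul_pow, sq_abs, sq_abs] at h4
    rw [mul_pow, mul_pow, ← mul_assoc]
    exact mul_le_mul_of_nonneg_right h4 (sq_nonneg _)
  exact le_of_sq_le_sq h3 (by positivity)

lemma mem_specDomain_one (u : L2 O) : u ∈ specDomain e (fun _ => 1) := by
  simpa [specDomain] using (hasSum_norm_sq e u).summable

lemma specOp_one (u : L2 O) : specOp e (fun _ => 1) u = u :=
  ext_inner_basis e fun i => by rw [inner_specOp (mem_specDomain_one u), one_mul]

lemma mem_specDomain_of_bounded {m : ℕ → ℝ} {C : ℝ} (h : ∀ i, |m i| ≤ C) (u : L2 O) :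
    u ∈ specDomain e m :=
  mem_specDomain_of_le (mem_specDomain_one u) (C := C) (by simpa using h)

lemma norm_specOp_le_of_bounded {m : ℕ → ℝ} {C : ℝ} (h : ∀ i, |m i| ≤ C) (u : L2 O) :
    ‖specOp e m u‖ ≤ C * ‖u‖ := by
  have := norm_specOp_le (m := m) ((abs_nonneg _).trans (h 0)) (mem_specDomain_one (e := e) u)
    (by simpa using h)
  rwa [specOp_one] at this

lemma specDomain_add {m : ℕ → ℝ} {u v : L2 O} (hu : u ∈ specDomain e m)
    (hv : v ∈ specDomain e m) : u + v ∈ specDomain e m := by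
  have h1 : Summable fun i => 2 * (m i * ⟪e i, u⟫_ℝ) ^ 2 + 2 * (m i * ⟪e i, v⟫_ℝ) ^ 2 :=
    (Summable.mul_left 2 hu).add (Summable.mul_left 2 hv)
  refine Summable.of_nonneg_of_le (fun i => sq_nonneg _) (fun i => ?_) h1
  rw [inner_add_right]
  nlinarith [sq_nonneg (m i * ⟪e i, u⟫_ℝ - m i * ⟪e i, v⟫_ℝ)]

lemma specDomain_smul {m : ℕ → ℝ} {u : L2 O} (hu : u ∈ specDomain e m) (c : ℝ) :
    c • u ∈ specDomain e m := by
  refine (Summable.mul_left (c ^ 2) hu).congr fun i => ?_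
  rw [inner_smul_right]; ring

lemma specDomain_sub {m : ℕ → ℝ} {u v : L2 O} (hu : u ∈ specDomain e m)
    (hv : v ∈ specDomain e m) : u - v ∈ specDomain e m := by
  have := specDomain_add hu (specDomain_smul hv (-1))
  rwa [neg_one_smul, ← sub_eq_add_neg] at this

lemma specOp_add {m : ℕ → ℝ} {u v : L2 O} (hu : u ∈ specDomain e m)
    (hv : v ∈ specDomain e m) : specOp e m (u + v) = specOp e m u + specOp e m v :=
  ext_inner_basis e fun i => by
    rw [inner_add_right, inner_specOp hu, inner_specOp hv, inner_specOp (specDomain_add hu hv),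
      inner_add_right, mul_add]

lemma specOp_smul {m : ℕ → ℝ} {u : L2 O} (hu : u ∈ specDomain e m) (c : ℝ) :
    specOp e m (c • u) = c • specOp e m u :=
  ext_inner_basis e fun i => by
    rw [inner_smul_right, inner_specOp hu, inner_specOp (specDomain_smul hu c),
      inner_smul_right]; ring

lemma zero_mem_specDomain (m : ℕ → ℝ) : (0 : L2 O) ∈ specDomain e m := by
  simp [specDomain]

/-! ### The norm of `Ḣ¹` -/

lemma H1_add {u v : L2 O} (hu : u ∈ H1 e lam) (hv : v ∈ H1 e lam) : u + v ∈ H1 e lam :=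
  specDomain_add hu hv

lemma H1_sub {u v : L2 O} (hu : u ∈ H1 e lam) (hv : v ∈ H1 e lam) : u - v ∈ H1 e lam :=
  specDomain_sub hu hv

lemma H1_smul {u : L2 O} (hu : u ∈ H1 e lam) (c : ℝ) : c • u ∈ H1 e lam :=
  specDomain_smul hu c

lemma zero_mem_H1 : (0 : L2 O) ∈ H1 e lam := zero_mem_specDomain _

lemma h1norm_nonneg (u : L2 O) : 0 ≤ h1norm e lam u := Real.sqrt_nonneg _

lemma h1norm_eq (hl : ∀ i, 0 < lam i) {u : L2 O} (hu : u ∈ H1 e lam) :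
    h1norm e lam u = ‖specOp e (fun i => √(lam i)) u‖ := by
  have h := hasSum_norm_sq e (specOp e (fun i => √(lam i)) u)
  rw [h1norm, ← Real.sqrt_sq (norm_nonneg (specOp e _ u)), ← h.tsum_eq]
  congr 2
  ext i
  rw [inner_specOp hu, mul_pow, Real.sq_sqrt (hl i).le]

lemma hasSum_h1norm_sq (hl : ∀ i, 0 < lam i) {u : L2 O} (hu : u ∈ H1 e lam) :
    HasSum (fun i => lam i * ⟪e i, u⟫_ℝ ^ 2) (h1norm e lam u ^ 2) := by
  rw [h1norm_eq hl hu]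
  refine (hasSum_norm_sq e (specOp e (fun i => √(lam i)) u)).congr_fun fun i => ?_
  rw [inner_specOp hu, mul_pow, Real.sq_sqrt (hl i).le]

lemma h1norm_add_le (hl : ∀ i, 0 < lam i) {u v : L2 O} (hu : u ∈ H1 e lam) (hv : v ∈ H1 e lam) :
    h1norm e lam (u + v) ≤ h1norm e lam u + h1norm e lam v := by
  rw [h1norm_eq hl hu, h1norm_eq hl hv, h1norm_eq hl (H1_add hu hv), specOp_add hu hv]
  exact norm_add_le _ _

lemma h1norm_smul (hl : ∀ i, 0 < lam i) {u : L2 O} (hu : u ∈ H1 e lam) (c : ℝ) :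
    h1norm e lam (c • u) = |c| * h1norm e lam u := by
  rw [h1norm_eq hl hu, h1norm_eq hl (H1_smul hu c), specOp_smul hu, norm_smul, Real.norm_eq_abs]

lemma h1norm_sub_le (hl : ∀ i, 0 < lam i) {u v : L2 O} (hu : u ∈ H1 e lam) (hv : v ∈ H1 e lam) :
    h1norm e lam (u - v) ≤ h1norm e lam u + h1norm e lam v := by
  have := h1norm_add_le hl hu (H1_smul hv (-1))
  rwa [h1norm_smul hl hv, neg_one_smul, ← sub_eq_add_neg, abs_neg, abs_one, one_mul] at this

lemma h1norm_zero : h1norm e lam (0 : L2 O) = 0 := by simp [h1norm]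

lemma norm_le_h1norm (he : IsDirichletEigenbasis e lam) {u : L2 O} (hu : u ∈ H1 e lam) :
    ‖u‖ ≤ (√(lam 0))⁻¹ * h1norm e lam u := by
  rw [h1norm_eq he.pos hu]
  have h0 := Real.sqrt_pos.2 (he.pos 0)
  have := norm_specOp_le (e := e) (m := fun _ => 1) (C := (√(lam 0))⁻¹) (by positivity) hu
    (fun i => by
      rw [abs_one, abs_of_nonneg (Real.sqrt_nonneg _), inv_mul_eq_div, le_div_iff₀ h0, one_mul]
      exact Real.sqrt_le_sqrt (he.mono (Nat.zero_le i)))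
  rwa [specOp_one] at this

/-! ### One step of the schemes -/

lemma inner_laplacian (hl : ∀ i, 0 < lam i) {w z : L2 O}
    (hw : w ∈ specDomain e fun i => -lam i) (hw1 : w ∈ H1 e lam) (hz : z ∈ H1 e lam) :
    ⟪laplacian e lam w, z⟫_ℝ =
      -⟪specOp e (fun i => √(lam i)) w, specOp e (fun i => √(lam i)) z⟫_ℝ := by
  have h1 := e.hasSum_inner_mul_inner (laplacian e lam w) z
  have h2 := (e.hasSum_inner_mul_inner (specOp e (fun i => √(lam i)) w)
    (specOp e (fun i => √(lam i)) z)).neg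
  refine h1.unique (h2.congr_fun fun i => ?_)
  rw [real_inner_comm, laplacian, inner_specOp hw, real_inner_comm (e i), inner_specOp hw1,
    inner_specOp hz]
  linear_combination (⟪e i, w⟫_ℝ * ⟪e i, z⟫_ℝ) * Real.mul_self_sqrt (hl i).le

variable {Ft : ℝ → ℝ} {δ₀ : ℝ}

/-- The purpose of the auxiliary variable: the factor (q + q')/2 in the drift turns the increment q'
- q into a difference of squares, so the work done by the nonlinearity is stored exactly in q². -/
lemma AuxStep.inner_drift {û u u' : L2 O} {q q' : ℝ} (h : AuxStep Ft δ₀ û u u' q q') :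
    ⟪drift Ft δ₀ û q q', u' - u⟫_ℝ = q' ^ 2 - q ^ 2 := by
  have h1 : ⟪f Ft û, u' - u⟫_ℝ / (2 * √(F Ft û + δ₀)) = q' - q := by rw [h]; ring
  have h2 : ⟪drift Ft δ₀ û q q', u' - u⟫_ℝ =
      (q + q') * (⟪f Ft û, u' - u⟫_ℝ / (2 * √(F Ft û + δ₀))) := by
    rw [drift, real_inner_smul_left]; ring
  rw [h2, h1]; ring

/-- The midpoint rule gives τ(v' + v + ξ) = 2(u' - u). Pairing the velocity equation with v' + (v +
ξ) therefore turns the Laplacian and the drift into pairings with u' - u, both of which are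
differences of squares. -/
lemma energy_midpoint (hl : ∀ i, 0 < lam i) {τ : ℝ} {û ξ u v u' v' : L2 O}
    {q q' : ℝ} (hu : u ∈ H1 e lam) (hu' : u' ∈ H1 e lam)
    (h : Step e lam Ft δ₀ .midpoint τ û ξ u v q u' v' q') :
    h1norm e lam u' ^ 2 + ‖v'‖ ^ 2 + 2 * q' ^ 2 =
      h1norm e lam u ^ 2 + ‖v + ξ‖ ^ 2 + 2 * q ^ 2 := by
  obtain ⟨haux, h1, hdom, h2⟩ := h
  have hφ := haux.inner_drift
  have hL := inner_laplacian hl hdom (H1_add hu hu') (H1_sub hu' hu)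
  set φ := drift Ft δ₀ û q q'
  set L := laplacian e lam (u + u')
  have hsub : specOp e (fun i => √(lam i)) (u' - u) =
      specOp e (fun i => √(lam i)) u' - specOp e (fun i => √(lam i)) u := by
    have := specOp_add hu (H1_sub hu' hu)
    rw [add_sub_cancel] at this
    rw [this]; abel
  have hw : τ • (v' + (v + ξ)) = (2 : ℝ) • (u' - u) := by
    rw [h1]; module
  have hv : v' - (v + ξ) = τ • ((1 / 2 : ℝ) • L - φ) := by
    nth_rewrite 1 [h2]; module
  have hE : ⟪v' - (v + ξ), v' + (v + ξ)⟫_ℝ = ⟪L, u' - u⟫_ℝ - 2 * ⟪φ, u' - u⟫_ℝ := by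
    rw [hv, real_inner_smul_left, ← real_inner_smul_right, hw, inner_sub_left,
      real_inner_smul_right, real_inner_smul_right, real_inner_smul_left]
    ring
  rw [hL, hφ, specOp_add hu hu', hsub] at hE
  rw [h1norm_eq hl hu, h1norm_eq hl hu']
  have e1 : ∀ a b : L2 O, ⟪a - b, a + b⟫_ℝ = ‖a‖ ^ 2 - ‖b‖ ^ 2 := fun a b => by
    rw [inner_sub_left, inner_add_right, inner_add_right, real_inner_self_eq_norm_sq,
      real_inner_self_eq_norm_sq, real_inner_comm a]
    ring
  have e2 : ∀ a b : L2 O, ⟪a + b, b - a⟫_ℝ = ‖b‖ ^ 2 - ‖a‖ ^ 2 := fun a b => by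
    rw [inner_add_left, inner_sub_right, inner_sub_right, real_inner_self_eq_norm_sq,
      real_inner_self_eq_norm_sq, real_inner_comm b]
    ring
  rw [e1, e2] at hE
  linarith

lemma abs_sin_mul_div_le {τ x : ℝ} (hτ : 0 ≤ τ) (hx : 0 < x) :
    |x⁻¹ * Real.sin (τ * x)| ≤ τ := by
  rw [abs_mul, abs_of_pos (inv_pos.2 hx), inv_mul_le_iff₀ hx]
  refine (Real.abs_sin_le_abs).trans ?_
  rw [abs_of_nonneg (by positivity), mul_comm]

lemma abs_cos_sub_one_le (x : ℝ) : |Real.cos x - 1| ≤ |x| := by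
  have h1 := Real.one_sub_sq_div_two_le_cos (x := x)
  have h2 := Real.cos_le_one x
  have h3 := Real.neg_one_le_cos x
  rw [abs_of_nonpos (by linarith)]
  rcases le_total |x| 2 with h | h
  · have : x ^ 2 ≤ 2 * |x| := by
      rw [← sq_abs]; nlinarith [abs_nonneg x]
    linarith
  · linarith

lemma abs_inv_mul_cos_sub_one_le {τ x : ℝ} (hx : 0 < x) :
    |x⁻¹ * (Real.cos (τ * √x) - 1)| ≤ τ ^ 2 / 2 := by
  have h1 := Real.one_sub_sq_div_two_le_cos (x := τ * √x)
  have h2 := Real.cos_le_one (τ * √x)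
  rw [abs_mul, abs_of_pos (inv_pos.2 hx), inv_mul_le_iff₀ hx, abs_of_nonpos (by linarith)]
  rw [mul_pow, Real.sq_sqrt hx.le] at h1
  linarith

/-- By linearity of E(τ) the noise can be added to the velocity before the flow acts, so v and ξ
enter only through v + ξ. Along each eigenvector the step is a forced rotation. -/
lemma inner_exponential (hl : ∀ i, 0 < lam i) {τ : ℝ} (hτ : 0 ≤ τ) {ξ φ u v u' v' : L2 O}
    (hu : u ∈ H1 e lam)
    (h : (u', v') = waveGroup e lam τ (u, v)
        + waveGenInv e lam (waveGroup e lam τ (0, -φ) - (0, -φ)) + waveGroup e lam τ (0, ξ))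
    (i : ℕ) :
    ⟪e i, u'⟫_ℝ = Real.cos (τ * √(lam i)) * ⟪e i, u⟫_ℝ
        + (√(lam i))⁻¹ * Real.sin (τ * √(lam i)) * ⟪e i, v + ξ⟫_ℝ
        + (lam i)⁻¹ * (Real.cos (τ * √(lam i)) - 1) * ⟪e i, φ⟫_ℝ ∧
    ⟪e i, v'⟫_ℝ = -(√(lam i) * Real.sin (τ * √(lam i))) * ⟪e i, u⟫_ℝ
        + Real.cos (τ * √(lam i)) * ⟪e i, v + ξ⟫_ℝ
        - (√(lam i))⁻¹ * Real.sin (τ * √(lam i)) * ⟪e i, φ⟫_ℝ := by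
  have hc : ∀ w : L2 O, w ∈ specDomain e fun i => Real.cos (τ * √(lam i)) :=
    mem_specDomain_of_bounded (C := 1) fun i => Real.abs_cos_le_one _
  have hs : ∀ w : L2 O, w ∈ specDomain e fun i => (√(lam i))⁻¹ * Real.sin (τ * √(lam i)) :=
    mem_specDomain_of_bounded (C := τ) fun i =>
      abs_sin_mul_div_le hτ (Real.sqrt_pos.2 (hl i))
  have hss : ∀ w ∈ H1 e lam, w ∈ specDomain e fun i => -(√(lam i) * Real.sin (τ * √(lam i))) :=
    fun w hw => mem_specDomain_of_le (C := 1) hw fun i => by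
      rw [abs_neg, abs_mul, one_mul]
      exact mul_le_of_le_one_right (abs_nonneg _) (Real.abs_sin_le_one _)
  -- The quotient (cos - 1)/λ is at most τ²/2 in absolute value, which gives membership without a
  -- lower bound on the eigenvalues.
  have hy : (specOp e (fun i => Real.cos (τ * √(lam i))) (-φ) - -φ)
      ∈ specDomain e fun i => -(lam i)⁻¹ := by
    have h1 : Summable fun i => ((lam i)⁻¹ * (Real.cos (τ * √(lam i)) - 1) * ⟪e i, φ⟫_ℝ) ^ 2 :=
      mem_specDomain_of_bounded (C := τ ^ 2 / 2) (fun i => abs_inv_mul_cos_sub_one_le (hl i)) φ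
    refine h1.congr fun i => ?_
    rw [inner_sub_right, inner_specOp (hc _), inner_neg_right]
    ring
  have hz : ∀ m : ℕ → ℝ, specOp e m (0 : L2 O) = 0 := fun m =>
    ext_inner_basis e fun i => by rw [inner_specOp (zero_mem_specDomain m)]; simp
  rw [Prod.ext_iff] at h
  simp only [waveGroup, waveGenInv, Prod.fst_add, Prod.snd_add, Prod.fst_sub, Prod.snd_sub, hz,
    zero_add, sub_zero] at h
  constructor
  · rw [h.1]
    simp only [inner_add_right]
    rw [inner_specOp (hc _), inner_specOp (hs _), inner_specOp hy, inner_specOp (hs _),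
      inner_sub_right, inner_specOp (hc _), inner_neg_right]
    ring
  · rw [h.2]
    simp only [inner_add_right]
    rw [inner_specOp (hc _), inner_specOp (hss _ hu), inner_specOp (hs _), inner_specOp (hc _),
      inner_neg_right]
    ring

/-- In each coordinate the rotation is isometric and the forcing contributes exactly -2⟨φ, u' - u⟩;
after summation over the basis this pairing is absorbed by q². -/
lemma energy_exponential (hl : ∀ i, 0 < lam i) {τ : ℝ} (hτ : 0 ≤ τ) {û ξ u v u' v' : L2 O}
    {q q' : ℝ} (hu : u ∈ H1 e lam) (hu' : u' ∈ H1 e lam)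
    (h : Step e lam Ft δ₀ .exponential τ û ξ u v q u' v' q') :
    h1norm e lam u' ^ 2 + ‖v'‖ ^ 2 + 2 * q' ^ 2 =
      h1norm e lam u ^ 2 + ‖v + ξ‖ ^ 2 + 2 * q ^ 2 := by
  obtain ⟨haux, h1⟩ := h
  have hφ := haux.inner_drift
  set φ := drift Ft δ₀ û q q'
  have hi := inner_exponential hl hτ hu h1
  have s1 := ((hasSum_h1norm_sq hl hu').add (hasSum_norm_sq e v')).add
    ((e.hasSum_inner_mul_inner φ (u' - u)).mul_left 2)
  have s2 := (hasSum_h1norm_sq hl hu).add (hasSum_norm_sq e (v + ξ))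
  have key := s1.unique (s2.congr_fun fun i => ?_)
  · rw [hφ] at key
    linarith
  · rw [inner_sub_right, real_inner_comm (e i) φ, (hi i).1, (hi i).2]
    have hL := hl i
    have hl2 : lam i = √(lam i) ^ 2 := (Real.sq_sqrt hL.le).symm
    have hs := Real.sin_sq (τ * √(lam i))
    have hp := Real.sqrt_pos.2 hL
    rw [hl2, Real.sqrt_sq hp.le]
    generalize √(lam i) = r at *
    generalize Real.cos (τ * r) = c at *
    generalize Real.sin (τ * r) = s at *
    generalize ⟪e i, u⟫_ℝ = a
    generalize ⟪e i, v + ξ⟫_ℝ = b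
    generalize ⟪e i, φ⟫_ℝ = p
    field_simp
    -- With denominators cleared, the two sides differ by a multiple of sin² + cos² - 1.
    linear_combination (r ^ 4 * a ^ 2 + r ^ 2 * b ^ 2 + p ^ 2 + 2 * a * p * r ^ 2) * hs

lemma energy_step (hl : ∀ i, 0 < lam i) {s : Scheme} {τ : ℝ} (hτ : 0 ≤ τ) {û ξ u v u' v' : L2 O}
    {q q' : ℝ} (hu : u ∈ H1 e lam) (hu' : u' ∈ H1 e lam)
    (h : Step e lam Ft δ₀ s τ û ξ u v q u' v' q') :
    h1norm e lam u' ^ 2 + ‖v'‖ ^ 2 + 2 * q' ^ 2 =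
      h1norm e lam u ^ 2 + ‖v + ξ‖ ^ 2 + 2 * q ^ 2 := by
  cases s with
  | midpoint => exact energy_midpoint hl hu hu' h
  | exponential => exact energy_exponential hl hτ hu hu' h

/-- The increment has order τ rather than √τ: the noise reaches u only through τ/2 or sin(τ√λ)/√λ.
In the exponential scheme |cos(τ√λ) - 1| ≤ τ√λ costs one Ḣ¹ norm of u. The right-hand side carries
the terms of both schemes. -/
lemma norm_increment_le (hl : ∀ i, 0 < lam i) {s : Scheme} {τ : ℝ} (hτ : 0 ≤ τ)
    {û ξ u v u' v' : L2 O} {q q' : ℝ} (hu : u ∈ H1 e lam)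
    (h : Step e lam Ft δ₀ s τ û ξ u v q u' v' q') :
    ‖u' - u‖ ≤ τ * (h1norm e lam u + ‖v‖ + ‖v'‖ + ‖ξ‖ + τ * ‖drift Ft δ₀ û q q'‖) := by
  have hn := h1norm_nonneg (e := e) (lam := lam) u
  cases s with
  | midpoint =>
    obtain ⟨-, h1, -⟩ := h
    have : u' - u = (τ / 2) • (v + v' + ξ) := by rw [h1]; module
    rw [this, norm_smul, Real.norm_of_nonneg (by positivity)]
    have h2 := norm_add₃_le (a := v) (b := v') (c := ξ)
    have h3 : (τ / 2) * ‖v + v' + ξ‖ ≤ (τ / 2) * (‖v‖ + ‖v'‖ + ‖ξ‖) := by gcongr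
    have : 0 ≤ τ * h1norm e lam u := by positivity
    have : 0 ≤ τ * (τ * ‖drift Ft δ₀ û q q'‖) := by positivity
    have : 0 ≤ τ * (‖v‖ + ‖v'‖ + ‖ξ‖) := by positivity
    linarith
  | exponential =>
    obtain ⟨-, h1⟩ := h
    set φ := drift Ft δ₀ û q q'
    have hi := inner_exponential hl hτ hu h1
    have b1 : ∀ i, |Real.cos (τ * √(lam i)) - 1| ≤ τ * |√(lam i)| := fun i => by
      have := abs_cos_sub_one_le (τ * √(lam i))
      rwa [abs_mul, abs_of_nonneg hτ] at this
    have b2 : ∀ i, |(√(lam i))⁻¹ * Real.sin (τ * √(lam i))| ≤ τ := fun i =>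
      abs_sin_mul_div_le hτ (Real.sqrt_pos.2 (hl i))
    have b3 : ∀ i, |(lam i)⁻¹ * (Real.cos (τ * √(lam i)) - 1)| ≤ τ ^ 2 / 2 := fun i =>
      abs_inv_mul_cos_sub_one_le (hl i)
    have hd : u' - u = specOp e (fun i => Real.cos (τ * √(lam i)) - 1) u
        + specOp e (fun i => (√(lam i))⁻¹ * Real.sin (τ * √(lam i))) (v + ξ)
        + specOp e (fun i => (lam i)⁻¹ * (Real.cos (τ * √(lam i)) - 1)) φ :=
      ext_inner_basis e fun i => by
        simp only [inner_sub_right, (hi i).1, inner_add_right]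
        rw [inner_specOp (mem_specDomain_of_le hu b1),
          inner_specOp (mem_specDomain_of_bounded b2 _),
          inner_specOp (mem_specDomain_of_bounded b3 _), inner_add_right]
        ring
    have n1 := norm_specOp_le hτ hu b1
    rw [← h1norm_eq hl hu] at n1
    have n2 := norm_specOp_le_of_bounded (e := e) b2 (v + ξ)
    have n3 := norm_specOp_le_of_bounded (e := e) b3 φ
    have n4 : τ * ‖v + ξ‖ ≤ τ * (‖v‖ + ‖ξ‖) := by gcongr; exact norm_add_le _ _
    have n5 : 0 ≤ τ ^ 2 * ‖φ‖ := by positivity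
    have n6 : 0 ≤ τ * ‖v'‖ := by positivity
    rw [hd]
    refine (norm_add₃_le).trans ?_
    linarith

end Spectral

/-! ### Taylor's formula under an integral, and polynomial bounds. -/

section Calculus

/-- Taylor's formula with integral remainder inside an integral. -/
lemma integral_comp_sub_mul_eq {X : Type*} [MeasurableSpace X] {μ : Measure X} [SigmaFinite μ]
    {φ : ℝ → ℝ} (hφ : Differentiable ℝ φ) {a b m : X → ℝ} (ha : Measurable a) (hb : Measurable b)
    (hm : Measurable m) {K : ℝ≥0∞} (hK : K ≠ ∞)
    (hfin : ∀ s ∈ Set.Ioc (0 : ℝ) 1, ∫⁻ x, ‖deriv φ (a x + s * b x) * b x * m x‖ₑ ∂μ ≤ K) :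
    IntervalIntegrable (fun s => ∫ x, deriv φ (a x + s * b x) * b x * m x ∂μ) volume 0 1 ∧
    ∫ x, (φ (a x + b x) - φ (a x)) * m x ∂μ =
      ∫ s in (0 : ℝ)..1, ∫ x, deriv φ (a x + s * b x) * b x * m x ∂μ := by
  set κ : Measure ℝ := volume.restrict (Set.Ioc 0 1) with hκ
  have hmeas : Measurable fun z : ℝ × X => deriv φ (a z.2 + z.1 * b z.2) * b z.2 * m z.2 := by
    have := measurable_deriv φ
    fun_prop
  -- The bound is uniform in s and the interval has finite length, so the integrand is integrable on
  -- the product space and Fubini applies.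
  have hint : Integrable (fun z : ℝ × X => deriv φ (a z.2 + z.1 * b z.2) * b z.2 * m z.2)
      (κ.prod μ) := by
    refine ⟨hmeas.aestronglyMeasurable, ?_⟩
    rw [HasFiniteIntegral, lintegral_prod _ hmeas.enorm.aemeasurable]
    refine (lintegral_mono_ae (g := fun _ => K) ?_).trans_lt ?_
    · exact (ae_restrict_iff' measurableSet_Ioc).2 (ae_of_all _ hfin)
    · rw [lintegral_const, hκ]
      simp [hK.lt_top]
  refine ⟨?_, ?_⟩
  · rw [intervalIntegrable_iff_integrableOn_Ioc_of_le zero_le_one]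
    exact hint.integral_prod_left
  rw [intervalIntegral.integral_of_le zero_le_one,
    integral_integral_swap (f := fun s x => deriv φ (a x + s * b x) * b x * m x) hint]
  refine integral_congr_ae ?_
  filter_upwards [hint.prod_left_ae] with x hx
  have hd : ∀ s : ℝ, HasDerivAt (fun s => φ (a x + s * b x) * m x)
      (deriv φ (a x + s * b x) * b x * m x) s := fun s => by
    have h1 : HasDerivAt (fun s => a x + s * b x) (b x) s := by
      simpa using ((hasDerivAt_id s).mul_const (b x)).const_add (a x)
    exact ((hφ _).hasDerivAt.comp s h1).mul_const _
  -- The derivative of φ need not be continuous; integrability in s suffices for the fundamental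
  -- theorem, and Fubini supplies it for almost every x.
  have := intervalIntegral.integral_eq_sub_of_hasDerivAt (a := 0) (b := 1) (fun s _ => hd s)
    ((intervalIntegrable_iff_integrableOn_Ioc_of_le zero_le_one).2 hx)
  rw [intervalIntegral.integral_of_le zero_le_one] at this
  rw [this]
  simp only [one_mul, zero_mul, add_zero]
  ring

lemma lintegral_enorm_mul_le {X : Type*} [MeasurableSpace X] {μ : Measure X} {a b : X → ℝ}
    (ha : AEStronglyMeasurable a μ) (hb : AEStronglyMeasurable b μ) :
    ∫⁻ x, ‖a x * b x‖ₑ ∂μ ≤ eLpNorm a 2 μ * eLpNorm b 2 μ := by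
  have := eLpNorm_smul_le_mul_eLpNorm (p := 2) (q := 2) (r := 1) hb ha
  rw [eLpNorm_one_eq_lintegral_enorm] at this
  exact this

lemma exists_polynomial_bound (p : Polynomial ℝ) :
    ∃ (K : ℝ) (L : ℕ), 0 ≤ K ∧ ∀ M : ℝ, 1 ≤ M → ∀ x : ℝ, |x| ≤ M → |p.eval x| ≤ K * M ^ L := by
  refine ⟨∑ i ∈ p.support, |p.coeff i|, p.natDegree, by positivity, fun M hM x hx => ?_⟩
  rw [Polynomial.eval_eq_sum, Polynomial.sum, Finset.sum_mul]
  refine (Finset.abs_sum_le_sum_abs _ _).trans (Finset.sum_le_sum fun i hi => ?_)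
  rw [abs_mul, abs_pow]
  have h1 : |x| ^ i ≤ M ^ i := pow_le_pow_left₀ (abs_nonneg _) hx i
  have h2 : M ^ i ≤ M ^ p.natDegree :=
    pow_le_pow_right₀ hM (Polynomial.le_natDegree_of_mem_supp i hi)
  gcongr
  exact h1.trans h2

/-- Replaces the polynomials of the assumptions by one monomial in a common bound M ≥ 1 of the
arguments, a form that is easy to compose. -/
lemma exists_mvPolynomial_bound {σ : Type*} (p : MvPolynomial σ ℝ) :
    ∃ (K : ℝ) (L : ℕ), 0 ≤ K ∧ ∀ M : ℝ, 1 ≤ M → ∀ x : σ → ℝ, (∀ i, |x i| ≤ M) →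
      |MvPolynomial.eval x p| ≤ K * M ^ L := by
  induction p using MvPolynomial.induction_on with
  | C a => exact ⟨|a|, 0, abs_nonneg _, fun M _ x _ => by simp⟩
  | add p q hp hq =>
    obtain ⟨K, L, hK, h⟩ := hp
    obtain ⟨K', L', hK', h'⟩ := hq
    refine ⟨K + K', max L L', by positivity, fun M hM x hx => ?_⟩
    rw [map_add, add_mul]
    refine (abs_add_le _ _).trans (add_le_add ((h M hM x hx).trans ?_) ((h' M hM x hx).trans ?_))
    · gcongr
      exact le_max_left _ _
    · gcongr
      exact le_max_right _ _
  | mul_X p i hp =>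
    obtain ⟨K, L, hK, h⟩ := hp
    refine ⟨K, L + 1, hK, fun M hM x hx => ?_⟩
    rw [map_mul, MvPolynomial.eval_X, abs_mul, pow_succ, ← mul_assoc]
    gcongr
    exacts [h M hM x hx, hx i]

end Calculus

/-! ### Taylor estimates for F and for its square root. -/

section Coefficients

variable {d : ℕ} {O : Opens (EuclideanSpace ℝ (Fin d))}
variable {e : HilbertBasis ℕ ℝ (L2 O)} {lam : ℕ → ℝ} {R : L2 O →L[ℝ] L2 O}
variable {Ft : ℝ → ℝ} {g : L2 O × (Fin d → L2 O) → (CM R →ₗ[ℝ] L2 O)} {k : ℕ} {δ₀ : ℝ}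

lemma inner_eq_integral (x y : L2 O) : ⟪x, y⟫_ℝ = ∫ a, x a * y a ∂(vol O) := by
  rw [L2.inner_def]
  refine integral_congr_ae (ae_of_all _ fun a => ?_)
  simp [mul_comm]

lemma coeFn_line (z w : L2 O) (s : ℝ) :
    (z + s • w : L2 O) =ᵐ[vol O] fun x => z x + s * w x := by
  filter_upwards [Lp.coeFn_add z (s • w), Lp.coeFn_smul s w] with x h1 h2
  rw [h1, Pi.add_apply, h2, Pi.smul_apply, smul_eq_mul]

lemma CoefficientAssumption.coeFn_f (hcoef : CoefficientAssumption e lam R Ft g k δ₀) {u : L2 O}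
    (hu : u ∈ H1 e lam) : f Ft u =ᵐ[vol O] fun x => deriv Ft (u x) := by
  rw [f, dif_pos (hcoef.f_memLp u hu)]
  exact MemLp.coeFn_toLp _

lemma CoefficientAssumption.coeFn_f_line (hcoef : CoefficientAssumption e lam R Ft g k δ₀)
    {z w : L2 O} (hz : z ∈ H1 e lam) (hw : w ∈ H1 e lam) (s : ℝ) :
    f Ft (z + s • w) =ᵐ[vol O] fun x => deriv Ft (z x + s * w x) := by
  filter_upwards [hcoef.coeFn_f (H1_add hz (H1_smul hw s)), coeFn_line z w s] with x h1 h2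
  rw [h1, h2]

lemma h1norm_line_le (hl : ∀ i, 0 < lam i) {z w : L2 O} (hz : z ∈ H1 e lam)
    (hw : w ∈ H1 e lam) {s : ℝ} (hs : s ∈ Set.Icc (0 : ℝ) 1) :
    h1norm e lam (z + s • w) ≤ h1norm e lam z + h1norm e lam w := by
  refine (h1norm_add_le hl hz (H1_smul hw s)).trans ?_
  rw [h1norm_smul hl hw, abs_of_nonneg hs.1]
  have := mul_le_of_le_one_left (h1norm_nonneg (e := e) (lam := lam) w) hs.2
  linarith

lemma h1norm_segment_le (hl : ∀ i, 0 < lam i) {z w : L2 O} (hz : z ∈ H1 e lam)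
    (hw : w ∈ H1 e lam) {s M : ℝ} (hs : s ∈ Set.Icc (0 : ℝ) 1) (hzM : h1norm e lam z ≤ M)
    (hwM : h1norm e lam w ≤ M) : h1norm e lam (z + s • (w - z)) ≤ M := by
  have h : z + s • (w - z) = (1 - s) • z + s • w := by module
  rw [h]
  refine (h1norm_add_le hl (H1_smul hz _) (H1_smul hw _)).trans ?_
  rw [h1norm_smul hl hz, h1norm_smul hl hw, abs_of_nonneg hs.1,
    abs_of_nonneg (sub_nonneg.2 hs.2)]
  nlinarith [mul_le_mul_of_nonneg_left hzM (sub_nonneg.2 hs.2),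
    mul_le_mul_of_nonneg_left hwM hs.1]

/-- f is the gradient of F along segments in Ḣ¹. The growth bound on f gives the uniform bound
needed for Fubini; integrability of F̃(u) is part of the coercivity assumption. -/
lemma CoefficientAssumption.F_sub_eq (hcoef : CoefficientAssumption e lam R Ft g k δ₀)
    (hl : ∀ i, 0 < lam i) {u h : L2 O} (hu : u ∈ H1 e lam) (hh : h ∈ H1 e lam) :
    IntervalIntegrable (fun s : ℝ => ⟪f Ft (u + s • h), h⟫_ℝ) volume 0 1 ∧
    F Ft (u + h) - F Ft u = ∫ s in (0 : ℝ)..1, ⟪f Ft (u + s • h), h⟫_ℝ := by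
  obtain ⟨b₁, -, hb₁⟩ := hcoef.f_growth
  obtain ⟨K, L, hK, hKL⟩ := exists_polynomial_bound b₁
  set M := 1 + h1norm e lam u + h1norm e lam h
  have hun := h1norm_nonneg (e := e) (lam := lam) u
  have hhn := h1norm_nonneg (e := e) (lam := lam) h
  have hM : 1 ≤ M := by simp only [M]; linarith
  have hfb : ∀ s ∈ Set.Icc (0 : ℝ) 1, ‖f Ft (u + s • h)‖ ≤ K * M ^ L := fun s hs => by
    refine (hb₁ _ (H1_add hu (H1_smul hh s))).trans ((le_abs_self _).trans (hKL M hM _ ?_))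
    rw [abs_of_nonneg (h1norm_nonneg _)]
    have := h1norm_line_le hl hu hh hs
    simp only [M]; linarith
  have hEq : ∀ s : ℝ, ∫ x, deriv Ft (u x + s * h x) * h x * (1 : ℝ) ∂(vol O) =
      ⟪f Ft (u + s • h), h⟫_ℝ := fun s => by
    rw [inner_eq_integral]
    refine integral_congr_ae ?_
    filter_upwards [hcoef.coeFn_f_line hu hh s] with x hx
    rw [hx, mul_one]
  have key := integral_comp_sub_mul_eq (μ := vol O) hcoef.diff (a := u) (b := h)
    (m := fun _ => 1) (Lp.stronglyMeasurable u).measurable (Lp.stronglyMeasurable h).measurable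
    measurable_const (K := ENNReal.ofReal (K * M ^ L * ‖h‖)) ENNReal.ofReal_ne_top (fun s hs => by
      have h1 := lintegral_enorm_mul_le (μ := vol O)
        (Lp.aestronglyMeasurable (f Ft (u + s • h))) (Lp.aestronglyMeasurable h)
      have h2 : ∫⁻ x, ‖deriv Ft (u x + s * h x) * h x * (1 : ℝ)‖ₑ ∂(vol O) =
          ∫⁻ x, ‖f Ft (u + s • h) x * h x‖ₑ ∂(vol O) := by
        refine lintegral_congr_ae ?_
        filter_upwards [hcoef.coeFn_f_line hu hh s] with x hx
        rw [hx, mul_one]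
      rw [h2]
      refine h1.trans ?_
      rw [← Lp.enorm_def, ← Lp.enorm_def, ← ofReal_norm, ← ofReal_norm,
        ← ENNReal.ofReal_mul (norm_nonneg _)]
      refine ENNReal.ofReal_le_ofReal ?_
      gcongr
      exact hfb s ⟨hs.1.le, hs.2⟩)
  simp only [hEq] at key
  refine ⟨key.1, ?_⟩
  rw [← key.2]
  obtain ⟨c₃, c₄, -, -, hco⟩ := hcoef.coercive
  have e1 : F Ft (u + h) = ∫ x, Ft (u x + h x) ∂(vol O) := by
    refine integral_congr_ae ?_
    filter_upwards [Lp.coeFn_add u h] with x hx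
    rw [hx, Pi.add_apply]
  have i1 : Integrable (fun x => Ft (u x + h x)) (vol O) := by
    refine (hco _ (H1_add hu hh)).2.1.congr ?_
    filter_upwards [Lp.coeFn_add u h] with x hx
    rw [hx, Pi.add_apply]
  rw [e1, F, ← integral_sub i1 (hco u hu).2.1]
  simp

/-- The assumptions on `f` in the form in which they are used: polynomial bounds on balls. -/
structure PolyBound (e : HilbertBasis ℕ ℝ (L2 O)) (lam : ℕ → ℝ) (Ft : ℝ → ℝ) (γ K : ℝ) (L : ℕ) :
    Prop where
  nonneg : 0 ≤ K
  growth : ∀ M : ℝ, 1 ≤ M → ∀ u ∈ H1 e lam, h1norm e lam u ≤ M → ‖f Ft u‖ ≤ K * M ^ L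
  lipschitz : ∀ M : ℝ, 1 ≤ M → ∀ u ∈ H1 e lam, ∀ u' ∈ H1 e lam, h1norm e lam u ≤ M →
    h1norm e lam u' ≤ M → ‖f Ft u - f Ft u'‖ ≤ K * M ^ L * h1norm e lam (u - u')
  deriv : ∀ M : ℝ, 1 ≤ M → ∀ u ∈ H1 e lam, ∀ v ∈ H1 e lam, ∀ w ∈ H1 e lam, h1norm e lam u ≤ M →
    h1norm e lam v ≤ M → h1norm e lam w ≤ M →
    |∫ y, deriv (deriv Ft) (u y) * v y * w y ∂(vol O)| ≤ K * M ^ L * ‖v‖ ^ γ * ‖w‖ ^ γ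

lemma CoefficientAssumption.exists_polyBound (hcoef : CoefficientAssumption e lam R Ft g k δ₀)
    {γ : ℝ} {b₅ : MvPolynomial (Fin 3) ℝ}
    (hb₅ : ∀ u ∈ H1 e lam, ∀ v ∈ H1 e lam, ∀ w ∈ H1 e lam,
      Integrable (fun y => deriv (deriv Ft) (u y) * v y * w y) (vol O) ∧
      |∫ y, deriv (deriv Ft) (u y) * v y * w y ∂(vol O)| ≤
        MvPolynomial.eval ![h1norm e lam u, h1norm e lam v, h1norm e lam w] b₅
          * ‖v‖ ^ γ * ‖w‖ ^ γ) :
    ∃ K L, PolyBound e lam Ft γ K L := by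
  obtain ⟨b₁, -, h₁⟩ := hcoef.f_growth
  obtain ⟨b₂, -, h₂⟩ := hcoef.f_lipschitz
  obtain ⟨K₁, L₁, hK₁, hp₁⟩ := exists_polynomial_bound b₁
  obtain ⟨K₂, L₂, hK₂, hp₂⟩ := exists_mvPolynomial_bound b₂
  obtain ⟨K₅, L₅, hK₅, hp₅⟩ := exists_mvPolynomial_bound b₅
  have hle : ∀ M : ℝ, 1 ≤ M → K₁ * M ^ L₁ ≤ (K₁ + K₂ + K₅) * M ^ (L₁ + L₂ + L₅) ∧
      K₂ * M ^ L₂ ≤ (K₁ + K₂ + K₅) * M ^ (L₁ + L₂ + L₅) ∧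
      K₅ * M ^ L₅ ≤ (K₁ + K₂ + K₅) * M ^ (L₁ + L₂ + L₅) := fun M hM => by
    refine ⟨?_, ?_, ?_⟩ <;> gcongr <;> first | exact hM | linarith
  have hn : ∀ u : L2 O, |h1norm e lam u| = h1norm e lam u := fun u =>
    abs_of_nonneg (h1norm_nonneg u)
  refine ⟨K₁ + K₂ + K₅, L₁ + L₂ + L₅, by positivity, ?_, ?_, ?_⟩
  · intro M hM u hu huM
    exact (h₁ u hu).trans ((le_abs_self _).trans ((hp₁ M hM _ (by rwa [hn])).trans (hle M hM).1))
  · intro M hM u hu u' hu' huM huM'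
    refine (h₂ u hu u' hu').trans (mul_le_mul_of_nonneg_right ((le_abs_self _).trans
      ((hp₂ M hM _ ?_).trans (hle M hM).2.1)) (h1norm_nonneg _))
    intro i
    fin_cases i <;> simpa [hn]
  · intro M hM u hu v hv w hw huM hvM hwM
    refine (hb₅ u hu v hv w hw).2.trans ?_
    gcongr
    refine (le_abs_self _).trans ((hp₅ M hM _ ?_).trans (hle M hM).2.2)
    intro i
    fin_cases i <;> simpa [hn]

/-- Fatou: the derivative of the Nemytskii operator is bounded from `Ḣ¹` to `L²`. -/
lemma CoefficientAssumption.eLpNorm_deriv_f_le (hcoef : CoefficientAssumption e lam R Ft g k δ₀)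
    (hl : ∀ i, 0 < lam i) (hf' : Differentiable ℝ (deriv Ft)) {γ K : ℝ} {L : ℕ}
    (hB : PolyBound e lam Ft γ K L) {u w : L2 O} (hu : u ∈ H1 e lam) (hw : w ∈ H1 e lam) {M : ℝ}
    (hM : 1 ≤ M) (huM : h1norm e lam u + h1norm e lam w ≤ M) :
    eLpNorm (fun x => deriv (deriv Ft) (u x) * w x) 2 (vol O) ≤
      ENNReal.ofReal (K * M ^ L * h1norm e lam w) := by
  have hun := h1norm_nonneg (e := e) (lam := lam) u
  have hwn := h1norm_nonneg (e := e) (lam := lam) w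
  set t : ℕ → ℝ := fun n => ((n : ℝ) + 1)⁻¹ with ht
  have htpos : ∀ n, 0 < t n := fun n => by positivity
  have htle : ∀ n, t n ≤ 1 := fun n => inv_le_one_of_one_le₀ (by linarith [n.cast_nonneg (α := ℝ)])
  have htlim : Tendsto t atTop (𝓝[≠] 0) := by
    rw [tendsto_nhdsWithin_iff]
    exact ⟨tendsto_inv_atTop_zero.comp (tendsto_atTop_add_const_right _ _
      tendsto_natCast_atTop_atTop), Eventually.of_forall fun n => (htpos n).ne'⟩
  -- Difference quotients of f at u in direction w: they converge almost everywhere to f'(u)w, and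
  -- the Lipschitz estimate bounds them in L², so Fatou's lemma applies.
  set q : ℕ → L2 O := fun n => (t n)⁻¹ • (f Ft (u + t n • w) - f Ft u) with hq
  have hqlim : ∀ᵐ x ∂(vol O), Tendsto (fun n => q n x) atTop
      (𝓝 (deriv (deriv Ft) (u x) * w x)) := by
    have h1 : ∀ᵐ x ∂(vol O), ∀ n, q n x = (t n)⁻¹ * (deriv Ft (u x + t n * w x) -
        deriv Ft (u x)) := by
      rw [ae_all_iff]
      intro n
      filter_upwards [Lp.coeFn_smul (t n)⁻¹ (f Ft (u + t n • w) - f Ft u),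
        Lp.coeFn_sub (f Ft (u + t n • w)) (f Ft u), hcoef.coeFn_f_line hu hw (t n),
        hcoef.coeFn_f hu] with x a1 a2 a3 a4
      rw [hq]
      simp only
      rw [a1, Pi.smul_apply, a2, Pi.sub_apply, a3, a4, smul_eq_mul]
    filter_upwards [h1] with x hx
    simp_rw [hx]
    have h2 : HasDerivAt (fun s => deriv Ft (u x + s * w x)) (deriv (deriv Ft) (u x) * w x) 0 := by
      have h3 : HasDerivAt (fun s => u x + s * w x) (w x) 0 := by
        simpa using ((hasDerivAt_id (0 : ℝ)).mul_const (w x)).const_add (u x)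
      have h4 : HasDerivAt (deriv Ft) (deriv (deriv Ft) (u x)) (u x + 0 * w x) := by
        simpa using (hf' (u x)).hasDerivAt
      exact h4.comp (0 : ℝ) h3
    have h5 := h2.tendsto_slope.comp htlim
    refine h5.congr fun n => ?_
    simp [slope_def_field, div_eq_inv_mul]
  refine (Lp.eLpNorm_lim_le_liminf_eLpNorm (fun n => Lp.aestronglyMeasurable (q n)) _
    hqlim).trans ?_
  refine liminf_le_of_le (by isBoundedDefault) fun b hb => ?_
  obtain ⟨n, hn⟩ := hb.exists
  refine hn.trans ?_
  rw [← Lp.enorm_def, ← ofReal_norm]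
  refine ENNReal.ofReal_le_ofReal ?_
  have h6 := hB.lipschitz M hM _ (H1_add hu (H1_smul hw (t n))) u hu
    ((h1norm_line_le hl hu hw ⟨(htpos n).le, htle n⟩).trans huM) (by linarith)
  rw [add_sub_cancel_left, h1norm_smul hl hw, abs_of_pos (htpos n)] at h6
  rw [hq]
  simp only
  rw [norm_smul, norm_inv, Real.norm_of_nonneg (htpos n).le, inv_mul_le_iff₀ (htpos n)]
  linarith

/-- The weak Lipschitz estimate on `f` that follows from the bound on `f'`. -/
lemma CoefficientAssumption.abs_inner_f_sub_le (hcoef : CoefficientAssumption e lam R Ft g k δ₀)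
    (hl : ∀ i, 0 < lam i) (hf' : Differentiable ℝ (deriv Ft)) {γ K : ℝ} {L : ℕ}
    (hB : PolyBound e lam Ft γ K L) {z w h : L2 O} (hz : z ∈ H1 e lam) (hw : w ∈ H1 e lam)
    (hh : h ∈ H1 e lam) {M : ℝ} (hM : 1 ≤ M) (hzM : h1norm e lam z ≤ M)
    (hwM : h1norm e lam w ≤ M) (hhM : h1norm e lam h ≤ M) :
    |⟪f Ft w - f Ft z, h⟫_ℝ| ≤ K * (2 * M) ^ L * ‖w - z‖ ^ γ * ‖h‖ ^ γ := by
  set b := w - z with hb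
  have hbH : b ∈ H1 e lam := H1_sub hw hz
  have hbM : h1norm e lam b ≤ 2 * M := by
    have := h1norm_sub_le hl hw hz
    linarith
  have hseg : ∀ s ∈ Set.Icc (0 : ℝ) 1, h1norm e lam (z + s • b) ≤ M := fun s hs =>
    h1norm_segment_le hl hz hw hs hzM hwM
  have hsH : ∀ s : ℝ, z + s • b ∈ H1 e lam := fun s => H1_add hz (H1_smul hbH s)
  have hcong : ∀ s : ℝ, (fun x => deriv (deriv Ft) ((z + s • b : L2 O) x) * b x * h x) =ᵐ[vol O]
      fun x => deriv (deriv Ft) (z x + s * b x) * b x * h x := fun s => by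
    filter_upwards [coeFn_line z b s] with x hx
    rw [hx]
  -- The radius 3M bounds the norm of z + sb plus that of b, at most M + 2M. This bound only
  -- justifies Fubini and does not enter the final estimate.
  have key := integral_comp_sub_mul_eq (μ := vol O) hf' (a := z) (b := b) (m := h)
    (Lp.stronglyMeasurable z).measurable (Lp.stronglyMeasurable b).measurable
    (Lp.stronglyMeasurable h).measurable
    (K := ENNReal.ofReal (K * (3 * M) ^ L * h1norm e lam b) * ‖h‖ₑ)
    (ENNReal.mul_ne_top ENNReal.ofReal_ne_top enorm_ne_top) (fun s hs => by
      have hs' : s ∈ Set.Icc (0 : ℝ) 1 := ⟨hs.1.le, hs.2⟩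
      have hce : ∫⁻ x, ‖deriv (deriv Ft) (z x + s * b x) * b x * h x‖ₑ ∂(vol O) =
          ∫⁻ x, ‖deriv (deriv Ft) ((z + s • b : L2 O) x) * b x * h x‖ₑ ∂(vol O) :=
        (lintegral_congr_ae ((hcong s).fun_comp fun y : ℝ => ‖y‖ₑ)).symm
      rw [hce]
      have hme : AEStronglyMeasurable (fun x => deriv (deriv Ft) ((z + s • b : L2 O) x) * b x)
          (vol O) := by
        refine AEStronglyMeasurable.mul ?_ (Lp.aestronglyMeasurable b)
        exact ((measurable_deriv (deriv Ft)).comp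
          (Lp.stronglyMeasurable (z + s • b)).measurable).aestronglyMeasurable
      refine (lintegral_enorm_mul_le hme (Lp.aestronglyMeasurable h)).trans ?_
      rw [← Lp.enorm_def]
      gcongr
      refine hcoef.eLpNorm_deriv_f_le hl hf' hB (hsH s) hbH (by linarith) ?_
      have := hseg s hs'
      linarith)
  have e1 : ⟪f Ft w - f Ft z, h⟫_ℝ =
      ∫ x, (deriv Ft (z x + b x) - deriv Ft (z x)) * h x ∂(vol O) := by
    rw [inner_eq_integral]
    refine integral_congr_ae ?_
    have h1 := hcoef.coeFn_f_line hz hbH 1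
    rw [one_smul, hb, add_sub_cancel, ← hb] at h1
    filter_upwards [Lp.coeFn_sub (f Ft w) (f Ft z), h1, hcoef.coeFn_f hz] with x a1 a2 a3
    rw [a1, Pi.sub_apply, a2, a3, one_mul]
  rw [e1, key.2, ← Real.norm_eq_abs]
  -- The γ bound on f' is now applied for each s, with radius 2M because w - z is only known to have
  -- norm at most 2M.
  refine (intervalIntegral.norm_integral_le_of_norm_le_const
    (C := K * (2 * M) ^ L * ‖b‖ ^ γ * ‖h‖ ^ γ) fun s hs => ?_).trans (by simp)
  rw [Set.uIoc_of_le zero_le_one] at hs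
  rw [Real.norm_eq_abs, ← integral_congr_ae (hcong s)]
  exact hB.deriv (2 * M) (by linarith) _ (hsH s) _ hbH _ hh
    ((hseg s ⟨hs.1.le, hs.2⟩).trans (by linarith)) hbM (by linarith)

lemma CoefficientAssumption.abs_F_sub_le (hcoef : CoefficientAssumption e lam R Ft g k δ₀)
    (hl : ∀ i, 0 < lam i) {γ K : ℝ} {L : ℕ}
    (hB : PolyBound e lam Ft γ K L) {z w : L2 O} (hz : z ∈ H1 e lam) (hw : w ∈ H1 e lam)
    {M : ℝ} (hM : 1 ≤ M) (hzM : h1norm e lam z ≤ M) (hwM : h1norm e lam w ≤ M) :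
    |F Ft w - F Ft z| ≤ K * M ^ L * ‖w - z‖ := by
  have h := (hcoef.F_sub_eq hl hz (H1_sub hw hz)).2
  rw [add_sub_cancel] at h
  rw [h, ← Real.norm_eq_abs]
  refine (intervalIntegral.norm_integral_le_of_norm_le_const
    (C := K * M ^ L * ‖w - z‖) fun s hs => ?_).trans (by simp)
  rw [Set.uIoc_of_le zero_le_one] at hs
  refine (norm_inner_le_norm _ _).trans ?_
  gcongr
  exact hB.growth M hM _ (H1_add hz (H1_smul (H1_sub hw hz) s))
    (h1norm_segment_le hl hz hw ⟨hs.1.le, hs.2⟩ hzM hwM)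

/-- The remainder pairs f(u + s(u' - u)) - f(z) with u' - u, and the weak Lipschitz estimate yields
D^(2γ) from L² distances alone. The strong Lipschitz bound on f would need an Ḣ¹ increment, which
need not be O(τ). The base point z may differ from u, as extrapolation requires. -/
lemma CoefficientAssumption.abs_F_taylor_le (hcoef : CoefficientAssumption e lam R Ft g k δ₀)
    (hl : ∀ i, 0 < lam i) (hf' : Differentiable ℝ (deriv Ft)) {γ K : ℝ} {L : ℕ} (hγ : 0 ≤ γ)
    (hB : PolyBound e lam Ft γ K L) {z u u' : L2 O} (hz : z ∈ H1 e lam) (hu : u ∈ H1 e lam)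
    (hu' : u' ∈ H1 e lam) {M D : ℝ} (hM : 1 ≤ M) (hzM : h1norm e lam z ≤ M)
    (huM : h1norm e lam u ≤ M) (huM' : h1norm e lam u' ≤ M) (hD : ‖u' - u‖ ≤ D)
    (hDz : ‖u - z‖ ≤ D) :
    |F Ft u' - F Ft u - ⟪f Ft z, u' - u⟫_ℝ| ≤ K * (4 * M) ^ L * (2 * D) ^ γ * D ^ γ := by
  have hD0 : 0 ≤ D := (norm_nonneg _).trans hD
  have hK := hB.nonneg
  have hh : u' - u ∈ H1 e lam := H1_sub hu' hu
  obtain ⟨hi, h⟩ := hcoef.F_sub_eq hl hu hh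
  rw [add_sub_cancel] at h
  have h1 : F Ft u' - F Ft u - ⟪f Ft z, u' - u⟫_ℝ =
      ∫ s in (0 : ℝ)..1, ⟪f Ft (u + s • (u' - u)) - f Ft z, u' - u⟫_ℝ := by
    simp_rw [inner_sub_left (𝕜 := ℝ) (f Ft _) (f Ft z)]
    rw [intervalIntegral.integral_sub hi intervalIntegrable_const, h]
    simp
  rw [h1, ← Real.norm_eq_abs]
  refine (intervalIntegral.norm_integral_le_of_norm_le_const
    (C := K * (4 * M) ^ L * (2 * D) ^ γ * D ^ γ) fun s hs => ?_).trans (by simp)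
  rw [Set.uIoc_of_le zero_le_one] at hs
  have hs' : s ∈ Set.Icc (0 : ℝ) 1 := ⟨hs.1.le, hs.2⟩
  -- The radius is doubled because u' - u is a difference of two points of the ball of radius M.
  have h2 := hcoef.abs_inner_f_sub_le hl hf' hB (M := 2 * M) hz
    (H1_add hu (H1_smul hh s)) hh (by linarith) (by linarith)
    ((h1norm_segment_le hl hu hu' hs' huM huM').trans (by linarith))
    ((h1norm_sub_le hl hu' hu).trans (by linarith))
  rw [Real.norm_eq_abs]
  refine h2.trans ?_
  have h3 : ‖u + s • (u' - u) - z‖ ≤ 2 * D := by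
    have h4 : u + s • (u' - u) - z = (u - z) + s • (u' - u) := by abel
    rw [h4]
    refine (norm_add_le _ _).trans ?_
    rw [norm_smul, Real.norm_of_nonneg hs'.1]
    have := mul_le_of_le_one_left (norm_nonneg (u' - u)) hs'.2
    linarith
  rw [← mul_assoc (2 : ℝ) 2 M, show (2 : ℝ) * 2 = 4 by norm_num]
  gcongr

lemma abs_sqrt_sub_sqrt_le {a b c : ℝ} (hc : 0 < c) (ha : c ≤ a) (hb : c ≤ b) :
    |√a - √b| ≤ |a - b| / (2 * √c) := by
  have hsc := Real.sqrt_pos.2 hc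
  have h1 := Real.sqrt_le_sqrt ha
  have h2 := Real.sqrt_le_sqrt hb
  have h3 : a - b = (√a - √b) * (√a + √b) := by
    rw [mul_comm, ← sq_sub_sq, Real.sq_sqrt (hc.le.trans ha), Real.sq_sqrt (hc.le.trans hb)]
  rw [le_div_iff₀ (by positivity), h3, abs_mul, abs_of_pos (by linarith : 0 < √a + √b)]
  gcongr
  linarith

/-- Dividing a' - a by √a' + √a separates the Taylor error of a from the error of replacing √a' + √a
by 2√z. The second is a product of the small quantities i and B. -/
lemma abs_sqrt_taylor_le {a a' z i c A B : ℝ} (hc : 0 < c) (ha : c ≤ a) (ha' : c ≤ a')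
    (hz : c ≤ z) (hi : |a' - a - i| ≤ A) (hza : |z - a| ≤ B) (hza' : |z - a'| ≤ B) :
    |√a' - √a - i / (2 * √z)| ≤ A / (2 * √c) + |i| * B / (4 * c * √c) := by
  have hsc := Real.sqrt_pos.2 hc
  have h1 := Real.sqrt_le_sqrt ha
  have h2 := Real.sqrt_le_sqrt ha'
  have h3 := Real.sqrt_le_sqrt hz
  have hd := abs_sqrt_sub_sqrt_le hc hz ha
  have hd' := abs_sqrt_sub_sqrt_le hc hz ha'
  set r := √c
  have hr : r ^ 2 = c := Real.sq_sqrt hc.le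
  have e1 : a' - a = (√a' - √a) * (√a' + √a) := by
    rw [mul_comm, ← sq_sub_sq, Real.sq_sqrt (hc.le.trans ha), Real.sq_sqrt (hc.le.trans ha')]
  have hS : 2 * r ≤ √a' + √a := by linarith
  have hS0 : 0 < √a' + √a := by linarith
  have hz0 : 0 < √z := by linarith
  have e2 : √a' - √a - i / (2 * √z) = (a' - a - i) / (√a' + √a)
      + i * ((√z - √a) + (√z - √a')) / (2 * √z * (√a' + √a)) := by
    rw [e1]; field_simp; ring
  have hB0 : 0 ≤ B := (abs_nonneg _).trans hza
  rw [e2]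
  refine (abs_add_le _ _).trans (add_le_add ?_ ?_)
  · rw [abs_div, abs_of_pos hS0]
    exact div_le_div₀ ((abs_nonneg _).trans hi) hi (by positivity) hS
  · rw [abs_div, abs_mul, abs_of_pos (by positivity : 0 < 2 * √z * (√a' + √a))]
    have h5 : |√z - √a + (√z - √a')| ≤ B / r := by
      refine (abs_add_le _ _).trans ?_
      have h6 : |z - a| / (2 * r) ≤ B / (2 * r) := by gcongr
      have h7 : |z - a'| / (2 * r) ≤ B / (2 * r) := by gcongr
      have h8 : B / r = B / (2 * r) + B / (2 * r) := by field_simp; ring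
      linarith
    have h9 : |i| * B / (4 * c * r) = |i| * (B / r) / (2 * r * (2 * r)) := by
      rw [← hr]; field_simp; ring
    rw [h9]
    gcongr

/-- The local error of the auxiliary variable. -/
lemma CoefficientAssumption.abs_local_error_le (hcoef : CoefficientAssumption e lam R Ft g k δ₀)
    (hl : ∀ i, 0 < lam i) (hf' : Differentiable ℝ (deriv Ft)) {γ K : ℝ} {L : ℕ} (hγ : 0 ≤ γ)
    (hB : PolyBound e lam Ft γ K L) {c : ℝ} (hc : 0 < c) (hF : ∀ u ∈ H1 e lam, c ≤ F Ft u + δ₀)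
    {z u u' : L2 O} (hz : z ∈ H1 e lam) (hu : u ∈ H1 e lam)
    (hu' : u' ∈ H1 e lam) {M D : ℝ} (hM : 1 ≤ M) (hzM : h1norm e lam z ≤ M)
    (huM : h1norm e lam u ≤ M) (huM' : h1norm e lam u' ≤ M) (hD : ‖u' - u‖ ≤ D)
    (hDz : ‖u - z‖ ≤ D) :
    |√(F Ft u' + δ₀) - √(F Ft u + δ₀) - ⟪f Ft z, u' - u⟫_ℝ / (2 * √(F Ft z + δ₀))| ≤
      K * (4 * M) ^ L * (2 * D) ^ γ * D ^ γ / (2 * √c)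
        + (K * M ^ L * D) * (K * M ^ L * (2 * D)) / (4 * c * √c) := by
  have hD0 : 0 ≤ D := (norm_nonneg _).trans hD
  have hK := hB.nonneg
  have h1 := hcoef.abs_F_sub_le hl hB hu hz hM huM hzM
  have h2 := hcoef.abs_F_sub_le hl hB hu' hz hM huM' hzM
  have h3 : ‖z - u'‖ ≤ 2 * D := by
    have : z - u' = -((u - z) + (u' - u)) := by abel
    rw [this, norm_neg]
    exact (norm_add_le _ _).trans (by linarith)
  have hsc := Real.sqrt_pos.2 hc
  refine (abs_sqrt_taylor_le (A := K * (4 * M) ^ L * (2 * D) ^ γ * D ^ γ)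
    (B := K * M ^ L * (2 * D)) hc (hF u hu) (hF u' hu') (hF z hz) ?_ ?_ ?_).trans ?_
  · have := hcoef.abs_F_taylor_le hl hf' hγ hB hz hu hu' hM hzM huM huM' hD hDz
    rwa [add_sub_add_right_eq_sub]
  · rw [add_sub_add_right_eq_sub]
    refine h1.trans ?_
    rw [norm_sub_rev]
    gcongr
    linarith
  · rw [add_sub_add_right_eq_sub]
    refine h2.trans ?_
    gcongr
  · gcongr
    refine (abs_real_inner_le_norm _ _).trans ?_
    gcongr
    exact hB.growth M hM z hz hzM

lemma CoefficientAssumption.abs_sqrt_F_sub_le (hcoef : CoefficientAssumption e lam R Ft g k δ₀)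
    (hl : ∀ i, 0 < lam i) {γ K : ℝ} {L : ℕ}
    (hB : PolyBound e lam Ft γ K L) {c : ℝ} (hc : 0 < c) (hF : ∀ u ∈ H1 e lam, c ≤ F Ft u + δ₀)
    {z w : L2 O} (hz : z ∈ H1 e lam) (hw : w ∈ H1 e lam)
    {M : ℝ} (hM : 1 ≤ M) (hzM : h1norm e lam z ≤ M) (hwM : h1norm e lam w ≤ M) :
    |√(F Ft w + δ₀) - √(F Ft z + δ₀)| ≤ K * M ^ L * ‖w - z‖ / (2 * √c) := by
  refine (abs_sqrt_sub_sqrt_le hc (hF w hw) (hF z hz)).trans ?_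
  rw [add_sub_add_right_eq_sub]
  gcongr
  exact hcoef.abs_F_sub_le hl hB hz hw hM hzM hwM

end Coefficients

/-! ### Moments of real Gaussian variables and Minkowski's inequality. -/

section GaussianMoments

variable {Ω : Type*} [mΩ : MeasurableSpace Ω] {P : Measure Ω}

/-- The absolute moment of order `2 * j` of the standard normal distribution. -/
def gaussMoment (j : ℕ) : ℝ≥0∞ := ∫⁻ x, ‖x‖ₑ ^ (2 * j) ∂(gaussianReal 0 1)

lemma gaussMoment_ne_top (j : ℕ) : gaussMoment j ≠ ∞ := by
  have h : Integrable (fun x : ℝ => ‖id x‖ ^ (2 * j)) (gaussianReal 0 1) :=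
    (memLp_id_gaussianReal (μ := 0) (v := 1) ((2 * j : ℕ) : ℝ≥0)).integrable_norm_pow'
  have h2 := h.2
  rw [HasFiniteIntegral] at h2
  refine (lt_of_le_of_lt (le_of_eq ?_) h2).ne
  refine lintegral_congr fun x => ?_
  rw [enorm_pow, enorm_norm, id]

lemma lintegral_enorm_pow_gaussianReal (w : ℝ≥0) (j : ℕ) :
    ∫⁻ x, ‖x‖ₑ ^ (2 * j) ∂(gaussianReal 0 w) = (w : ℝ≥0∞) ^ j * gaussMoment j := by
  have h := gaussianReal_map_const_mul (μ := 0) (v := 1) (√(w : ℝ))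
  have hw : (.mk (√(w : ℝ) ^ 2) (sq_nonneg _) * 1 : ℝ≥0) = w := by
    rw [mul_one]
    ext
    exact Real.sq_sqrt w.2
  rw [mul_zero, hw] at h
  rw [← h, lintegral_map (by fun_prop) (by fun_prop), gaussMoment,
    ← lintegral_const_mul _ (by fun_prop)]
  refine lintegral_congr fun x => ?_
  have h1 : ‖√(w : ℝ)‖ₑ ^ 2 = w := by
    rw [← enorm_pow, Real.sq_sqrt w.coe_nonneg, Real.enorm_eq_ofReal w.coe_nonneg,
      ENNReal.ofReal_coe_nnreal]
  rw [enorm_mul, mul_pow, pow_mul ‖√(w : ℝ)‖ₑ, h1]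

lemma lintegral_le_of_tendsto_ae {f : ℕ → Ω → ℝ≥0∞} {h : Ω → ℝ≥0∞} {K : ℝ≥0∞}
    (hf : ∀ n, AEMeasurable (f n) P) (hlim : ∀ᵐ ω ∂P, Tendsto (fun n => f n ω) atTop (𝓝 (h ω)))
    (hK : ∀ n, ∫⁻ ω, f n ω ∂P ≤ K) : ∫⁻ ω, h ω ∂P ≤ K := by
  have h1 : ∫⁻ ω, h ω ∂P = ∫⁻ ω, liminf (fun n => f n ω) atTop ∂P :=
    lintegral_congr_ae (hlim.mono fun ω hω => hω.liminf_eq.symm)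
  rw [h1]
  refine (lintegral_liminf_le' hf).trans ?_
  refine liminf_le_of_le (by isBoundedDefault) fun b hb => ?_
  obtain ⟨n, hn⟩ := hb.exists
  exact hn.trans (hK n)

lemma map_sum_gaussianReal [IsProbabilityMeasure P] {Y : ℕ → Ω → ℝ} {v : ℝ≥0}
    (hY : ∀ k, Measurable (Y k)) (hind : iIndepFun Y P)
    (hlaw : ∀ k, P.map (Y k) = gaussianReal 0 v) (c : ℕ → ℝ) (n : ℕ) :
    P.map (fun ω => ∑ k ∈ Finset.range n, c k * Y k ω) =
      gaussianReal 0 (∑ k ∈ Finset.range n, ‖c k‖₊ ^ 2 * v) := by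
  induction n with
  | zero => simp [gaussianReal_zero_var]
  | succ n ih =>
    have hm : ∀ k, Measurable fun ω => c k * Y k ω := fun k => (hY k).const_mul (c k)
    have hi : iIndepFun (fun k ω => c k * Y k ω) P :=
      hind.comp (fun k x => c k * x) fun k => measurable_const_mul (c k)
    have hI := hi.indepFun_finsetSum_of_notMem hm (s := Finset.range n) (i := n) (by simp)
    have hsum : (∑ k ∈ Finset.range n, fun ω => c k * Y k ω) =
        fun ω => ∑ k ∈ Finset.range n, c k * Y k ω := by
      ext ω; simp
    rw [hsum] at hI
    have hn : P.map (fun ω => c n * Y n ω) = gaussianReal 0 (‖c n‖₊ ^ 2 * v) := by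
      have h := (gaussianReal_const_mul ⟨(hY n).aemeasurable, hlaw n⟩ (c n)).map_eq
      rw [h, mul_zero]
      congr 2
      ext
      simp
    have := gaussianReal_add_gaussianReal_of_indepFun hI ih hn
    rw [add_zero] at this
    rw [Finset.sum_range_succ, ← this]
    congr 1
    ext ω
    simp [Finset.sum_range_succ]

/-- Minkowski's inequality in L^j; since C is common to all terms, C^(1/j) factors out of the sum of
norms. -/
lemma lintegral_sum_pow_le {ι : Type*} (s : Finset ι) {f : ι → Ω → ℝ≥0∞} {a : ι → ℝ≥0∞}
    {C : ℝ≥0∞} {j : ℕ} (hj : j ≠ 0) (hf : ∀ i, Measurable (f i))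
    (h : ∀ i, ∫⁻ ω, f i ω ^ j ∂P ≤ a i ^ j * C) :
    ∫⁻ ω, (∑ i ∈ s, f i ω) ^ j ∂P ≤ (∑ i ∈ s, a i) ^ j * C := by
  have hj' : (0 : ℝ) < j := by positivity
  have hj1 : (1 : ℝ) ≤ j := by exact_mod_cast Nat.one_le_iff_ne_zero.2 hj
  have key : (∫⁻ ω, (∑ i ∈ s, f i ω) ^ (j : ℝ) ∂P) ^ (1 / (j : ℝ)) ≤
      (∑ i ∈ s, a i) * C ^ (1 / (j : ℝ)) := by
    classical
    induction s using Finset.induction_on with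
    | empty => simp [hj', hj]
    | insert i s his ih =>
      have h1 := ENNReal.lintegral_Lp_add_le (μ := P) (hf i).aemeasurable
        (Finset.measurable_fun_sum s fun i _ => hf i).aemeasurable hj1
      simp only [Pi.add_apply] at h1
      simp only [Finset.sum_insert his]
      refine h1.trans ?_
      rw [add_mul]
      refine add_le_add ?_ ih
      have h2 : ∫⁻ ω, f i ω ^ (j : ℝ) ∂P ≤ a i ^ (j : ℝ) * C := by
        simpa only [ENNReal.rpow_natCast] using h i
      refine (ENNReal.rpow_le_rpow h2 (by positivity)).trans (le_of_eq ?_)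
      rw [ENNReal.mul_rpow_of_nonneg _ _ (by positivity), ← ENNReal.rpow_mul,
        mul_one_div_cancel hj'.ne', ENNReal.rpow_one]
  have h3 := ENNReal.rpow_le_rpow key hj'.le
  rw [← ENNReal.rpow_mul, one_div_mul_cancel hj'.ne', ENNReal.rpow_one,
    ENNReal.mul_rpow_of_nonneg _ _ hj'.le, ← ENNReal.rpow_mul, one_div_mul_cancel hj'.ne',
    ENNReal.rpow_one] at h3
  simpa only [ENNReal.rpow_natCast] using h3

end GaussianMoments

/-! ### Gaussian noise independent of the past. -/

section Noise

variable {Ω : Type*} {m : MeasurableSpace Ω} [mΩ : MeasurableSpace Ω] {P : Measure Ω}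
variable {H : Type*} [NormedAddCommGroup H]

/-- `Y` is a sequence of independent centred Gaussian variables of variance `v`, independent of
the `σ`-algebra `m`. -/
structure IsGaussianNoise {Ω : Type*} (m : MeasurableSpace Ω) [mΩ : MeasurableSpace Ω]
    (P : Measure Ω) (Y : ℕ → Ω → ℝ) (v : ℝ≥0) : Prop where
  le : m ≤ mΩ
  meas : ∀ k, Measurable (Y k)
  indep : iIndepFun Y P
  law : ∀ k, P.map (Y k) = gaussianReal 0 v
  indep_past : Indep (MeasurableSpace.comap (fun ω k => Y k ω) inferInstance) m P

/-- For the tails of a Gaussian series, which are series of the same kind. -/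
lemma IsGaussianNoise.shift {Y : ℕ → Ω → ℝ} {v : ℝ≥0} (h : IsGaussianNoise m P Y v) (n : ℕ) :
    IsGaussianNoise m P (fun k => Y (n + k)) v where
  le := h.le
  meas k := h.meas (n + k)
  indep := h.indep.precomp (add_right_injective n)
  law k := h.law (n + k)
  indep_past := by
    refine indep_of_indep_of_le_left h.indep_past ?_
    have hm : Measurable fun (y : ℕ → ℝ) k => y (n + k) :=
      measurable_pi_lambda _ fun k => measurable_pi_apply (n + k)
    have : (fun ω k => Y (n + k) ω) = (fun (y : ℕ → ℝ) k => y (n + k)) ∘ fun ω k => Y k ω := rfl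
    rw [this, ← MeasurableSpace.comap_comp]
    exact MeasurableSpace.comap_mono hm.comap_le

lemma IsGaussianNoise.indepFun {𝒳 : Type*} [MeasurableSpace 𝒳] {Y : ℕ → Ω → ℝ} {v : ℝ≥0}
    (h : IsGaussianNoise m P Y v) {X : Ω → 𝒳} (hX : Measurable[m] X) :
    IndepFun X (fun ω k => Y k ω) P := by
  rw [IndepFun_iff_Indep]
  exact (indep_of_indep_of_le_right h.indep_past hX.comap_le).symm

lemma lintegral_enorm_inner_le [InnerProductSpace ℝ H] {x y : Ω → H} (hx : AEStronglyMeasurable x P)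
    (hy : AEStronglyMeasurable y P) :
    ∫⁻ ω, ‖⟪x ω, y ω⟫_ℝ‖ₑ ∂P ≤ eLpNorm x 2 P * eLpNorm y 2 P := by
  have h := lintegral_enorm_mul_le hx.norm hy.norm
  rw [eLpNorm_norm, eLpNorm_norm] at h
  refine (lintegral_mono fun ω => ?_).trans h
  rw [enorm_mul, enorm_norm, enorm_norm, ← ofReal_norm, ← ofReal_norm (x ω), ← ofReal_norm (y ω),
    ← ENNReal.ofReal_mul (norm_nonneg _)]
  exact ENNReal.ofReal_le_ofReal (norm_inner_le_norm _ _)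

lemma eLpNorm_two_eq (x : Ω → H) : eLpNorm x 2 P = (∫⁻ ω, ‖x ω‖ₑ ^ 2 ∂P) ^ (1 / 2 : ℝ) := by
  rw [eLpNorm_eq_lintegral_rpow_enorm_toReal (by norm_num) (by norm_num)]
  simp

end Noise

/-! ### Gaussian series with values in a Hilbert space. -/

section HilbertNoise

variable {Ω : Type*} {m : MeasurableSpace Ω} [mΩ : MeasurableSpace Ω] {P : Measure Ω} [IsProbabilityMeasure P]
variable {H : Type*} [NormedAddCommGroup H] [InnerProductSpace ℝ H]

lemma hasSum_enorm_sq (e : HilbertBasis ℕ ℝ H) (x : H) :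
    HasSum (fun i => ‖⟪e i, x⟫_ℝ‖ₑ ^ 2) (‖x‖ₑ ^ 2) := by
  have h := e.hasSum_inner_mul_inner x x
  rw [real_inner_self_eq_norm_sq] at h
  have h2 : HasSum (fun i => ‖⟪e i, x⟫_ℝ‖₊ ^ 2) (‖x‖₊ ^ 2) := by
    rw [← NNReal.hasSum_coe]
    refine (h.congr_fun fun i => ?_)
    rw [real_inner_comm x (e i)]
    simp [sq]
  have h3 := ENNReal.hasSum_coe.2 h2
  simpa [enorm_eq_nnnorm] using h3

/-- Moments of Gaussian sums in a Hilbert space. -/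
lemma lintegral_enorm_gaussian_sum_le (e : HilbertBasis ℕ ℝ H) {Y : ℕ → Ω → ℝ} {v : ℝ≥0}
    (hY : ∀ k, Measurable (Y k)) (hind : iIndepFun Y P)
    (hlaw : ∀ k, P.map (Y k) = gaussianReal 0 v) (b : ℕ → H) (n j : ℕ) :
    ∫⁻ ω, ‖∑ k ∈ Finset.range n, Y k ω • b k‖ₑ ^ (2 * j) ∂P ≤
      (v * ∑ k ∈ Finset.range n, ‖b k‖ₑ ^ 2) ^ j * gaussMoment j := by
  rcases eq_or_ne j 0 with rfl | hj
  · simp [gaussMoment]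
  have hinner : ∀ i ω, ⟪e i, ∑ k ∈ Finset.range n, Y k ω • b k⟫_ℝ =
      ∑ k ∈ Finset.range n, ⟪e i, b k⟫_ℝ * Y k ω := fun i ω => by
    rw [inner_sum]
    refine Finset.sum_congr rfl fun k _ => ?_
    rw [inner_smul_right, mul_comm]
  -- Parseval writes the squared norm as a sum of squares of real centred Gaussians with variances
  -- `a i`. Minkowski's inequality in L^j for this sum needs no independence between coordinates and
  -- keeps the one-dimensional constant.
  set s : ℕ → Ω → ℝ≥0∞ := fun i ω => ‖∑ k ∈ Finset.range n, ⟪e i, b k⟫_ℝ * Y k ω‖ₑ ^ 2 with hs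
  have hsm : ∀ i, Measurable (s i) := fun i => by
    refine Measurable.pow_const (Measurable.enorm ?_) 2
    exact Finset.measurable_fun_sum _ fun k _ => (hY k).const_mul _
  set a : ℕ → ℝ≥0∞ := fun i => v * ∑ k ∈ Finset.range n, ‖⟪e i, b k⟫_ℝ‖ₑ ^ 2 with ha
  have hmom : ∀ i, ∫⁻ ω, s i ω ^ j ∂P ≤ a i ^ j * gaussMoment j := fun i => by
    have h1 := lintegral_enorm_pow_gaussianReal
      (∑ k ∈ Finset.range n, ‖⟪e i, b k⟫_ℝ‖₊ ^ 2 * v) j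
    rw [← map_sum_gaussianReal hY hind hlaw (fun k => ⟪e i, b k⟫_ℝ) n,
      lintegral_map (by fun_prop)
        (Finset.measurable_fun_sum _ fun k _ => (hY k).const_mul _)] at h1
    simp only [hs, ← pow_mul]
    rw [h1, ha]
    simp only [ENNReal.ofNNReal_finsetSum, ENNReal.coe_mul, ENNReal.coe_pow, ← enorm_eq_nnnorm]
    rw [← Finset.sum_mul, mul_comm]
    rw [mul_comm (v : ℝ≥0∞), mul_comm]
  have hale : ∀ I : Finset ℕ, ∑ i ∈ I, a i ≤ v * ∑ k ∈ Finset.range n, ‖b k‖ₑ ^ 2 := fun I => by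
    rw [ha, ← Finset.mul_sum, Finset.sum_comm]
    gcongr with k _
    rw [← (hasSum_enorm_sq e (b k)).tsum_eq]
    exact ENNReal.sum_le_tsum I
  refine lintegral_le_of_tendsto_ae (f := fun m ω => (∑ i ∈ Finset.range m, s i ω) ^ j)
    (fun m => ((Finset.measurable_fun_sum _ fun i _ => hsm i).pow_const j).aemeasurable)
    (ae_of_all _ fun ω => ?_) fun m => ?_
  · have h := (hasSum_enorm_sq e (∑ k ∈ Finset.range n, Y k ω • b k)).tendsto_sum_nat
    simp only [hinner] at h
    rw [pow_mul]
    exact ((ENNReal.continuous_pow j).tendsto _).comp h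
  · refine (lintegral_sum_pow_le _ hj hsm hmom).trans ?_
    gcongr
    exact hale _

/-- The joint law is a product, so X can be frozen while Y is averaged. -/
lemma lintegral_of_indepFun {𝒳 𝒴 : Type*} [MeasurableSpace 𝒳] [MeasurableSpace 𝒴] {X : Ω → 𝒳}
    {Y : Ω → 𝒴} (hX : Measurable X) (hY : Measurable Y) (h : IndepFun X Y P)
    {Φ : 𝒳 × 𝒴 → ℝ≥0∞} (hΦ : Measurable Φ) :
    ∫⁻ ω, Φ (X ω, Y ω) ∂P = ∫⁻ ω, ∫⁻ ω', Φ (X ω, Y ω') ∂P ∂P := by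
  rw [← lintegral_map (f := Φ) (g := fun ω => (X ω, Y ω)) hΦ (hX.prodMk hY),
    (indepFun_iff_map_prod_eq_prod_map_map hX.aemeasurable hY.aemeasurable).1 h,
    lintegral_prod _ hΦ.aemeasurable, lintegral_map hΦ.lintegral_prod_right' hX]
  refine lintegral_congr fun ω => ?_
  rw [lintegral_map (by fun_prop) hY]

variable [MeasurableSpace H] [BorelSpace H] [SecondCountableTopology H]

/-- The weight and the coefficients belong to the past; once they are frozen, the sum is Gaussian
with deterministic coefficients. -/
lemma IsGaussianNoise.lintegral_partial_sum_le (e : HilbertBasis ℕ ℝ H) {Y : ℕ → Ω → ℝ}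
    {v : ℝ≥0} (h : IsGaussianNoise m P Y v) {Ψ : Ω → ℝ≥0∞} (hΨ : Measurable[m] Ψ)
    {B : ℕ → Ω → H} (hB : ∀ k, Measurable[m] (B k)) (n j : ℕ) :
    ∫⁻ ω, Ψ ω * ‖∑ k ∈ Finset.range n, Y k ω • B k ω‖ₑ ^ (2 * j) ∂P ≤
      gaussMoment j * v ^ j * ∫⁻ ω, Ψ ω * (∑' k, ‖B k ω‖ₑ ^ 2) ^ j ∂P := by
  have hΨ' : Measurable Ψ := hΨ.mono h.le le_rfl
  have hB' : ∀ k, Measurable (B k) := fun k => (hB k).mono h.le le_rfl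
  set X : Ω → ℝ≥0∞ × (ℕ → H) := fun ω => (Ψ ω, fun k => B k ω)
  have hX : Measurable[m] X := hΨ.prodMk (@measurable_pi_lambda _ _ _ m _ _ hB)
  have hX' : Measurable X := hX.mono h.le le_rfl
  set Φ : (ℝ≥0∞ × (ℕ → H)) × (ℕ → ℝ) → ℝ≥0∞ := fun z =>
    z.1.1 * ‖∑ k ∈ Finset.range n, z.2 k • z.1.2 k‖ₑ ^ (2 * j)
  have hΦ : Measurable Φ := by
    refine measurable_fst.fst.mul (Measurable.pow_const (Measurable.enorm ?_) _)
    refine Finset.measurable_fun_sum _ fun k _ => ?_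
    exact ((measurable_pi_apply k).comp measurable_snd).smul
      ((measurable_pi_apply k).comp measurable_fst.snd)
  have h1 := lintegral_of_indepFun hX' (measurable_pi_lambda _ h.meas) (h.indepFun hX) hΦ
  simp only [Φ, X] at h1
  have h3 : Measurable fun ω => Ψ ω * (∑' k, ‖B k ω‖ₑ ^ 2) ^ j :=
    hΨ'.mul ((Measurable.tsum fun k => (hB' k).enorm.pow_const 2).pow_const j)
  rw [h1, ← lintegral_const_mul _ h3]
  refine lintegral_mono fun ω => ?_
  rw [lintegral_const_mul _ (Measurable.pow_const (Measurable.enorm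
    (Finset.measurable_fun_sum _ fun k _ => (h.meas k).smul_const _)) _)]
  have h2 := lintegral_enorm_gaussian_sum_le e h.meas h.indep h.law (fun k => B k ω) n j
  calc Ψ ω * ∫⁻ ω', ‖∑ k ∈ Finset.range n, Y k ω' • B k ω‖ₑ ^ (2 * j) ∂P
      ≤ Ψ ω * ((v * ∑ k ∈ Finset.range n, ‖B k ω‖ₑ ^ 2) ^ j * gaussMoment j) := by gcongr
    _ ≤ Ψ ω * ((v * ∑' k, ‖B k ω‖ₑ ^ 2) ^ j * gaussMoment j) := by
        gcongr
        exact ENNReal.sum_le_tsum _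
    _ = _ := by rw [mul_pow]; ring

/-- Moments of Gaussian series with coefficients that are independent of the noise. -/
lemma IsGaussianNoise.lintegral_limit_le (e : HilbertBasis ℕ ℝ H) {Y : ℕ → Ω → ℝ}
    {v : ℝ≥0} (h : IsGaussianNoise m P Y v) {Ψ : Ω → ℝ≥0∞} (hΨ : Measurable[m] Ψ)
    (hΨt : ∀ ω, Ψ ω ≠ ∞)
    {B : ℕ → Ω → H} (hB : ∀ k, Measurable[m] (B k)) {ξ : Ω → H}
    (hξ : TendstoInMeasure P (fun n ω => ∑ k ∈ Finset.range n, Y k ω • B k ω) atTop ξ) (j : ℕ) :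
    ∫⁻ ω, Ψ ω * ‖ξ ω‖ₑ ^ (2 * j) ∂P ≤
      gaussMoment j * v ^ j * ∫⁻ ω, Ψ ω * (∑' k, ‖B k ω‖ₑ ^ 2) ^ j ∂P := by
  obtain ⟨ns, -, hns⟩ := hξ.exists_seq_tendsto_ae
  refine lintegral_le_of_tendsto_ae
    (f := fun n ω => Ψ ω * ‖∑ k ∈ Finset.range (ns n), Y k ω • B k ω‖ₑ ^ (2 * j))
    (fun n => ?_) ?_ fun n => h.lintegral_partial_sum_le e hΨ hB (ns n) j
  · refine ((hΨ.mono h.le le_rfl).mul (Measurable.pow_const (Measurable.enorm ?_) _)).aemeasurable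
    exact Finset.measurable_fun_sum _ fun k _ => (h.meas k).smul ((hB k).mono h.le le_rfl)
  · filter_upwards [hns] with ω hω
    refine ENNReal.Tendsto.const_mul ?_ (Or.inr (hΨt ω))
    exact ((ENNReal.continuous_pow _).tendsto _).comp (hω.enorm)

omit [IsProbabilityMeasure P] in
lemma aestronglyMeasurable_noise {Y : ℕ → Ω → ℝ} {v : ℝ≥0} (h : IsGaussianNoise m P Y v)
    {B : ℕ → Ω → H} (hB : ∀ k, Measurable[m] (B k)) {ξ : Ω → H}
    (hξ : TendstoInMeasure P (fun n ω => ∑ k ∈ Finset.range n, Y k ω • B k ω) atTop ξ) :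
    AEStronglyMeasurable ξ P :=
  hξ.aestronglyMeasurable fun _ => (Finset.measurable_fun_sum _ fun k _ =>
    (h.meas k).smul ((hB k).mono h.le le_rfl)).aestronglyMeasurable

/-- Gaussian series with coefficients that are independent of the noise are centred. -/
lemma IsGaussianNoise.integral_inner_eq_zero (e : HilbertBasis ℕ ℝ H) {Y : ℕ → Ω → ℝ}
    {v : ℝ≥0} (h : IsGaussianNoise m P Y v)
    {B : ℕ → Ω → H} (hB : ∀ k, Measurable[m] (B k)) {ξ : Ω → H}
    (hξ : TendstoInMeasure P (fun n ω => ∑ k ∈ Finset.range n, Y k ω • B k ω) atTop ξ)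
    {w : Ω → H} (hw : Measurable[m] w) (hw2 : MemLp w 2 P)
    (hB2 : ∑' k, ∫⁻ ω, ‖B k ω‖ₑ ^ 2 ∂P ≠ ∞) :
    Integrable (fun ω => ⟪w ω, ξ ω⟫_ℝ) P ∧ ∫ ω, ⟪w ω, ξ ω⟫_ℝ ∂P = 0 := by
  have hB' : ∀ k, Measurable (B k) := fun k => (hB k).mono h.le le_rfl
  have hξm := aestronglyMeasurable_noise h hB hξ
  set S : ℕ → Ω → H := fun n ω => ∑ k ∈ Finset.range n, Y k ω • B k ω with hS
  have hSm : ∀ n, Measurable (S n) := fun n =>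
    Finset.measurable_fun_sum _ fun k _ => (h.meas k).smul (hB' k)
  -- The second-moment bound for the shifted noise upgrades the assumed convergence in probability
  -- to convergence in L².
  have htail : ∀ n, ∫⁻ ω, ‖ξ ω - S n ω‖ₑ ^ 2 ∂P ≤
      gaussMoment 1 * v * ∑' k, ∫⁻ ω, ‖B (k + n) ω‖ₑ ^ 2 ∂P := fun n => by
    have h1 : TendstoInMeasure P (fun l ω => ∑ k ∈ Finset.range l, Y (n + k) ω • B (n + k) ω)
        atTop (fun ω => ξ ω - S n ω) := by
      intro ε hε
      refine ((hξ ε hε).comp (tendsto_add_atTop_nat n)).congr fun l => ?_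
      simp only [Function.comp_apply]
      congr 1
      ext ω
      simp only [Set.mem_ofPred_eq]
      rw [add_comm l n, hS]
      simp only
      rw [Finset.sum_range_add, edist_eq_enorm_sub, edist_eq_enorm_sub]
      have : ∀ a b c : H, a + b - c = b - (c - a) := fun a b c => by abel
      rw [this]
    have h2 := (h.shift n).lintegral_limit_le e (Ψ := fun _ => 1) measurable_const (by simp)
      (B := fun k => B (n + k)) (fun k => hB _) h1 1
    simp only [one_mul, mul_one, pow_one] at h2
    refine h2.trans (le_of_eq ?_)
    rw [lintegral_tsum fun k => ((hB' _).enorm.pow_const 2).aemeasurable]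
    simp only [add_comm n]
  have hξ2 : ∫⁻ ω, ‖ξ ω‖ₑ ^ 2 ∂P < ∞ := by
    have h0 := htail 0
    simp only [hS, Finset.range_zero, Finset.sum_empty, sub_zero, add_zero] at h0
    exact h0.trans_lt (ENNReal.mul_lt_top
      (ENNReal.mul_lt_top (gaussMoment_ne_top 1).lt_top ENNReal.coe_lt_top) hB2.lt_top)
  have hξL : MemLp ξ 2 P := ⟨hξm, by
    rw [eLpNorm_two_eq]; exact ENNReal.rpow_lt_top_of_nonneg (by norm_num) hξ2.ne⟩
  have hInt : Integrable (fun ω => ⟪w ω, ξ ω⟫_ℝ) P :=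
    ⟨hw2.1.inner hξm, (lintegral_enorm_inner_le hw2.1 hξm).trans_lt
      (ENNReal.mul_lt_top hw2.2 hξL.2)⟩
  refine ⟨hInt, ?_⟩
  have hBL : ∀ k, MemLp (B k) 2 P := fun k => ⟨(hB' k).aestronglyMeasurable, by
    rw [eLpNorm_two_eq]
    exact ENNReal.rpow_lt_top_of_nonneg (by norm_num) (ENNReal.ne_top_of_tsum_ne_top hB2 k)⟩
  have hwB : ∀ k, Integrable (fun ω => ⟪w ω, B k ω⟫_ℝ) P := fun k =>
    ⟨hw2.1.inner (hBL k).1, (lintegral_enorm_inner_le hw2.1 (hBL k).1).trans_lt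
      (ENNReal.mul_lt_top hw2.2 (hBL k).2)⟩
  have hYi : ∀ k, Integrable (Y k) P ∧ ∫ ω, Y k ω ∂P = 0 := fun k => by
    have hl : HasLaw (Y k) (gaussianReal 0 v) P := ⟨(h.meas k).aemeasurable, h.law k⟩
    refine ⟨?_, ?_⟩
    · have h1 : Integrable id (P.map (Y k)) := by
        rw [h.law k]
        exact (memLp_id_gaussianReal 1).integrable (by simp)
      exact (integrable_map_measure measurable_id.aestronglyMeasurable
        (h.meas k).aemeasurable).1 h1
    · rw [hl.integral_eq, integral_id_gaussianReal]
  have hind : ∀ k, IndepFun (fun ω => ⟪w ω, B k ω⟫_ℝ) (Y k) P := fun k => by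
    have hm : Measurable[m] (fun ω => ⟪w ω, B k ω⟫_ℝ) := by
      have h1 : Measurable[m] fun ω => (w ω, B k ω) := hw.prodMk (hB k)
      exact (measurable_fst.inner measurable_snd :
        Measurable fun z : H × H => ⟪z.1, z.2⟫_ℝ).comp h1
    exact (h.indepFun hm).comp measurable_id (measurable_pi_apply k)
  have hSint : ∀ n, Integrable (fun ω => ⟪w ω, S n ω⟫_ℝ) P ∧ ∫ ω, ⟪w ω, S n ω⟫_ℝ ∂P = 0 := by
    intro n
    have h1 : (fun ω => ⟪w ω, S n ω⟫_ℝ) =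
        fun ω => ∑ k ∈ Finset.range n, ⟪w ω, B k ω⟫_ℝ * Y k ω := by
      ext ω
      rw [hS]
      simp only
      rw [inner_sum]
      refine Finset.sum_congr rfl fun k _ => ?_
      rw [inner_smul_right, mul_comm]
    have h2 : ∀ k, Integrable (fun ω => ⟪w ω, B k ω⟫_ℝ * Y k ω) P := fun k =>
      (hind k).integrable_mul (hwB k) (hYi k).1
    rw [h1]
    refine ⟨integrable_finsetSum _ fun k _ => h2 k, ?_⟩
    rw [integral_finsetSum _ fun k _ => h2 k]
    refine Finset.sum_eq_zero fun k _ => ?_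
    have := (hind k).integral_mul_eq_mul_integral (hwB k).1 (hYi k).1.1
    simp only [Pi.mul_apply] at this
    rw [this, (hYi k).2, mul_zero]
  -- Partial sums pair with w to zero in expectation, so only the tail contributes, and
  -- Cauchy–Schwarz bounds it.
  have hbound : ∀ n, ‖∫ ω, ⟪w ω, ξ ω⟫_ℝ ∂P‖ₑ ≤ eLpNorm w 2 P *
      (gaussMoment 1 * v * ∑' k, ∫⁻ ω, ‖B (k + n) ω‖ₑ ^ 2 ∂P) ^ (1 / 2 : ℝ) := fun n => by
    have h1 : ∫ ω, ⟪w ω, ξ ω⟫_ℝ ∂P = ∫ ω, ⟪w ω, ξ ω - S n ω⟫_ℝ ∂P := by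
      simp_rw [inner_sub_right]
      rw [integral_sub hInt (hSint n).1, (hSint n).2, sub_zero]
    rw [h1]
    refine (enorm_integral_le_lintegral_enorm _).trans ?_
    refine (lintegral_enorm_inner_le hw2.1 (hξm.sub (hSm n).aestronglyMeasurable)).trans ?_
    gcongr
    rw [eLpNorm_two_eq]
    exact ENNReal.rpow_le_rpow (htail n) (by norm_num)
  have hlim : Tendsto (fun n => eLpNorm w 2 P *
      (gaussMoment 1 * v * ∑' k, ∫⁻ ω, ‖B (k + n) ω‖ₑ ^ 2 ∂P) ^ (1 / 2 : ℝ)) atTop (𝓝 0) := by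
    have h1 := ENNReal.tendsto_sum_nat_add (fun k => ∫⁻ ω, ‖B k ω‖ₑ ^ 2 ∂P) hB2
    have h2 := ENNReal.Tendsto.const_mul (a := gaussMoment 1 * v) h1
      (Or.inr (ENNReal.mul_ne_top (gaussMoment_ne_top 1) ENNReal.coe_ne_top))
    have h3 := ENNReal.Tendsto.const_mul (a := eLpNorm w 2 P)
      ((ENNReal.continuous_rpow_const (y := 1 / 2)).tendsto _ |>.comp h2) (Or.inr hw2.2.ne)
    simpa using h3
  have h0 := ge_of_tendsto' hlim hbound
  simpa using h0

end HilbertNoise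

/-! ### Measurability of functions that are continuous only for the Ḣ¹ norm. -/

section Measurability

variable {d : ℕ} {O : Opens (EuclideanSpace ℝ (Fin d))}
variable {e : HilbertBasis ℕ ℝ (L2 O)} {lam : ℕ → ℝ} {R : L2 O →L[ℝ] L2 O}
variable {Ft : ℝ → ℝ} {g : L2 O × (Fin d → L2 O) → (CM R →ₗ[ℝ] L2 O)} {k : ℕ} {δ₀ : ℝ}

local instance : MeasurableSpace (L2 O) := borel _

local instance : BorelSpace (L2 O) := ⟨rfl⟩

/-- The orthogonal projection onto the span of `e 0, …, e (n - 1)`. -/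
def specProj (e : HilbertBasis ℕ ℝ (L2 O)) (n : ℕ) (u : L2 O) : L2 O :=
  specOp e (fun i => if i < n then 1 else 0) u

lemma inner_specProj (n : ℕ) (u : L2 O) (i : ℕ) :
    ⟪e i, specProj e n u⟫_ℝ = if i < n then ⟪e i, u⟫_ℝ else 0 := by
  rw [specProj, inner_specOp (mem_specDomain_of_bounded (C := 1) (fun i => by split_ifs <;> simp) u)]
  split_ifs <;> simp

lemma specProj_sub (n : ℕ) (u w : L2 O) :
    specProj e n (u - w) = specProj e n u - specProj e n w :=
  ext_inner_basis e fun i => by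
    simp only [inner_sub_right, inner_specProj]
    split_ifs <;> simp

lemma abs_sqrt_mul_indicator_le (hm : Monotone lam) (n i : ℕ) :
    |√(lam i) * (if i < n then 1 else 0)| ≤ √(lam n) := by
  split_ifs with h
  · rw [mul_one, abs_of_nonneg (Real.sqrt_nonneg _)]
    exact Real.sqrt_le_sqrt (hm h.le)
  · simp

lemma specProj_mem_H1 (hm : Monotone lam) (n : ℕ) (u : L2 O) : specProj e n u ∈ H1 e lam := by
  have h : Summable fun i => (√(lam i) * (if i < n then 1 else 0) * ⟪e i, u⟫_ℝ) ^ 2 :=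
    mem_specDomain_of_bounded (abs_sqrt_mul_indicator_le hm n) u
  refine h.congr fun i => ?_
  rw [inner_specProj]
  split_ifs <;> simp

lemma h1norm_specProj_le (hl : ∀ i, 0 < lam i) (hm : Monotone lam) (n : ℕ) (u : L2 O) :
    h1norm e lam (specProj e n u) ≤ √(lam n) * ‖u‖ := by
  have h := norm_specOp_le_of_bounded (e := e) (abs_sqrt_mul_indicator_le hm n) u
  rw [h1norm_eq hl (specProj_mem_H1 hm n u)]
  refine (le_of_eq ?_).trans h
  congr 1
  refine ext_inner_basis e fun i => ?_
  rw [inner_specOp (specProj_mem_H1 hm n u),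
    inner_specOp (mem_specDomain_of_bounded (abs_sqrt_mul_indicator_le hm n) u), inner_specProj]
  split_ifs <;> simp

lemma tendsto_h1norm_specProj (hl : ∀ i, 0 < lam i) (hm : Monotone lam) {u : L2 O}
    (hu : u ∈ H1 e lam) :
    Tendsto (fun n => h1norm e lam (specProj e n u - u)) atTop (𝓝 0) := by
  have hs := hasSum_h1norm_sq hl hu
  have hmem : ∀ n, specProj e n u - u ∈ H1 e lam := fun n => H1_sub (specProj_mem_H1 hm n u) hu
  have hsq : ∀ n, h1norm e lam (specProj e n u - u) ^ 2 =
      h1norm e lam u ^ 2 - ∑ i ∈ Finset.range n, lam i * ⟪e i, u⟫_ℝ ^ 2 := fun n => by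
    have h1 := hasSum_h1norm_sq hl (hmem n)
    have h2 : HasSum (fun i => if i < n then lam i * ⟪e i, u⟫_ℝ ^ 2 else 0)
        (∑ i ∈ Finset.range n, if i < n then lam i * ⟪e i, u⟫_ℝ ^ 2 else 0) :=
      hasSum_sum_of_ne_finset_zero fun i hi => if_neg (by simpa using hi)
    have h3 : ∑ i ∈ Finset.range n, (if i < n then lam i * ⟪e i, u⟫_ℝ ^ 2 else 0) =
        ∑ i ∈ Finset.range n, lam i * ⟪e i, u⟫_ℝ ^ 2 :=
      Finset.sum_congr rfl fun i hi => if_pos (Finset.mem_range.1 hi)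
    rw [h3] at h2
    refine h1.unique ((hs.sub h2).congr_fun fun i => ?_)
    rw [inner_sub_right, inner_specProj]
    split_ifs <;> simp
  have h4 : Tendsto (fun n => h1norm e lam (specProj e n u - u) ^ 2) atTop (𝓝 0) := by
    simp_rw [hsq]
    have := hs.tendsto_sum_nat.const_sub (h1norm e lam u ^ 2)
    rwa [sub_self] at this
  have h5 := (Real.continuous_sqrt.tendsto _).comp h4
  rw [Real.sqrt_zero] at h5
  refine h5.congr fun n => ?_
  simp [Real.sqrt_sq (h1norm_nonneg _)]

/-- Sequential continuity with respect to the norm of `Ḣ¹`. -/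
def H1Continuous {E : Type*} [TopologicalSpace E] (e : HilbertBasis ℕ ℝ (L2 O)) (lam : ℕ → ℝ)
    (Φ : L2 O → E) : Prop :=
  ∀ u ∈ H1 e lam, ∀ w : ℕ → L2 O, (∀ n, w n ∈ H1 e lam) →
    Tendsto (fun n => h1norm e lam (w n - u)) atTop (𝓝 0) → Tendsto (fun n => Φ (w n)) atTop (𝓝 (Φ u))

/-- Local Lipschitz functions for the norm of `Ḣ¹` are continuous. -/
lemma H1Continuous.of_lipschitz {E : Type*} [SeminormedAddCommGroup E] (hl : ∀ i, 0 < lam i)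
    {Φ : L2 O → E} {K : ℝ → ℝ} (h : ∀ M : ℝ, 1 ≤ M → ∀ u ∈ H1 e lam, ∀ w ∈ H1 e lam,
      h1norm e lam u ≤ M → h1norm e lam w ≤ M → ‖Φ w - Φ u‖ ≤ K M * h1norm e lam (w - u)) :
    H1Continuous e lam Φ := by
  intro u hu w hw hlim
  rw [tendsto_iff_norm_sub_tendsto_zero]
  set M := h1norm e lam u + 1
  have hM : 1 ≤ M := le_add_of_nonneg_left (h1norm_nonneg u)
  have h0 : Tendsto (fun n => K M * h1norm e lam (w n - u)) atTop (𝓝 0) := by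
    simpa using hlim.const_mul (K M)
  refine squeeze_zero' (Eventually.of_forall fun n => norm_nonneg _) ?_ h0
  filter_upwards [hlim.eventually (gt_mem_nhds zero_lt_one)] with n hn
  refine h M hM u hu (w n) (hw n) (by simp [M]) ?_
  have h1 := h1norm_add_le hl hu (H1_sub (hw n) hu)
  rw [add_sub_cancel] at h1
  linarith

/-- On the range of the projection, which involves finitely many eigenvalues, L² convergence implies
Ḣ¹ convergence. -/
lemma H1Continuous.continuous_comp_specProj {E : Type*} [TopologicalSpace E]
    {Φ : L2 O → E} (hΦ : H1Continuous e lam Φ) (hl : ∀ i, 0 < lam i) (hm : Monotone lam) (n : ℕ) :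
    Continuous fun u => Φ (specProj e n u) := by
  rw [continuous_iff_seqContinuous]
  intro w u hw
  refine hΦ _ (specProj_mem_H1 hm n u) _ (fun j => specProj_mem_H1 hm n (w j)) ?_
  rw [tendsto_iff_norm_sub_tendsto_zero] at hw
  have h0 : Tendsto (fun j => √(lam n) * ‖w j - u‖) atTop (𝓝 0) := by
    simpa using hw.const_mul (√(lam n))
  refine squeeze_zero (fun j => h1norm_nonneg _) (fun j => ?_) h0
  rw [← specProj_sub]
  exact h1norm_specProj_le hl hm n _

/-- Φ need not be continuous for the L² norm, in which U is measurable. Composed with spectral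
projections it is, and these compositions converge pointwise along U. -/
lemma H1Continuous.stronglyMeasurable_comp {E : Type*} [TopologicalSpace E]
    [PseudoMetrizableSpace E]
    {Φ : L2 O → E} (hΦ : H1Continuous e lam Φ) (hl : ∀ i, 0 < lam i) (hm : Monotone lam)
    {Ω : Type*} {m : MeasurableSpace Ω} {U : Ω → L2 O} (hU : StronglyMeasurable[m] U)
    (hH : ∀ ω, U ω ∈ H1 e lam) : StronglyMeasurable[m] fun ω => Φ (U ω) := by
  refine stronglyMeasurable_of_tendsto atTop (f := fun n ω => Φ (specProj e n (U ω)))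
    (fun n => (hΦ.continuous_comp_specProj hl hm n).comp_stronglyMeasurable hU) ?_
  rw [tendsto_pi_nhds]
  exact fun ω => hΦ _ (hH ω) _ (fun n => specProj_mem_H1 hm n _) (tendsto_h1norm_specProj hl hm (hH ω))

lemma measurableSet_H1 : MeasurableSet (H1 e lam) := by
  have h : H1 e lam = {u : L2 O | ∑' i, ((‖√(lam i) * ⟪e i, u⟫_ℝ‖₊ ^ 2 : ℝ≥0) : ℝ≥0∞) ≠ ∞} := by
    ext u
    rw [Set.mem_ofPred_eq, ENNReal.tsum_coe_ne_top_iff_summable, ← NNReal.summable_coe]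
    simp only [NNReal.coe_pow, coe_nnnorm, Real.norm_eq_abs, sq_abs]
    rfl
  rw [h]
  have hm : Measurable fun u : L2 O => ∑' i, ((‖√(lam i) * ⟪e i, u⟫_ℝ‖₊ ^ 2 : ℝ≥0) : ℝ≥0∞) := by
    refine Measurable.tsum fun i => ?_
    have : Continuous fun u : L2 O => ((‖√(lam i) * ⟪e i, u⟫_ℝ‖₊ ^ 2 : ℝ≥0) : ℝ≥0∞) := by
      fun_prop
    exact this.measurable
  exact (hm (measurableSet_singleton ∞)).compl

/-- Numerical solutions lie in Ḣ¹ only almost surely. Since Ḣ¹ is Borel in L², putting 0 elsewhere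
preserves measurability for the same σ-algebra. -/
lemma exists_H1_version {Ω : Type*} {m : MeasurableSpace Ω} {U : Ω → L2 O}
    (hU : StronglyMeasurable[m] U) :
    ∃ U' : Ω → L2 O, StronglyMeasurable[m] U' ∧ (∀ ω, U' ω ∈ H1 e lam) ∧
      ∀ ω, U ω ∈ H1 e lam → U' ω = U ω := by
  refine ⟨(U ⁻¹' H1 e lam).indicator U, hU.indicator (hU.measurable measurableSet_H1),
    fun ω => ?_, fun ω hω => Set.indicator_of_mem (by exact hω) _⟩
  by_cases h : U ω ∈ H1 e lam
  · rwa [Set.indicator_of_mem (by exact h)]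
  · rw [Set.indicator_of_notMem (by exact h)]
    exact zero_mem_H1

lemma h1Continuous_h1norm (hl : ∀ i, 0 < lam i) : H1Continuous e lam (h1norm e lam) := by
  refine H1Continuous.of_lipschitz hl (K := fun _ => 1) fun M _ u hu w hw _ _ => ?_
  rw [one_mul, Real.norm_eq_abs, abs_sub_le_iff]
  have h1 := h1norm_add_le hl hu (H1_sub hw hu)
  have h2 := h1norm_sub_le hl hw (H1_sub hw hu)
  rw [add_sub_cancel] at h1
  rw [sub_sub_cancel] at h2
  constructor <;> linarith

lemma CoefficientAssumption.h1Continuous_F (hcoef : CoefficientAssumption e lam R Ft g k δ₀)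
    (he : IsDirichletEigenbasis e lam) {γ K : ℝ} {L : ℕ} (hB : PolyBound e lam Ft γ K L) :
    H1Continuous e lam (F Ft) := by
  have hK := hB.nonneg
  refine H1Continuous.of_lipschitz he.pos (K := fun M => K * M ^ L * (√(lam 0))⁻¹)
    fun M hM u hu w hw huM hwM => ?_
  refine (hcoef.abs_F_sub_le he.pos hB hu hw hM huM hwM).trans ?_
  rw [mul_assoc (K * M ^ L)]
  gcongr
  exact norm_le_h1norm he (H1_sub hw hu)

lemma norm_apply_le_hsNorm {B : CM R →ₗ[ℝ] L2 O} (hB : IsHilbertSchmidt e R B) (i : ℕ) :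
    ‖B (toCM R (e i))‖ ≤ hsNorm e R B := by
  rw [hsNorm]
  refine Real.le_sqrt_of_sq_le ?_
  exact hB.2.le_tsum i fun j _ => by positivity

lemma IsHilbertSchmidt.sub {B B' : CM R →ₗ[ℝ] L2 O} (hB : IsHilbertSchmidt e R B)
    (hB' : IsHilbertSchmidt e R B') : IsHilbertSchmidt e R (B - B') := by
  refine ⟨hB.1.sub hB'.1, ?_⟩
  refine Summable.of_nonneg_of_le (fun i => by positivity) (fun i => ?_)
    ((hB.2.mul_left 2).add (hB'.2.mul_left 2))
  rw [LinearMap.sub_apply]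
  have h := norm_sub_le (B (toCM R (e i))) (B' (toCM R (e i)))
  nlinarith [sq_nonneg (‖B (toCM R (e i))‖ - ‖B' (toCM R (e i))‖), norm_nonneg
    (B (toCM R (e i)) - B' (toCM R (e i)))]

/-- The Hilbert–Schmidt norm dominates every column. The noise series uses only columns, so no
measurability of an operator-valued map is required. -/
lemma CoefficientAssumption.h1Continuous_g (hcoef : CoefficientAssumption e lam R Ft g k δ₀)
    (hl : ∀ i, 0 < lam i) (i : ℕ) :
    H1Continuous e lam (fun u => g (Theta u) (toCM R (e i))) := by
  obtain ⟨b₃, -, h₃⟩ := hcoef.g_lipschitz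
  obtain ⟨K, L, hK, hp⟩ := exists_mvPolynomial_bound b₃
  refine H1Continuous.of_lipschitz hl (K := fun M => K * M ^ L) fun M hM u hu w hw huM hwM => ?_
  rw [← LinearMap.sub_apply]
  refine (norm_apply_le_hsNorm ((hcoef.g_hs w hw).sub (hcoef.g_hs u hu)) i).trans ?_
  refine (h₃ w hw u hu).trans (mul_le_mul_of_nonneg_right ((le_abs_self _).trans
    (hp M hM _ ?_)) (h1norm_nonneg _))
  intro i
  fin_cases i <;> simpa [abs_of_nonneg (h1norm_nonneg _)]

end Measurability

/-! ### Growth of the moments of the energy in one step. -/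

section OneStep

/-- Used with x the energy, l = ⟨v, ξ⟩ and a = ‖ξ‖². The term linear in l keeps its exact
coefficient because its expectation vanishes. Cauchy–Schwarz in the form l² ≤ 2xa makes the
quadratic terms comparable to a. The induction multiplies the previous inequality by x + l + a/2. -/
lemma exists_pow_add_le (p : ℕ) : ∃ C : ℝ, 0 ≤ C ∧ ∀ x l a : ℝ, 0 ≤ x → 0 ≤ a →
    l ^ 2 ≤ 2 * x * a → 0 ≤ x + l + a / 2 →
    (x + l + a / 2) ^ (p + 1) ≤
      x ^ (p + 1) + (p + 1) * (x ^ p * l) + C * (x ^ p * a + a ^ (p + 1)) := by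
  induction p with
  | zero => exact ⟨1, zero_le_one, fun x l a hx ha _ _ => by simp; linarith⟩
  | succ p ih =>
    obtain ⟨C, hC, h⟩ := ih
    refine ⟨1 / 2 + 2 * (p + 1) + (p + 1) + 8 * C, by positivity, fun x l a hx ha hl hy => ?_⟩
    have h1 := h x l a hx ha hl hy
    set y := x + l + a / 2 with hydef
    set m := x ^ (p + 1) * a + a ^ (p + 2) with hm
    have hlx : |l| ≤ x + a := by
      refine abs_le_of_sq_le_sq ?_ (by positivity)
      nlinarith [mul_nonneg hx ha, sq_nonneg x, sq_nonneg a]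
    have hly := (abs_le.1 hlx).2
    -- The mixed monomials interpolate between x^(p+1) a and a^(p+2), so the larger of x and a
    -- decides which one dominates.
    have hxa : x ^ p * a ^ 2 ≤ m ∧ x * a ^ (p + 1) ≤ m ∧ x ^ (p + 1) * a ≤ m ∧
        a ^ (p + 2) ≤ m := by
      rcases le_total a x with hax | hax
      · have i1 : x ^ p * a ^ 2 ≤ x ^ (p + 1) * a := by
          calc x ^ p * a ^ 2 = x ^ p * a * a := by ring
            _ ≤ x ^ p * x * a := by gcongr
            _ = _ := by ring
        have i2 : x * a ^ (p + 1) ≤ x ^ (p + 1) * a := by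
          calc x * a ^ (p + 1) = x * a ^ p * a := by ring
            _ ≤ x * x ^ p * a := by gcongr
            _ = _ := by ring
        have i3 : 0 ≤ a ^ (p + 2) := by positivity
        have i4 : 0 ≤ x ^ (p + 1) * a := by positivity
        refine ⟨?_, ?_, ?_, ?_⟩ <;> simp only [hm] <;> linarith
      · have i1 : x ^ p * a ^ 2 ≤ a ^ (p + 2) := by
          calc x ^ p * a ^ 2 ≤ a ^ p * a ^ 2 := by gcongr
            _ = _ := by ring
        have i2 : x * a ^ (p + 1) ≤ a ^ (p + 2) := by
          calc x * a ^ (p + 1) ≤ a * a ^ (p + 1) := by gcongr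
            _ = _ := by ring
        have i3 : 0 ≤ a ^ (p + 2) := by positivity
        have i4 : 0 ≤ x ^ (p + 1) * a := by positivity
        refine ⟨?_, ?_, ?_, ?_⟩ <;> simp only [hm] <;> linarith
    obtain ⟨m1, m2, m3, m4⟩ := hxa
    have hm0 : 0 ≤ m := by positivity
    have hp : 0 ≤ x ^ p := by positivity
    have t1 : x ^ p * l ^ 2 ≤ 2 * m := by
      calc x ^ p * l ^ 2 ≤ x ^ p * (2 * x * a) := by gcongr
        _ = 2 * (x ^ (p + 1) * a) := by ring
        _ ≤ 2 * m := by linarith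
    have t2 : x ^ p * a * l / 2 ≤ m := by
      have : x ^ p * a * l ≤ x ^ p * a * (x + a) := by gcongr
      have e1 : x ^ p * a * (x + a) = x ^ (p + 1) * a + x ^ p * a ^ 2 := by ring
      linarith
    have t3 : y * (C * (x ^ p * a + a ^ (p + 1))) ≤ 8 * C * m := by
      have hy2 : y ≤ 2 * x + 2 * a := by simp only [hydef]; linarith
      have e1 : (2 * x + 2 * a) * (C * (x ^ p * a + a ^ (p + 1))) =
          2 * C * (x ^ (p + 1) * a + x * a ^ (p + 1) + x ^ p * a ^ 2 + a ^ (p + 2)) := by ring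
      calc y * (C * (x ^ p * a + a ^ (p + 1))) ≤
          (2 * x + 2 * a) * (C * (x ^ p * a + a ^ (p + 1))) := by gcongr
        _ ≤ 2 * C * (m + m + m + m) := by rw [e1]; gcongr
        _ = 8 * C * m := by ring
    calc y ^ (p + 1 + 1) = y * y ^ (p + 1) := by ring
      _ ≤ y * (x ^ (p + 1) + (p + 1) * (x ^ p * l) + C * (x ^ p * a + a ^ (p + 1))) := by gcongr
      _ = x ^ (p + 2) + (p + 2) * (x ^ (p + 1) * l) + x ^ (p + 1) * a / 2
          + (p + 1) * (x ^ p * l ^ 2) + (p + 1) * (x ^ p * a * l / 2)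
          + y * (C * (x ^ p * a + a ^ (p + 1))) := by rw [hydef]; ring
      _ ≤ x ^ (p + 2) + (p + 2) * (x ^ (p + 1) * l) + m / 2
          + (p + 1) * (2 * m) + (p + 1) * m + 8 * C * m := by gcongr
      _ = _ := by push_cast; ring

lemma integrable_of_lintegral_le {Ω : Type*} [MeasurableSpace Ω] {P : Measure Ω} {f : Ω → ℝ}
    (hf : AEStronglyMeasurable f P) (h0 : 0 ≤ᵐ[P] f) {K : ℝ} (hK : 0 ≤ K)
    (h : ∫⁻ ω, ENNReal.ofReal (f ω) ∂P ≤ ENNReal.ofReal K) : Integrable f P ∧ ∫ ω, f ω ∂P ≤ K := by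
  refine ⟨⟨hf, ?_⟩, ?_⟩
  · rw [hasFiniteIntegral_iff_ofReal h0]
    exact h.trans_lt ENNReal.ofReal_lt_top
  · rw [integral_eq_lintegral_of_nonneg_ae h0 hf]
    exact ENNReal.toReal_le_of_le_ofReal hK h

variable {d : ℕ} {O : Opens (EuclideanSpace ℝ (Fin d))}
variable {e : HilbertBasis ℕ ℝ (L2 O)} {lam : ℕ → ℝ} {R : L2 O →L[ℝ] L2 O}
variable {Ft : ℝ → ℝ} {g : L2 O × (Fin d → L2 O) → (CM R →ₗ[ℝ] L2 O)} {k : ℕ} {δ₀ : ℝ}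

local instance : MeasurableSpace (L2 O) := borel _

local instance : BorelSpace (L2 O) := ⟨rfl⟩

local instance : Fact ((2 : ℝ≥0∞) ≠ ∞) := ⟨ENNReal.ofNat_ne_top⟩

local instance : SecondCountableTopology (L2 O) := inferInstance

/-- One plus the modified energy that the schemes preserve in the absence of noise. -/
def energy (e : HilbertBasis ℕ ℝ (L2 O)) (lam : ℕ → ℝ) (u v : L2 O) (q : ℝ) : ℝ :=
  1 + (h1norm e lam u ^ 2 + ‖v‖ ^ 2) / 2 + q ^ 2

lemma one_le_energy (u v : L2 O) (q : ℝ) : 1 ≤ energy e lam u v q := by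
  rw [energy]
  have : 0 ≤ (h1norm e lam u ^ 2 + ‖v‖ ^ 2) / 2 + q ^ 2 := by positivity
  linarith

lemma energy_nonneg (u v : L2 O) (q : ℝ) : 0 ≤ energy e lam u v q :=
  zero_le_one.trans (one_le_energy u v q)

lemma energy_bounds (u v : L2 O) (q : ℝ) : h1norm e lam u ≤ 2 * energy e lam u v q ∧
    ‖v‖ ≤ 2 * energy e lam u v q ∧ |q| ≤ energy e lam u v q ∧
    ‖v‖ ^ 2 ≤ 2 * energy e lam u v q ∧
    (1 + h1norm e lam u) ^ 2 ≤ 4 * energy e lam u v q := by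
  have h1 := sq_nonneg (h1norm e lam u - 1)
  have h2 := sq_nonneg (‖v‖ - 1)
  have h3 := sq_nonneg (|q| - 1)
  have h4 := sq_nonneg (h1norm e lam u)
  have h5 := sq_nonneg ‖v‖
  have h6 := sq_nonneg q
  have h7 := sq_abs q
  refine ⟨?_, ?_, ?_, ?_, ?_⟩ <;> rw [energy] <;> nlinarith

lemma energy_step_eq (hl : ∀ i, 0 < lam i) {s : Scheme} {τ : ℝ} (hτ : 0 ≤ τ)
    {û ξ u v u' v' : L2 O} {q q' : ℝ} (hu : u ∈ H1 e lam) (hu' : u' ∈ H1 e lam)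
    (h : Step e lam Ft δ₀ s τ û ξ u v q u' v' q') :
    energy e lam u' v' q' = energy e lam u v q + ⟪v, ξ⟫_ℝ + ‖ξ‖ ^ 2 / 2 := by
  have h1 := energy_step hl hτ hu hu' h
  have h2 := norm_add_sq_real v ξ
  rw [energy, energy]
  linarith

lemma stronglyMeasurable_energy (hl : ∀ i, 0 < lam i) (hm : Monotone lam) {Ω : Type*}
    {m : MeasurableSpace Ω} {U v : Ω → L2 O} {q : Ω → ℝ} (hU : StronglyMeasurable[m] U)
    (hH : ∀ ω, U ω ∈ H1 e lam) (hv : StronglyMeasurable[m] v) (hq : Measurable[m] q) :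
    StronglyMeasurable[m] fun ω => energy e lam (U ω) (v ω) (q ω) := by
  have h1 := (h1Continuous_h1norm hl).stronglyMeasurable_comp hl hm hU hH
  have hc : Continuous fun z : (ℝ × ℝ) × ℝ => 1 + (z.1.1 ^ 2 + z.1.2 ^ 2) / 2 + z.2 ^ 2 := by
    fun_prop
  exact hc.comp_stronglyMeasurable ((h1.prodMk hv.norm).prodMk hq.stronglyMeasurable)

lemma tsum_enorm_sq_le (hcoef : CoefficientAssumption e lam R Ft g k δ₀) {c₂ : ℝ} (hc₂ : 0 < c₂)
    (hg : ∀ u ∈ H1 e lam, hsNorm e R (g (Theta u)) ≤ c₂ * (1 + h1norm e lam u)) {u : L2 O}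
    (hu : u ∈ H1 e lam) (v : L2 O) (q : ℝ) :
    ∑' i, ‖g (Theta u) (toCM R (e i))‖ₑ ^ 2 ≤
      ENNReal.ofReal (4 * c₂ ^ 2 * energy e lam u v q) := by
  have h1 : ∑' i, ‖g (Theta u) (toCM R (e i))‖ₑ ^ 2 =
      ENNReal.ofReal (∑' i, ‖g (Theta u) (toCM R (e i))‖ ^ 2) := by
    rw [ENNReal.ofReal_tsum_of_nonneg (fun i => by positivity) (hcoef.g_hs u hu).2]
    refine tsum_congr fun i => ?_
    rw [ENNReal.ofReal_pow (norm_nonneg _), ofReal_norm]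
  rw [h1]
  refine ENNReal.ofReal_le_ofReal ?_
  have h2 : hsNorm e R (g (Theta u)) ^ 2 = ∑' i, ‖g (Theta u) (toCM R (e i))‖ ^ 2 :=
    Real.sq_sqrt (tsum_nonneg fun i => by positivity)
  have h3 := (energy_bounds (e := e) (lam := lam) u v q).2.2.2.2
  rw [← h2]
  calc hsNorm e R (g (Theta u)) ^ 2 ≤ (c₂ * (1 + h1norm e lam u)) ^ 2 :=
        pow_le_pow_left₀ (Real.sqrt_nonneg _) (hg u hu) 2
    _ = c₂ ^ 2 * (1 + h1norm e lam u) ^ 2 := by ring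
    _ ≤ c₂ ^ 2 * (4 * energy e lam u v q) := by gcongr
    _ = _ := by ring

/-- The constant in the moment bounds of the noise increments. -/
def noiseConst (c₂ : ℝ) (j : ℕ) : ℝ := (gaussMoment j).toReal * (4 * c₂ ^ 2) ^ j

lemma noiseConst_nonneg (c₂ : ℝ) (j : ℕ) : 0 ≤ noiseConst c₂ j := by
  rw [noiseConst]; positivity

variable {Ω : Type*} {m : MeasurableSpace Ω} [mΩ : MeasurableSpace Ω] {P : Measure Ω}
  [IsProbabilityMeasure P]

/-- Data at the beginning of a step of a scheme, and the noise increment. -/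
structure NoiseStep (e : HilbertBasis ℕ ℝ (L2 O)) (lam : ℕ → ℝ) (R : L2 O →L[ℝ] L2 O)
    (g : L2 O × (Fin d → L2 O) → (CM R →ₗ[ℝ] L2 O)) {Ω : Type*} (m : MeasurableSpace Ω)
    [mΩ : MeasurableSpace Ω] (P : Measure Ω) (Y : ℕ → Ω → ℝ) (τ : ℝ≥0) (U v : Ω → L2 O)
    (q : Ω → ℝ) (ξ : Ω → L2 O) : Prop where
  noise : IsGaussianNoise m P Y τ
  meas_u : StronglyMeasurable[m] U
  mem_H1 : ∀ ω, U ω ∈ H1 e lam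
  meas_v : StronglyMeasurable[m] v
  meas_q : Measurable[m] q
  tendsto : TendstoInMeasure P
    (fun n ω => ∑ k ∈ Finset.range n, Y k ω • g (Theta (U ω)) (toCM R (e k))) atTop ξ
  moments : ∀ r : ℕ, Integrable (fun ω => energy e lam (U ω) (v ω) (q ω) ^ r) P

variable {Y : ℕ → Ω → ℝ} {τ : ℝ≥0} {U v : Ω → L2 O} {q : Ω → ℝ} {ξ : Ω → L2 O}

omit [IsProbabilityMeasure P] in
lemma NoiseStep.measurable_coef (hcoef : CoefficientAssumption e lam R Ft g k δ₀)
    (he : IsDirichletEigenbasis e lam)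
    (hs : NoiseStep e lam R g m P Y τ U v q ξ) (i : ℕ) :
    Measurable[m] fun ω => g (Theta (U ω)) (toCM R (e i)) :=
  ((hcoef.h1Continuous_g he.pos i).stronglyMeasurable_comp he.pos he.mono hs.meas_u
    hs.mem_H1).measurable

/-- Conditionally on the past, ξ is Gaussian with covariance of trace at most 4c₂²τ times the
energy. Each factor ‖ξ‖² thus gains one power of τ and costs one power of the energy. -/
lemma NoiseStep.noise_moment (hcoef : CoefficientAssumption e lam R Ft g k δ₀)
    (he : IsDirichletEigenbasis e lam) {c₂ : ℝ} (hc₂ : 0 < c₂)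
    (hg : ∀ u ∈ H1 e lam, hsNorm e R (g (Theta u)) ≤ c₂ * (1 + h1norm e lam u))
    (hs : NoiseStep e lam R g m P Y τ U v q ξ) (r j : ℕ) :
    Integrable (fun ω => energy e lam (U ω) (v ω) (q ω) ^ r * (‖ξ ω‖ ^ 2) ^ j) P ∧
    ∫ ω, energy e lam (U ω) (v ω) (q ω) ^ r * (‖ξ ω‖ ^ 2) ^ j ∂P ≤
      noiseConst c₂ j * τ ^ j * ∫ ω, energy e lam (U ω) (v ω) (q ω) ^ (r + j) ∂P := by
  have hEm := stronglyMeasurable_energy he.pos he.mono hs.meas_u hs.mem_H1 hs.meas_v hs.meas_q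
  set E : Ω → ℝ := fun ω => energy e lam (U ω) (v ω) (q ω) with hE
  have hE0 : ∀ ω, 0 ≤ E ω := fun ω => energy_nonneg _ _ _
  have hξm := aestronglyMeasurable_noise hs.noise (hs.measurable_coef hcoef he) hs.tendsto
  have hint : 0 ≤ ∫ ω, E ω ^ (r + j) ∂P := integral_nonneg fun ω => pow_nonneg (hE0 ω) _
  refine integrable_of_lintegral_le ?_ ?_ ?_ ?_
  · exact ((hEm.mono hs.noise.le).pow r).aestronglyMeasurable.mul ((hξm.norm.pow 2).pow j)
  · exact ae_of_all _ fun ω => mul_nonneg (pow_nonneg (hE0 ω) _) (by positivity)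
  · have := noiseConst_nonneg c₂ j
    positivity
  have h1 := hs.noise.lintegral_limit_le e (Ψ := fun ω => ENNReal.ofReal (E ω ^ r))
    (hEm.measurable.pow_const r).ennreal_ofReal (fun ω => ENNReal.ofReal_ne_top)
    (hs.measurable_coef hcoef he) hs.tendsto j
  have h2 : ∀ ω, ENNReal.ofReal (E ω ^ r * (‖ξ ω‖ ^ 2) ^ j) =
      ENNReal.ofReal (E ω ^ r) * ‖ξ ω‖ₑ ^ (2 * j) := fun ω => by
    rw [ENNReal.ofReal_mul (pow_nonneg (hE0 ω) _), ← pow_mul, ENNReal.ofReal_pow (norm_nonneg _),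
      ofReal_norm]
  refine (le_of_eq (lintegral_congr h2)).trans (h1.trans ?_)
  have h3 : ∀ ω, ENNReal.ofReal (E ω ^ r) *
      (∑' i, ‖g (Theta (U ω)) (toCM R (e i))‖ₑ ^ 2) ^ j ≤
      ENNReal.ofReal ((4 * c₂ ^ 2) ^ j * E ω ^ (r + j)) := fun ω => by
    calc ENNReal.ofReal (E ω ^ r) * (∑' i, ‖g (Theta (U ω)) (toCM R (e i))‖ₑ ^ 2) ^ j
        ≤ ENNReal.ofReal (E ω ^ r) * (ENNReal.ofReal (4 * c₂ ^ 2 * E ω)) ^ j := by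
          gcongr
          exact tsum_enorm_sq_le hcoef hc₂ hg (hs.mem_H1 ω) _ _
      _ = _ := by
          have := hE0 ω
          rw [← ENNReal.ofReal_pow (by positivity), ← ENNReal.ofReal_mul (by positivity)]
          congr 1
          ring
  calc gaussMoment j * (τ : ℝ≥0∞) ^ j * ∫⁻ ω, ENNReal.ofReal (E ω ^ r) *
        (∑' i, ‖g (Theta (U ω)) (toCM R (e i))‖ₑ ^ 2) ^ j ∂P
      ≤ gaussMoment j * (τ : ℝ≥0∞) ^ j *
        ∫⁻ ω, ENNReal.ofReal ((4 * c₂ ^ 2) ^ j * E ω ^ (r + j)) ∂P := by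
        gcongr with ω
        exact h3 ω
    _ = gaussMoment j * (τ : ℝ≥0∞) ^ j *
        ENNReal.ofReal ((4 * c₂ ^ 2) ^ j * ∫ ω, E ω ^ (r + j) ∂P) := by
        rw [← integral_const_mul, ofReal_integral_eq_lintegral_ofReal
          ((hs.moments (r + j)).const_mul _)]
        exact ae_of_all _ fun ω => mul_nonneg (by positivity) (pow_nonneg (hE0 ω) _)
    _ = _ := by
        have e1 : (τ : ℝ≥0∞) ^ j = ENNReal.ofReal ((τ : ℝ) ^ j) := by
          rw [ENNReal.ofReal_pow τ.coe_nonneg, ENNReal.ofReal_coe_nnreal]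
        rw [e1, ← ENNReal.ofReal_toReal (gaussMoment_ne_top j),
          ← ENNReal.ofReal_mul (by positivity), ← ENNReal.ofReal_mul (by positivity), noiseConst]
        congr 1
        ring

/-- The martingale term: energy and velocity are known before the noise. Square integrability of the
weighted velocity uses the energy moment of order 2p + 1, hence the assumption on all orders. -/
lemma NoiseStep.integral_inner (hcoef : CoefficientAssumption e lam R Ft g k δ₀)
    (he : IsDirichletEigenbasis e lam) {c₂ : ℝ} (hc₂ : 0 < c₂)
    (hg : ∀ u ∈ H1 e lam, hsNorm e R (g (Theta u)) ≤ c₂ * (1 + h1norm e lam u))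
    (hs : NoiseStep e lam R g m P Y τ U v q ξ) (p : ℕ) :
    Integrable (fun ω => energy e lam (U ω) (v ω) (q ω) ^ p * ⟪v ω, ξ ω⟫_ℝ) P ∧
    ∫ ω, energy e lam (U ω) (v ω) (q ω) ^ p * ⟪v ω, ξ ω⟫_ℝ ∂P = 0 := by
  have hEm := stronglyMeasurable_energy he.pos he.mono hs.meas_u hs.mem_H1 hs.meas_v hs.meas_q
  set E : Ω → ℝ := fun ω => energy e lam (U ω) (v ω) (q ω) with hE
  have hE0 : ∀ ω, 0 ≤ E ω := fun ω => energy_nonneg _ _ _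
  have hwm : StronglyMeasurable[m] fun ω => E ω ^ p • v ω := (hEm.pow p).smul hs.meas_v
  have hw2 : MemLp (fun ω => E ω ^ p • v ω) 2 P := by
    refine (memLp_two_iff_integrable_sq_norm (hwm.mono hs.noise.le).aestronglyMeasurable).2 ?_
    refine Integrable.mono' ((hs.moments (2 * p + 1)).const_mul 2)
      (((hwm.mono hs.noise.le).norm.pow 2).aestronglyMeasurable) (ae_of_all _ fun ω => ?_)
    rw [Real.norm_of_nonneg (by positivity), norm_smul, mul_pow,
      Real.norm_of_nonneg (pow_nonneg (hE0 ω) _)]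
    have h1 := (energy_bounds (e := e) (lam := lam) (U ω) (v ω) (q ω)).2.2.2.1
    calc (E ω ^ p) ^ 2 * ‖v ω‖ ^ 2 ≤ (E ω ^ p) ^ 2 * (2 * E ω) := by gcongr
      _ = 2 * E ω ^ (2 * p + 1) := by ring
  have hB2 : ∑' i, ∫⁻ ω, ‖g (Theta (U ω)) (toCM R (e i))‖ₑ ^ 2 ∂P ≠ ∞ := by
    rw [← lintegral_tsum fun i => (((hs.measurable_coef hcoef he i).mono hs.noise.le
      le_rfl).enorm.pow_const 2).aemeasurable]
    refine ne_of_lt (lt_of_le_of_lt (lintegral_mono fun ω =>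
      tsum_enorm_sq_le hcoef hc₂ hg (hs.mem_H1 ω) (v ω) (q ω)) ?_)
    have h1 := ((hs.moments 1).const_mul (4 * c₂ ^ 2)).2
    simp only [pow_one] at h1
    rwa [hasFiniteIntegral_iff_ofReal] at h1
    exact ae_of_all _ fun ω => mul_nonneg (by positivity) (hE0 ω)
  have h := hs.noise.integral_inner_eq_zero e (hs.measurable_coef hcoef he) hs.tendsto
    hwm.measurable hw2 hB2
  simpa only [real_inner_smul_left] using h

/-- The rate of growth of the moments of the energy. -/
def momentRate (c₂ : ℝ) (T : ℝ≥0) (p : ℕ) : ℝ :=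
  (exists_pow_add_le p).choose * (noiseConst c₂ 1 + noiseConst c₂ (p + 1) * T ^ p)

lemma momentRate_nonneg (c₂ : ℝ) (T : ℝ≥0) (p : ℕ) : 0 ≤ momentRate c₂ T p := by
  have h0 := (exists_pow_add_le p).choose_spec.1
  have h1 := noiseConst_nonneg c₂ 1
  have h2 := noiseConst_nonneg c₂ (p + 1)
  rw [momentRate]
  positivity

/-- Growth of the moments of the energy in one step. -/
lemma NoiseStep.moment_step (hcoef : CoefficientAssumption e lam R Ft g k δ₀)
    (he : IsDirichletEigenbasis e lam) {c₂ : ℝ} (hc₂ : 0 < c₂)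
    (hg : ∀ u ∈ H1 e lam, hsNorm e R (g (Theta u)) ≤ c₂ * (1 + h1norm e lam u)) {T : ℝ≥0}
    (p : ℕ) (hτ : τ ≤ T) (hs : NoiseStep e lam R g m P Y τ U v q ξ) {Z : Ω → ℝ}
    (hZ : ∀ᵐ ω ∂P, Z ω = energy e lam (U ω) (v ω) (q ω) + ⟪v ω, ξ ω⟫_ℝ + ‖ξ ω‖ ^ 2 / 2)
    (hZ0 : ∀ᵐ ω ∂P, 0 ≤ Z ω) :
    Integrable (fun ω => Z ω ^ (p + 1)) P ∧ ∫ ω, Z ω ^ (p + 1) ∂P ≤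
      (1 + momentRate c₂ T p * τ) * ∫ ω, energy e lam (U ω) (v ω) (q ω) ^ (p + 1) ∂P := by
  obtain ⟨hC, hpow⟩ := (exists_pow_add_le p).choose_spec
  rw [momentRate]
  set C := (exists_pow_add_le p).choose
  have hn1 := noiseConst_nonneg c₂ 1
  have hn2 := noiseConst_nonneg c₂ (p + 1)
  have hEm := stronglyMeasurable_energy he.pos he.mono hs.meas_u hs.mem_H1 hs.meas_v hs.meas_q
  have hξm := aestronglyMeasurable_noise hs.noise (hs.measurable_coef hcoef he) hs.tendsto
  obtain ⟨i1, z1⟩ := hs.integral_inner hcoef he hc₂ hg p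
  obtain ⟨i2, z2⟩ := hs.noise_moment hcoef he hc₂ hg p 1
  obtain ⟨i3, z3⟩ := hs.noise_moment hcoef he hc₂ hg 0 (p + 1)
  have i0 := hs.moments (p + 1)
  simp only [pow_zero, one_mul, zero_add, pow_one] at i2 z2 i3 z3
  set E : Ω → ℝ := fun ω => energy e lam (U ω) (v ω) (q ω) with hE
  have hE0 : ∀ ω, 0 ≤ E ω := fun ω => energy_nonneg _ _ _
  -- Only the first-order term in ⟨v, ξ⟩ changes sign, and its expectation is zero; all other terms
  -- are controlled by the noise moments.
  have hbound : ∀ᵐ ω ∂P, Z ω ^ (p + 1) ≤ E ω ^ (p + 1) + (p + 1) * (E ω ^ p * ⟪v ω, ξ ω⟫_ℝ)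
      + C * (E ω ^ p * ‖ξ ω‖ ^ 2 + (‖ξ ω‖ ^ 2) ^ (p + 1)) := by
    filter_upwards [hZ, hZ0] with ω h1 h2
    rw [h1] at h2 ⊢
    refine hpow _ _ _ (hE0 ω) (by positivity) ?_ h2
    have h3 := (energy_bounds (e := e) (lam := lam) (U ω) (v ω) (q ω)).2.2.2.1
    calc ⟪v ω, ξ ω⟫_ℝ ^ 2 ≤ (‖v ω‖ * ‖ξ ω‖) ^ 2 := by
          rw [← sq_abs]
          exact pow_le_pow_left₀ (abs_nonneg _) (abs_real_inner_le_norm _ _) 2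
      _ = ‖v ω‖ ^ 2 * ‖ξ ω‖ ^ 2 := by ring
      _ ≤ 2 * E ω * ‖ξ ω‖ ^ 2 := by gcongr
  have hZm : AEStronglyMeasurable Z P := by
    refine AEStronglyMeasurable.congr ?_ (EventuallyEq.symm hZ)
    exact ((hEm.mono hs.noise.le).aestronglyMeasurable.add
      ((hs.meas_v.mono hs.noise.le).aestronglyMeasurable.inner hξm)).add
      ((hξm.norm.aemeasurable.pow_const 2).div_const 2).aestronglyMeasurable
  have j0 : Integrable (fun ω => (p + 1) * (E ω ^ p * ⟪v ω, ξ ω⟫_ℝ)) P := i1.const_mul _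
  have j1 : Integrable (fun ω => E ω ^ (p + 1) + (p + 1) * (E ω ^ p * ⟪v ω, ξ ω⟫_ℝ)) P :=
    i0.add j0
  have j2 : Integrable (fun ω => C * (E ω ^ p * ‖ξ ω‖ ^ 2 + (‖ξ ω‖ ^ 2) ^ (p + 1))) P :=
    (i2.add i3).const_mul C
  have z1' : ∫ ω, E ω ^ p * ⟪v ω, ξ ω⟫_ℝ ∂P = 0 := z1
  have hdom : Integrable (fun ω => E ω ^ (p + 1) + (p + 1) * (E ω ^ p * ⟪v ω, ξ ω⟫_ℝ)
      + C * (E ω ^ p * ‖ξ ω‖ ^ 2 + (‖ξ ω‖ ^ 2) ^ (p + 1))) P :=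
    j1.add j2
  have hZi : Integrable (fun ω => Z ω ^ (p + 1)) P := by
    refine hdom.mono' (hZm.pow _) ?_
    filter_upwards [hbound, hZ0] with ω h1 h2
    rwa [Real.norm_of_nonneg (pow_nonneg h2 _)]
  refine ⟨hZi, (integral_mono_ae hZi hdom hbound).trans ?_⟩
  have hsplit : ∫ ω, (E ω ^ (p + 1) + (p + 1) * (E ω ^ p * ⟪v ω, ξ ω⟫_ℝ)
      + C * (E ω ^ p * ‖ξ ω‖ ^ 2 + (‖ξ ω‖ ^ 2) ^ (p + 1))) ∂P =
      ∫ ω, E ω ^ (p + 1) ∂P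
        + C * (∫ ω, E ω ^ p * ‖ξ ω‖ ^ 2 ∂P + ∫ ω, (‖ξ ω‖ ^ 2) ^ (p + 1) ∂P) := by
    rw [integral_add j1 j2, integral_add i0 j0, integral_const_mul, integral_const_mul, z1',
      integral_add i2 i3]
    ring
  rw [hsplit]
  have hI : 0 ≤ ∫ ω, E ω ^ (p + 1) ∂P := integral_nonneg fun ω => pow_nonneg (hE0 ω) _
  -- One factor τ is retained so that the growth factor is 1 + O(τ); the other powers go into T^p.
  have hτp : (τ : ℝ) ^ (p + 1) ≤ T ^ p * τ := by
    rw [pow_succ]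
    gcongr
  have z3' : ∫ ω, (‖ξ ω‖ ^ 2) ^ (p + 1) ∂P ≤
      noiseConst c₂ (p + 1) * (T ^ p * τ) * ∫ ω, E ω ^ (p + 1) ∂P := z3.trans (by gcongr)
  calc ∫ ω, E ω ^ (p + 1) ∂P
        + C * (∫ ω, E ω ^ p * ‖ξ ω‖ ^ 2 ∂P + ∫ ω, (‖ξ ω‖ ^ 2) ^ (p + 1) ∂P)
      ≤ ∫ ω, E ω ^ (p + 1) ∂P
        + C * (noiseConst c₂ 1 * τ * ∫ ω, E ω ^ (p + 1) ∂P +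
          noiseConst c₂ (p + 1) * (T ^ p * τ) * ∫ ω, E ω ^ (p + 1) ∂P) := by gcongr
    _ = _ := by ring

end OneStep

/-! ### Uniform moment bounds along the numerical solution. -/

section Moments

variable {d : ℕ} {O : Opens (EuclideanSpace ℝ (Fin d))}
variable {e : HilbertBasis ℕ ℝ (L2 O)} {lam : ℕ → ℝ} {R : L2 O →L[ℝ] L2 O}
variable {Ft : ℝ → ℝ} {g : L2 O × (Fin d → L2 O) → (CM R →ₗ[ℝ] L2 O)} {k : ℕ} {δ₀ : ℝ}
variable {Ω : Type*} [mΩ : MeasurableSpace Ω] {P : Measure Ω}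

local instance : MeasurableSpace (L2 O) := borel _

local instance : BorelSpace (L2 O) := ⟨rfl⟩

local instance : Fact ((2 : ℝ≥0∞) ≠ ∞) := ⟨ENNReal.ofNat_ne_top⟩

local instance : SecondCountableTopology (L2 O) := inferInstance

lemma IsWienerFamily.isGaussianNoise {ℱ : Filtration ℝ≥0 mΩ} {β : ℕ → ℝ≥0 → Ω → ℝ}
    (h : IsWienerFamily P ℱ β) (s τ : ℝ≥0) :
    IsGaussianNoise (ℱ s) P (fun k ω => β k (s + τ) ω - β k s ω) τ where
  le := ℱ.le s
  meas k := ((h.adapted k _).mono (ℱ.le _) le_rfl).sub ((h.adapted k _).mono (ℱ.le _) le_rfl)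
  indep := h.indep.comp (fun _ (w : ℝ≥0 → ℝ) => w (s + τ) - w s)
    fun _ => (measurable_pi_apply _).sub (measurable_pi_apply _)
  law k := by
    have h1 := ((h.brownian k).toIsPreBrownianReal.hasLaw_sub (s + τ) s).map_eq
    have h2 : nndist (s + τ : ℝ≥0).1 s.1 = τ := by
      ext
      rw [coe_nndist, Real.dist_eq]
      simp
    rw [h2] at h1
    exact h1
  indep_past := h.indep_past s (s + τ) le_self_add

variable {ℱ : Filtration ℝ≥0 mΩ} {β : ℕ → ℝ≥0 → Ω → ℝ} {s : Scheme} {x : Extrapolation}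
  {N : ℕ} {τ T : ℝ≥0} {u₀ v₀ : Ω → L2 O} {u v : ℕ → Ω → L2 O} {q : ℕ → Ω → ℝ}

lemma IsNumericalSolution.exists_version
    (hsol : IsNumericalSolution e lam R Ft P g δ₀ ℱ β s x N τ u₀ v₀ u v q) {n : ℕ} (hn : n ≤ N) :
    ∃ U : Ω → L2 O, StronglyMeasurable[ℱ (n * τ)] U ∧ (∀ ω, U ω ∈ H1 e lam) ∧ u n =ᵐ[P] U := by
  obtain ⟨U, h1, h2, h3⟩ := exists_H1_version (e := e) (lam := lam) (hsol.adapted_u n hn)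
  exact ⟨U, h1, h2, (hsol.mem_H1 n hn).mono fun ω hω => (h3 ω hω).symm⟩

lemma IsNumericalSolution.aestronglyMeasurable_energy (he : IsDirichletEigenbasis e lam)
    (hsol : IsNumericalSolution e lam R Ft P g δ₀ ℱ β s x N τ u₀ v₀ u v q) {n : ℕ} (hn : n ≤ N) :
    AEStronglyMeasurable (fun ω => energy e lam (u n ω) (v n ω) (q n ω)) P := by
  obtain ⟨U, h1, h2, h3⟩ := hsol.exists_version hn
  have h4 := (stronglyMeasurable_energy he.pos he.mono h1 h2 (hsol.adapted_v n hn)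
    (hsol.adapted_q n hn)).mono (ℱ.le _)
  refine h4.aestronglyMeasurable.congr ?_
  filter_upwards [h3] with ω hω
  rw [hω]

lemma IsNumericalSolution.noiseStep (hW : IsWienerFamily P ℱ β)
    (hsol : IsNumericalSolution e lam R Ft P g δ₀ ℱ β s x N τ u₀ v₀ u v q) {n : ℕ} (hn : n < N)
    {ξ : Ω → L2 O}
    (hξ : IsNoiseIncrement e R P β (n * τ) ((n + 1 : ℕ) * τ) (fun ω => g (Theta (u n ω))) ξ)
    (hM : ∀ r : ℕ, Integrable (fun ω => energy e lam (u n ω) (v n ω) (q n ω) ^ r) P) :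
    ∃ U : Ω → L2 O, u n =ᵐ[P] U ∧ NoiseStep e lam R g (ℱ (n * τ)) P
      (fun k ω => β k (n * τ + τ) ω - β k (n * τ) ω) τ U (v n) (q n) ξ := by
  obtain ⟨U, h1, h2, h3⟩ := hsol.exists_version hn.le
  refine ⟨U, h3, ⟨hW.isGaussianNoise _ _, h1, h2, hsol.adapted_v n hn.le, hsol.adapted_q n hn.le,
    ?_, fun r => (hM r).congr ?_⟩⟩
  · have e1 : ((n + 1 : ℕ) : ℝ≥0) * τ = n * τ + τ := by push_cast; ring
    rw [IsNoiseIncrement, e1] at hξ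
    refine hξ.congr_left fun l => ?_
    filter_upwards [h3] with ω hω
    rw [hω]
  · filter_upwards [h3] with ω hω
    rw [hω]

variable [IsProbabilityMeasure P]

/-- Bound on the moments of the energy, uniform with respect to the discretisation. -/
def energyMoment (c₂ : ℝ) (T : ℝ≥0) (M : ℕ → ℝ) (r : ℕ) : ℝ :=
  Real.exp (momentRate c₂ T (r - 1) * T) * M r

/-- Discrete Gronwall inequality. The induction carries integrability of every order, because a step
at one order uses higher moments of the current energy. -/
lemma IsNumericalSolution.energy_moments (hcoef : CoefficientAssumption e lam R Ft g k δ₀)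
    (he : IsDirichletEigenbasis e lam) {c₂ : ℝ} (hc₂ : 0 < c₂)
    (hg : ∀ u ∈ H1 e lam, hsNorm e R (g (Theta u)) ≤ c₂ * (1 + h1norm e lam u))
    (hW : IsWienerFamily P ℱ β)
    (hsol : IsNumericalSolution e lam R Ft P g δ₀ ℱ β s x N τ u₀ v₀ u v q) (hN : 1 ≤ N)
    (hNT : N * τ = T) {M : ℕ → ℝ}
    (h0 : ∀ r : ℕ, Integrable (fun ω => energy e lam (u 0 ω) (v 0 ω) (q 0 ω) ^ r) P ∧
      ∫ ω, energy e lam (u 0 ω) (v 0 ω) (q 0 ω) ^ r ∂P ≤ M r) {n : ℕ} (hn : n ≤ N) (r : ℕ) :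
    Integrable (fun ω => energy e lam (u n ω) (v n ω) (q n ω) ^ r) P ∧
      ∫ ω, energy e lam (u n ω) (v n ω) (q n ω) ^ r ∂P ≤ energyMoment c₂ T M r := by
  have hτT : τ ≤ T := by
    rw [← hNT]
    exact le_mul_of_one_le_left zero_le (by exact_mod_cast hN)
  have key : ∀ n ≤ N, (∀ r : ℕ,
      Integrable (fun ω => energy e lam (u n ω) (v n ω) (q n ω) ^ r) P) ∧
      ∀ p : ℕ, ∫ ω, energy e lam (u n ω) (v n ω) (q n ω) ^ (p + 1) ∂P ≤
        (1 + momentRate c₂ T p * τ) ^ n * M (p + 1) := by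
    intro n
    induction n with
    | zero => exact fun _ => ⟨fun r => (h0 r).1, fun p => by simpa using (h0 (p + 1)).2⟩
    | succ n ih =>
      intro hn
      have hn' : n < N := hn
      obtain ⟨ih1, ih2⟩ := ih hn'.le
      obtain ⟨ξ, hξ, hstep⟩ := hsol.step n hn'
      obtain ⟨U, hU, hs⟩ := hsol.noiseStep hW hn' hξ ih1
      have hZ : ∀ᵐ ω ∂P, energy e lam (u (n + 1) ω) (v (n + 1) ω) (q (n + 1) ω) =
          energy e lam (U ω) (v n ω) (q n ω) + ⟪v n ω, ξ ω⟫_ℝ + ‖ξ ω‖ ^ 2 / 2 := by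
        filter_upwards [hU, hstep, hsol.mem_H1 n hn'.le, hsol.mem_H1 (n + 1) hn] with ω a1 a2 a3 a4
        rw [energy_step_eq he.pos τ.coe_nonneg a3 a4 a2, a1]
      have hZ0 : ∀ᵐ ω ∂P, 0 ≤ energy e lam (u (n + 1) ω) (v (n + 1) ω) (q (n + 1) ω) :=
        ae_of_all _ fun ω => energy_nonneg _ _ _
      refine ⟨fun r => ?_, fun p => ?_⟩
      · cases r with
        | zero => simp
        | succ p => exact (hs.moment_step hcoef he hc₂ hg p hτT hZ hZ0).1
      · refine (hs.moment_step hcoef he hc₂ hg p hτT hZ hZ0).2.trans ?_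
        have e1 : ∫ ω, energy e lam (U ω) (v n ω) (q n ω) ^ (p + 1) ∂P =
            ∫ ω, energy e lam (u n ω) (v n ω) (q n ω) ^ (p + 1) ∂P :=
          integral_congr_ae (hU.mono fun ω hω => by simp only [hω])
        have hr := momentRate_nonneg c₂ T p
        rw [e1, pow_succ', mul_assoc]
        gcongr
        exact ih2 p
  refine ⟨(key n hn).1 r, ?_⟩
  -- At order 0 the truncated `r - 1` selects the rate of index 0. That rate is nonnegative, so the
  -- exponential factor is at least 1 and does no harm.
  cases r with
  | zero =>
    have h1 := (h0 0).2
    simp only [pow_zero] at h1 ⊢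
    refine h1.trans ?_
    have h2 : (0 : ℝ) ≤ M 0 := le_trans (by simp) h1
    have h3 := momentRate_nonneg c₂ T (0 - 1)
    exact le_mul_of_one_le_left h2 (Real.one_le_exp (by positivity))
  | succ p =>
    refine ((key n hn).2 p).trans ?_
    have hr := momentRate_nonneg c₂ T p
    have hM0 : 0 ≤ M (p + 1) := le_trans
      (integral_nonneg fun ω => pow_nonneg (energy_nonneg _ _ _) _) (h0 (p + 1)).2
    rw [energyMoment, Nat.add_sub_cancel]
    gcongr
    have hnT : (n : ℝ) * τ ≤ T := by
      rw [← hNT]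
      push_cast
      gcongr
    calc (1 + momentRate c₂ T p * τ) ^ n ≤ Real.exp (momentRate c₂ T p * τ) ^ n := by
          gcongr
          rw [add_comm]
          exact Real.add_one_le_exp _
      _ = Real.exp (momentRate c₂ T p * (n * τ)) := by
          rw [← Real.exp_nat_mul]; ring_nf
      _ ≤ _ := by gcongr

/-- The random variable `X` is nonnegative and its moments are bounded by `a`. -/
structure HasMoments (P : Measure Ω) (X : Ω → ℝ) (a : ℕ → ℝ) : Prop where
  nonneg : ∀ ω, 0 ≤ X ω
  meas : AEStronglyMeasurable X P
  moments : ∀ r : ℕ, Integrable (fun ω => X ω ^ r) P ∧ ∫ ω, X ω ^ r ∂P ≤ a r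

/-- A bound for the moments of a sum. -/
def addMoments (a b : ℕ → ℝ) (r : ℕ) : ℝ := 2 ^ (r - 1) * (a r + b r)

omit [IsProbabilityMeasure P] in
lemma HasMoments.add {X Y : Ω → ℝ} {a b : ℕ → ℝ} (hX : HasMoments P X a) (hY : HasMoments P Y b) :
    HasMoments P (fun ω => X ω + Y ω) (addMoments a b) := by
  refine ⟨fun ω => add_nonneg (hX.nonneg ω) (hY.nonneg ω), hX.meas.add hY.meas, fun r => ?_⟩
  have hdom : Integrable (fun ω => 2 ^ (r - 1) * (X ω ^ r + Y ω ^ r)) P :=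
    ((hX.moments r).1.add (hY.moments r).1).const_mul _
  have hle : ∀ ω, (X ω + Y ω) ^ r ≤ 2 ^ (r - 1) * (X ω ^ r + Y ω ^ r) := fun ω =>
    add_pow_le (hX.nonneg ω) (hY.nonneg ω) r
  have hint : Integrable (fun ω => (X ω + Y ω) ^ r) P := by
    refine hdom.mono' ((hX.meas.add hY.meas).pow r) (ae_of_all _ fun ω => ?_)
    rw [Real.norm_of_nonneg (pow_nonneg (add_nonneg (hX.nonneg ω) (hY.nonneg ω)) r)]
    exact hle ω
  refine ⟨hint, (integral_mono hint hdom hle).trans ?_⟩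
  rw [integral_const_mul, integral_add (hX.moments r).1 (hY.moments r).1, addMoments]
  gcongr
  exacts [(hX.moments r).2, (hY.moments r).2]

/-- Bound on the moments of the squared noise increments. -/
def incrementMoment (c₂ : ℝ) (T : ℝ≥0) (M : ℕ → ℝ) (r : ℕ) : ℝ :=
  noiseConst c₂ r * T ^ r * energyMoment c₂ T M r

lemma IsNumericalSolution.noise_moments (hcoef : CoefficientAssumption e lam R Ft g k δ₀)
    (he : IsDirichletEigenbasis e lam) {c₂ : ℝ} (hc₂ : 0 < c₂)
    (hg : ∀ u ∈ H1 e lam, hsNorm e R (g (Theta u)) ≤ c₂ * (1 + h1norm e lam u))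
    (hW : IsWienerFamily P ℱ β)
    (hsol : IsNumericalSolution e lam R Ft P g δ₀ ℱ β s x N τ u₀ v₀ u v q) (hτT : τ ≤ T)
    {n : ℕ} (hn : n < N) {ξ : Ω → L2 O}
    (hξ : IsNoiseIncrement e R P β (n * τ) ((n + 1 : ℕ) * τ) (fun ω => g (Theta (u n ω))) ξ)
    {M : ℕ → ℝ}
    (hM : ∀ r : ℕ, Integrable (fun ω => energy e lam (u n ω) (v n ω) (q n ω) ^ r) P ∧
      ∫ ω, energy e lam (u n ω) (v n ω) (q n ω) ^ r ∂P ≤ energyMoment c₂ T M r) :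
    HasMoments P (fun ω => ‖ξ ω‖ ^ 2) (incrementMoment c₂ T M) := by
  obtain ⟨U, hU, hs⟩ := hsol.noiseStep hW hn hξ fun r => (hM r).1
  have hξm := aestronglyMeasurable_noise hs.noise (hs.measurable_coef hcoef he) hs.tendsto
  refine ⟨fun ω => by positivity, hξm.norm.pow 2, fun r => ?_⟩
  have h := hs.noise_moment hcoef he hc₂ hg 0 r
  simp only [pow_zero, one_mul, zero_add] at h
  refine ⟨h.1, h.2.trans ?_⟩
  have e1 : ∫ ω, energy e lam (U ω) (v n ω) (q n ω) ^ r ∂P =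
      ∫ ω, energy e lam (u n ω) (v n ω) (q n ω) ^ r ∂P :=
    integral_congr_ae (hU.mono fun ω hω => by simp only [hω])
  have h0 := noiseConst_nonneg c₂ r
  have hI : 0 ≤ ∫ ω, energy e lam (u n ω) (v n ω) (q n ω) ^ r ∂P :=
    integral_nonneg fun ω => pow_nonneg (energy_nonneg _ _ _) _
  rw [e1, incrementMoment]
  gcongr
  exact (hM r).2

/-- F grows polynomially, by comparison with its value at 0, and q starts near √(F + δ₀). The norms
of the data thus control the initial energy, q included. -/
lemma exists_initial_energy_le (hcoef : CoefficientAssumption e lam R Ft g k δ₀)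
    (he : IsDirichletEigenbasis e lam) {γ K : ℝ} {L : ℕ} (hB : PolyBound e lam Ft γ K L)
    (hF : ∀ u ∈ H1 e lam, 0 ≤ F Ft u + δ₀) (D : ℝ) :
    ∃ C : ℝ, 0 ≤ C ∧ ∀ u ∈ H1 e lam, ∀ (v : L2 O) (q : ℝ), |q - √(F Ft u + δ₀)| ≤ D →
      energy e lam u v q ≤ C * (1 + h1norm e lam u + ‖v‖) ^ (L + 2) := by
  have hK := hB.nonneg
  refine ⟨1 + 2 * |F Ft (0 : L2 O) + δ₀| + 2 * K * (√(lam 0))⁻¹ + 2 * D ^ 2, by positivity,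
    fun u hu v q hq => ?_⟩
  have hn := h1norm_nonneg (e := e) (lam := lam) u
  set W := 1 + h1norm e lam u + ‖v‖ with hW
  have hW1 : 1 ≤ W := by rw [hW]; linarith [norm_nonneg v]
  have huW : h1norm e lam u ≤ W := by rw [hW]; linarith [norm_nonneg v]
  have h1 : F Ft u + δ₀ ≤ |F Ft (0 : L2 O) + δ₀| + K * W ^ L * ((√(lam 0))⁻¹ * W) := by
    have h2 := hcoef.abs_F_sub_le he.pos hB zero_mem_H1 hu hW1
      (by rw [h1norm_zero]; linarith) huW
    rw [sub_zero] at h2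
    have h3 : K * W ^ L * ‖u‖ ≤ K * W ^ L * ((√(lam 0))⁻¹ * W) := by
      gcongr
      exact (norm_le_h1norm he hu).trans (by gcongr)
    have h4 := (abs_le.1 h2).2
    have h5 := le_abs_self (F Ft (0 : L2 O) + δ₀)
    linarith
  have h2 : q ^ 2 ≤ 2 * (F Ft u + δ₀) + 2 * D ^ 2 := by
    have h3 : (q - √(F Ft u + δ₀)) ^ 2 ≤ D ^ 2 := by
      rw [← sq_abs]; exact pow_le_pow_left₀ (abs_nonneg _) hq 2
    have h4 := Real.sq_sqrt (hF u hu)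
    nlinarith [sq_nonneg (q - 2 * √(F Ft u + δ₀))]
  have h3 : 1 + (h1norm e lam u ^ 2 + ‖v‖ ^ 2) / 2 ≤ W ^ 2 := by
    have := norm_nonneg v
    rw [hW]
    nlinarith [mul_nonneg hn this]
  have p1 : W ^ 2 ≤ W ^ (L + 2) := pow_le_pow_right₀ hW1 (by omega)
  have p2 : (1 : ℝ) ≤ W ^ (L + 2) := one_le_pow₀ hW1
  have p3 : W ^ (L + 1) ≤ W ^ (L + 2) := pow_le_pow_right₀ hW1 (by omega)
  have p4 : 2 * |F Ft (0 : L2 O) + δ₀| * 1 ≤ 2 * |F Ft (0 : L2 O) + δ₀| * W ^ (L + 2) := by gcongr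
  have p5 : 2 * D ^ 2 * 1 ≤ 2 * D ^ 2 * W ^ (L + 2) := by gcongr
  have p6 : 2 * K * (√(lam 0))⁻¹ * W ^ (L + 1) ≤ 2 * K * (√(lam 0))⁻¹ * W ^ (L + 2) := by gcongr
  have e1 : K * W ^ L * ((√(lam 0))⁻¹ * W) = K * (√(lam 0))⁻¹ * W ^ (L + 1) := by ring
  rw [energy]
  linarith

omit [IsProbabilityMeasure P] in
lemma integrable_pow_add {X Y : Ω → ℝ} (hX0 : ∀ ω, 0 ≤ X ω) (hY0 : ∀ ω, 0 ≤ Y ω)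
    (hX : ∀ r : ℕ, Integrable (fun ω => X ω ^ r) P) (hY : ∀ r : ℕ, Integrable (fun ω => Y ω ^ r) P)
    (r : ℕ) : Integrable (fun ω => (X ω + Y ω) ^ r) P := by
  have hXm : HasMoments P X fun r => ∫ ω, X ω ^ r ∂P :=
    ⟨hX0, by simpa using (hX 1).1, fun r => ⟨hX r, le_rfl⟩⟩
  have hYm : HasMoments P Y fun r => ∫ ω, Y ω ^ r ∂P :=
    ⟨hY0, by simpa using (hY 1).1, fun r => ⟨hY r, le_rfl⟩⟩
  exact ((hXm.add hYm).moments r).1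

lemma uHat_zero (x : Extrapolation) (u : ℕ → L2 O) : uHat x u 0 = u 0 := by
  cases x with
  | constant => rfl
  | linear =>
    simp only [uHat]
    module

/-- Bound on the moments of the initial energy, uniform with respect to the discretisation. -/
lemma exists_initial_moments (hcoef : CoefficientAssumption e lam R Ft g k δ₀)
    (he : IsDirichletEigenbasis e lam) {γ K : ℝ} {L : ℕ} (hB : PolyBound e lam Ft γ K L)
    (hF : ∀ u ∈ H1 e lam, 0 ≤ F Ft u + δ₀) (C₀ : ℝ)
    (hmom : ∀ r : ℕ, Integrable (fun ω => h1norm e lam (u₀ ω) ^ r) P ∧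
      Integrable (fun ω => ‖v₀ ω‖ ^ r) P) (T : ℝ≥0) :
    ∃ M : ℕ → ℝ, ∀ (ℱ : Filtration ℝ≥0 mΩ) (β : ℕ → ℝ≥0 → Ω → ℝ) (s : Scheme)
      (x : Extrapolation) (N : ℕ) (τ : ℝ≥0), τ ≤ T →
      ∀ (u v : ℕ → Ω → L2 O) (q : ℕ → Ω → ℝ),
        IsNumericalSolution e lam R Ft P g δ₀ ℱ β s x N τ u₀ v₀ u v q →
        (∀ᵐ ω ∂P, |q 0 ω - √(F Ft (uHat x (fun m => u m ω) 0) + δ₀)| ≤ C₀ * τ) →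
        ∀ r : ℕ, Integrable (fun ω => energy e lam (u 0 ω) (v 0 ω) (q 0 ω) ^ r) P ∧
          ∫ ω, energy e lam (u 0 ω) (v 0 ω) (q 0 ω) ^ r ∂P ≤ M r := by
  -- The distance |C₀|T covers the initial error for every step size τ ≤ T at once.
  obtain ⟨C, hC, hE⟩ := exists_initial_energy_le hcoef he hB hF (|C₀| * T)
  have hW : ∀ r : ℕ, Integrable (fun ω => (1 + h1norm e lam (u₀ ω) + ‖v₀ ω‖) ^ r) P :=
    integrable_pow_add (fun ω => add_nonneg zero_le_one (h1norm_nonneg _))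
      (fun ω => norm_nonneg _)
      (integrable_pow_add (X := fun _ => 1) (fun _ => zero_le_one) (fun ω => h1norm_nonneg _)
        (fun r => by simp) fun r => (hmom r).1) fun r => (hmom r).2
  refine ⟨fun r => ∫ ω, (C * (1 + h1norm e lam (u₀ ω) + ‖v₀ ω‖) ^ (L + 2)) ^ r ∂P, ?_⟩
  intro ℱ β s x N τ hτ u v q hsol hq r
  have hdom : Integrable (fun ω => (C * (1 + h1norm e lam (u₀ ω) + ‖v₀ ω‖) ^ (L + 2)) ^ r) P := by
    simp_rw [mul_pow, ← pow_mul]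
    exact (hW _).const_mul _
  have hle : ∀ᵐ ω ∂P, energy e lam (u 0 ω) (v 0 ω) (q 0 ω) ^ r ≤
      (C * (1 + h1norm e lam (u₀ ω) + ‖v₀ ω‖) ^ (L + 2)) ^ r := by
    filter_upwards [hq, hsol.mem_H1 0 (Nat.zero_le _)] with ω h1 h2
    rw [uHat_zero] at h1
    rw [← hsol.init_u, ← hsol.init_v]
    refine pow_le_pow_left₀ (energy_nonneg _ _ _) (hE _ h2 _ _ (h1.trans ?_)) r
    have : (τ : ℝ) ≤ T := by exact_mod_cast hτ
    gcongr
    exact le_abs_self _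
  have hint : Integrable (fun ω => energy e lam (u 0 ω) (v 0 ω) (q 0 ω) ^ r) P := by
    refine hdom.mono' ((hsol.aestronglyMeasurable_energy he (Nat.zero_le _)).pow r) ?_
    filter_upwards [hle] with ω hω
    rwa [Real.norm_of_nonneg (pow_nonneg (energy_nonneg _ _ _) r)]
  exact ⟨hint, integral_mono_ae hint hdom hle⟩

end Moments

/-! ### Powers of τ in the local error. -/

section RealBounds

lemma rpow_le_mul_rpow {τ T a b : ℝ} (hτ : 0 < τ) (hT : τ ≤ T) (h : b ≤ a) :
    τ ^ a ≤ T ^ (a - b) * τ ^ b := by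
  calc τ ^ a = τ ^ (a - b) * τ ^ b := by rw [← Real.rpow_add hτ]; ring_nf
    _ ≤ T ^ (a - b) * τ ^ b := by
      gcongr

/-- The local error is of order `1 + min 1 (2γ - 1)` if the increments are of order one. -/
lemma exists_local_error_rate {γ K c κ T : ℝ} (L : ℕ) (hγ : 1 / 2 < γ) (hK : 0 ≤ K) (hc : 0 < c)
    (hκ : 0 ≤ κ) (hT : 0 < T) :
    ∃ C : ℝ, 0 ≤ C ∧ ∃ m : ℕ, ∀ S τ : ℝ, 1 ≤ S → 0 < τ → τ ≤ T →
      K * (4 * (4 * S)) ^ L * (2 * (τ * (κ * S ^ (L + 1)))) ^ γ * (τ * (κ * S ^ (L + 1))) ^ γ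
            / (2 * √c)
          + (K * (4 * S) ^ L * (τ * (κ * S ^ (L + 1))))
            * (K * (4 * S) ^ L * (2 * (τ * (κ * S ^ (L + 1))))) / (4 * c * √c)
        ≤ C * τ ^ min 1 (2 * γ - 1) * (τ * S ^ m) ∧
      K * (4 * S) ^ L * (τ * (κ * S ^ (L + 1))) / (2 * √c) ≤
        C * τ ^ min 1 (2 * γ - 1) * S ^ m := by
  set μ := min 1 (2 * γ - 1) with hμ
  have hμ1 : μ ≤ 1 := min_le_left _ _
  have hμ2 : μ ≤ 2 * γ - 1 := min_le_right _ _
  have hs : 0 < √c := Real.sqrt_pos.2 hc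
  -- Here S bounds the solution near a step, 4S the Ḣ¹ norms and τκS^(L+1) the increments. Since μ ≤
  -- 1 and μ ≤ 2γ - 1, the surplus exponents of τ are nonnegative and become powers of T.
  set C1 := K * 16 ^ L * (2 ^ γ * κ ^ (2 * γ)) / (2 * √c) * T ^ (2 * γ - (1 + μ)) with hC1
  set C2 := K ^ 2 * 16 ^ L * (2 * κ ^ 2) / (4 * c * √c) * T ^ (2 - (1 + μ)) with hC2
  set C3 := K * 4 ^ L * κ / (2 * √c) * T ^ (1 - μ) with hC3
  have hC1' : 0 ≤ C1 := by positivity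
  have hC2' : 0 ≤ C2 := by positivity
  have hC3' : 0 ≤ C3 := by positivity
  -- One exponent dominating the powers of S in all three terms; the real exponent 2γ is rounded up.
  set m := L + (L + 1) * ⌈2 * γ⌉₊ + (2 * L + 2 * (L + 1)) with hm
  refine ⟨C1 + C2 + C3, by positivity, m, fun S τ hS hτ hτT => ?_⟩
  have hS0 : 0 < S := by linarith
  have hτμ : τ ^ (1 + μ) = τ * τ ^ μ := by rw [Real.rpow_add hτ, Real.rpow_one]
  have t1 : τ ^ (2 * γ) ≤ T ^ (2 * γ - (1 + μ)) * (τ * τ ^ μ) := by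
    rw [← hτμ]; exact rpow_le_mul_rpow hτ hτT (by linarith)
  have t2 : τ ^ 2 ≤ T ^ (2 - (1 + μ)) * (τ * τ ^ μ) := by
    rw [← hτμ, ← Real.rpow_natCast]; exact rpow_le_mul_rpow hτ hτT (by push_cast; linarith)
  have t3 : τ ≤ T ^ (1 - μ) * τ ^ μ := by
    simpa using rpow_le_mul_rpow hτ hτT hμ1
  have s1 : (S ^ (L + 1)) ^ (2 * γ) ≤ S ^ ((L + 1) * ⌈2 * γ⌉₊) := by
    rw [pow_mul, ← Real.rpow_natCast (S ^ (L + 1))]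
    exact Real.rpow_le_rpow_of_exponent_le (one_le_pow₀ hS) (Nat.le_ceil _)
  have e1 : (2 * (τ * (κ * S ^ (L + 1)))) ^ γ * (τ * (κ * S ^ (L + 1))) ^ γ =
      2 ^ γ * κ ^ (2 * γ) * (S ^ (L + 1)) ^ (2 * γ) * τ ^ (2 * γ) := by
    have h : ∀ y : ℝ, 0 ≤ y → y ^ (2 * γ) = y ^ γ * y ^ γ := fun y hy => by
      rw [two_mul, Real.rpow_add_of_nonneg hy (by linarith) (by linarith)]
    rw [h κ hκ, h (S ^ (L + 1)) (by positivity), h τ hτ.le, Real.mul_rpow zero_le_two (by positivity),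
      Real.mul_rpow hτ.le (by positivity), Real.mul_rpow hκ (by positivity)]
    ring
  have p1 : S ^ (L + (L + 1) * ⌈2 * γ⌉₊) ≤ S ^ m := pow_le_pow_right₀ hS (by omega)
  have p2 : S ^ (2 * L + 2 * (L + 1)) ≤ S ^ m := pow_le_pow_right₀ hS (by omega)
  have p3 : S ^ (2 * L + 1) ≤ S ^ m := pow_le_pow_right₀ hS (by omega)
  have hτμ0 : 0 ≤ τ ^ μ := by positivity
  have hSm : 0 ≤ S ^ m := by positivity
  have hz : 0 ≤ τ ^ μ * (τ * S ^ m) := by positivity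
  have hz' : 0 ≤ τ ^ μ * S ^ m := by positivity
  have b1 : K * (4 * (4 * S)) ^ L * (2 * (τ * (κ * S ^ (L + 1)))) ^ γ
      * (τ * (κ * S ^ (L + 1))) ^ γ / (2 * √c) ≤ C1 * (τ ^ μ * (τ * S ^ m)) := by
    rw [mul_assoc (K * _), e1]
    calc _ = K * 16 ^ L * (2 ^ γ * κ ^ (2 * γ)) / (2 * √c) *
          (S ^ L * (S ^ (L + 1)) ^ (2 * γ)) * τ ^ (2 * γ) := by
          rw [← mul_assoc 4 4 S, mul_pow]; norm_num; ring
      _ ≤ K * 16 ^ L * (2 ^ γ * κ ^ (2 * γ)) / (2 * √c) *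
          S ^ m * (T ^ (2 * γ - (1 + μ)) * (τ * τ ^ μ)) := by
          gcongr
          refine le_trans ?_ p1
          rw [pow_add S L ((L + 1) * ⌈2 * γ⌉₊)]
          gcongr
      _ = _ := by rw [hC1]; ring
  have b2 : (K * (4 * S) ^ L * (τ * (κ * S ^ (L + 1))))
      * (K * (4 * S) ^ L * (2 * (τ * (κ * S ^ (L + 1))))) / (4 * c * √c) ≤
        C2 * (τ ^ μ * (τ * S ^ m)) := by
    calc _ = K ^ 2 * 16 ^ L * (2 * κ ^ 2) / (4 * c * √c) * S ^ (2 * L + 2 * (L + 1)) * τ ^ 2 := by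
          have : (16 : ℝ) ^ L = 4 ^ L * 4 ^ L := by rw [← mul_pow]; norm_num
          rw [this, mul_pow]; ring
      _ ≤ K ^ 2 * 16 ^ L * (2 * κ ^ 2) / (4 * c * √c) * S ^ m
          * (T ^ (2 - (1 + μ)) * (τ * τ ^ μ)) := by gcongr
      _ = _ := by rw [hC2]; ring
  have b3 : K * (4 * S) ^ L * (τ * (κ * S ^ (L + 1))) / (2 * √c) ≤ C3 * (τ ^ μ * S ^ m) := by
    calc _ = K * 4 ^ L * κ / (2 * √c) * S ^ (2 * L + 1) * τ := by rw [mul_pow]; ring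
      _ ≤ K * 4 ^ L * κ / (2 * √c) * S ^ m * (T ^ (1 - μ) * τ ^ μ) := by gcongr
      _ = _ := by rw [hC3]; ring
  constructor
  · nlinarith [mul_nonneg hC3' hz]
  · nlinarith [mul_nonneg hC1' hz', mul_nonneg hC2' hz']

end RealBounds

/-! ### Pathwise error of the auxiliary variable. -/

section Path

variable {d : ℕ} {O : Opens (EuclideanSpace ℝ (Fin d))}
variable {e : HilbertBasis ℕ ℝ (L2 O)} {lam : ℕ → ℝ} {R : L2 O →L[ℝ] L2 O}
variable {Ft : ℝ → ℝ} {g : L2 O × (Fin d → L2 O) → (CM R →ₗ[ℝ] L2 O)} {k : ℕ} {δ₀ : ℝ}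

lemma uHat_mem_H1 {x : Extrapolation} {u : ℕ → L2 O} {n : ℕ} (h : u n ∈ H1 e lam)
    (h' : u (n - 1) ∈ H1 e lam) : uHat x u n ∈ H1 e lam := by
  cases x with
  | constant => exact h
  | linear => exact H1_smul (H1_sub (H1_smul h _) h') _

/-- The extrapolation coefficients 3/2 and 1/2 are rounded up so that one bound serves both choices.
-/
lemma h1norm_uHat_le (hl : ∀ i, 0 < lam i) {x : Extrapolation} {u : ℕ → L2 O} {n : ℕ}
    (h : u n ∈ H1 e lam) (h' : u (n - 1) ∈ H1 e lam) :
    h1norm e lam (uHat x u n) ≤ 2 * h1norm e lam (u n) + h1norm e lam (u (n - 1)) := by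
  have h1 := h1norm_nonneg (e := e) (lam := lam) (u n)
  have h2 := h1norm_nonneg (e := e) (lam := lam) (u (n - 1))
  cases x with
  | constant => simp only [uHat]; linarith
  | linear =>
    simp only [uHat]
    rw [h1norm_smul hl (H1_sub (H1_smul h _) h')]
    have h3 := h1norm_sub_le hl (H1_smul h 3) h'
    rw [h1norm_smul hl h] at h3
    norm_num at h3 ⊢
    linarith

/-- Extrapolation displaces u_n by half the previous increment, so its error has order τ. At n = 0
truncated subtraction makes both sides vanish. -/
lemma norm_sub_uHat_le (x : Extrapolation) (u : ℕ → L2 O) (n : ℕ) :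
    ‖u n - uHat x u n‖ ≤ ‖u n - u (n - 1)‖ := by
  cases x with
  | constant => simp [uHat]
  | linear =>
    have : u n - uHat .linear u n = (-(1 / 2) : ℝ) • (u n - u (n - 1)) := by
      simp only [uHat]
      module
    rw [this, norm_smul]
    norm_num
    linarith [norm_nonneg (u n - u (n - 1))]

lemma norm_drift_le {γ K : ℝ} {L : ℕ} (hB : PolyBound e lam Ft γ K L) {c : ℝ} (hc : 0 < c)
    {z : L2 O} (hF : c ≤ F Ft z + δ₀) (hz : z ∈ H1 e lam) {M : ℝ} (hM : 1 ≤ M)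
    (hzM : h1norm e lam z ≤ M) (q q' : ℝ) :
    ‖drift Ft δ₀ z q q'‖ ≤ (|q| + |q'|) / (2 * √c) * (K * M ^ L) := by
  have hs : 0 < √c := Real.sqrt_pos.2 hc
  have hs' : √c ≤ √(F Ft z + δ₀) := Real.sqrt_le_sqrt hF
  rw [drift, norm_smul, Real.norm_eq_abs, abs_div, abs_div, abs_of_nonneg (Real.sqrt_nonneg _),
    abs_two, div_div]
  gcongr
  exacts [abs_add_le _ _, hB.growth M hM z hz hzM]

/-- A quantity that controls the numerical solution near the step `n`. -/
def stepBound (e : HilbertBasis ℕ ℝ (L2 O)) (lam : ℕ → ℝ) (u v : ℕ → L2 O) (q : ℕ → ℝ)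
    (ξ : ℕ → L2 O) (n : ℕ) : ℝ :=
  energy e lam (u (n - 1)) (v (n - 1)) (q (n - 1)) + energy e lam (u n) (v n) (q n)
    + energy e lam (u (n + 1)) (v (n + 1)) (q (n + 1)) + ‖ξ n‖ ^ 2

/-- A quantity that controls the numerical solution near the steps `n - 1` and `n`. -/
def pathBound (e : HilbertBasis ℕ ℝ (L2 O)) (lam : ℕ → ℝ) (u v : ℕ → L2 O) (q : ℕ → ℝ)
    (ξ : ℕ → L2 O) (n : ℕ) : ℝ :=
  stepBound e lam u v q ξ n + stepBound e lam u v q ξ (n - 1)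

lemma one_le_stepBound (u v : ℕ → L2 O) (q : ℕ → ℝ) (ξ : ℕ → L2 O) (n : ℕ) :
    1 ≤ stepBound e lam u v q ξ n := by
  have h1 := one_le_energy (e := e) (lam := lam) (u (n - 1)) (v (n - 1)) (q (n - 1))
  have h2 := one_le_energy (e := e) (lam := lam) (u n) (v n) (q n)
  have h3 := one_le_energy (e := e) (lam := lam) (u (n + 1)) (v (n + 1)) (q (n + 1))
  have h4 := sq_nonneg ‖ξ n‖
  rw [stepBound]
  linarith

lemma one_le_pathBound (u v : ℕ → L2 O) (q : ℕ → ℝ) (ξ : ℕ → L2 O) (n : ℕ) :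
    1 ≤ pathBound e lam u v q ξ n := by
  have h1 := one_le_stepBound (e := e) (lam := lam) u v q ξ n
  have h2 := one_le_stepBound (e := e) (lam := lam) u v q ξ (n - 1)
  rw [pathBound]
  linarith

/-- The constant in the bound for the increments. -/
def incrementConst (K c T : ℝ) (L : ℕ) : ℝ := 5 + T * K * 4 ^ L / (2 * √c)

lemma norm_step_increment_le (hl : ∀ i, 0 < lam i) {γ K : ℝ} {L : ℕ}
    (hB : PolyBound e lam Ft γ K L) {c : ℝ} (hc : 0 < c) (hF : ∀ u ∈ H1 e lam, c ≤ F Ft u + δ₀)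
    {s : Scheme} {x : Extrapolation} {τ T : ℝ} (hτ : 0 ≤ τ) (hτT : τ ≤ T) {u v ξ : ℕ → L2 O}
    {q : ℕ → ℝ} {n : ℕ} (h0 : u (n - 1) ∈ H1 e lam) (h1 : u n ∈ H1 e lam)
    (h : Step e lam Ft δ₀ s τ (uHat x u n) (ξ n) (u n) (v n) (q n) (u (n + 1)) (v (n + 1))
      (q (n + 1))) :
    ‖u (n + 1) - u n‖ ≤
      τ * (incrementConst K c T L * stepBound e lam u v q ξ n ^ (L + 1)) := by
  have hK := hB.nonneg
  have hT : 0 ≤ T := hτ.trans hτT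
  have hs : 0 < √c := Real.sqrt_pos.2 hc
  obtain ⟨a1, -⟩ := energy_bounds (e := e) (lam := lam) (u (n - 1)) (v (n - 1)) (q (n - 1))
  obtain ⟨b1, b2, b3, -⟩ := energy_bounds (e := e) (lam := lam) (u n) (v n) (q n)
  obtain ⟨-, c2, c3, -⟩ :=
    energy_bounds (e := e) (lam := lam) (u (n + 1)) (v (n + 1)) (q (n + 1))
  have hE0 := one_le_energy (e := e) (lam := lam) (u (n - 1)) (v (n - 1)) (q (n - 1))
  have hE1 := one_le_energy (e := e) (lam := lam) (u n) (v n) (q n)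
  have hE2 := one_le_energy (e := e) (lam := lam) (u (n + 1)) (v (n + 1)) (q (n + 1))
  have hA1 := one_le_stepBound (e := e) (lam := lam) u v q ξ n
  have hAd : stepBound e lam u v q ξ n = energy e lam (u (n - 1)) (v (n - 1)) (q (n - 1))
    + energy e lam (u n) (v n) (q n) + energy e lam (u (n + 1)) (v (n + 1)) (q (n + 1))
    + ‖ξ n‖ ^ 2 := rfl
  set A := stepBound e lam u v q ξ n
  have hxi : ‖ξ n‖ ≤ 1 + ‖ξ n‖ ^ 2 := by nlinarith [sq_nonneg (‖ξ n‖ - 1)]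
  have hxi2 := sq_nonneg ‖ξ n‖
  have hz := uHat_mem_H1 (x := x) h1 h0
  have hzA : h1norm e lam (uHat x u n) ≤ 4 * A := by
    have := h1norm_uHat_le hl (x := x) h1 h0
    linarith
  have hdr := norm_drift_le (δ₀ := δ₀) hB hc (hF _ hz) hz (by linarith : (1 : ℝ) ≤ 4 * A) hzA
    (q n) (q (n + 1))
  have hdr2 : ‖drift Ft δ₀ (uHat x u n) (q n) (q (n + 1))‖ ≤ A / (2 * √c) * (K * (4 * A) ^ L) := by
    refine hdr.trans ?_
    gcongr
    linarith
  refine (norm_increment_le hl hτ h1 h).trans ?_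
  gcongr
  have hpow : A ≤ A ^ (L + 1) := le_self_pow₀ hA1 (by omega)
  have h5 : τ * ‖drift Ft δ₀ (uHat x u n) (q n) (q (n + 1))‖ ≤
      T * (A / (2 * √c) * (K * (4 * A) ^ L)) := by gcongr
  have e1 : T * (A / (2 * √c) * (K * (4 * A) ^ L)) = T * K * 4 ^ L / (2 * √c) * A ^ (L + 1) := by
    rw [mul_pow]; ring
  -- The constant 5 collects at most 4E_n + 2E_{n+1} from the norms of u and of the two velocities,
  -- and 1 + ‖ξ‖² from the noise; the second summand comes from the drift.
  rw [incrementConst, add_mul]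
  linarith

/-- Pathwise bound for the error of the auxiliary variable. -/
lemma CoefficientAssumption.exists_path_error (hcoef : CoefficientAssumption e lam R Ft g k δ₀)
    (hl : ∀ i, 0 < lam i) (hf' : Differentiable ℝ (deriv Ft)) {γ K : ℝ} {L : ℕ} (hγ : 1 / 2 < γ)
    (hB : PolyBound e lam Ft γ K L) {c : ℝ} (hc : 0 < c) (hF : ∀ u ∈ H1 e lam, c ≤ F Ft u + δ₀)
    {T : ℝ} (hT : 0 < T) (C₀ : ℝ) :
    ∃ C : ℝ, 0 < C ∧ ∃ m : ℕ, ∀ (s : Scheme) (x : Extrapolation) (N : ℕ) (τ : ℝ), 0 < τ → τ ≤ T →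
      ∀ (u v ξ : ℕ → L2 O) (q : ℕ → ℝ), (∀ n ≤ N, u n ∈ H1 e lam) →
      (∀ n < N, Step e lam Ft δ₀ s τ (uHat x u n) (ξ n) (u n) (v n) (q n) (u (n + 1)) (v (n + 1))
        (q (n + 1))) →
      |q 0 - √(F Ft (uHat x u 0) + δ₀)| ≤ C₀ * τ →
      ∀ j, 1 ≤ j → j ≤ N → |√(F Ft (uHat x u j) + δ₀) - q j| ≤ C * τ ^ min 1 (2 * γ - 1) *
        (1 + pathBound e lam u v q ξ (j - 1) ^ m
          + τ * ∑ n ∈ Finset.range j, pathBound e lam u v q ξ n ^ m) := by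
  have hK := hB.nonneg
  have hκ : 0 ≤ incrementConst K c T L := by rw [incrementConst]; positivity
  obtain ⟨C, hC, m, hrate⟩ := exists_local_error_rate L hγ hK hc hκ hT
  set μ := min 1 (2 * γ - 1) with hμ
  have hμ1 : μ ≤ 1 := min_le_left _ _
  -- The summands account for the local errors, the initial error and strict positivity.
  refine ⟨C + |C₀| * T ^ (1 - μ) + 1, by positivity, m, ?_⟩
  intro s x N τ hτ hτT u v ξ q hu hstep h0 j hj hjN
  set S := pathBound e lam u v q ξ with hS
  have hS1 : ∀ n, 1 ≤ S n := fun n => one_le_pathBound u v q ξ n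
  have hinc : ∀ n < N, ‖u (n + 1) - u n‖ ≤
      τ * (incrementConst K c T L * stepBound e lam u v q ξ n ^ (L + 1)) := fun n hn =>
    norm_step_increment_le hl hB hc hF hτ.le hτT (hu _ (by omega)) (hu _ hn.le) (hstep n hn)
  have hA1 := one_le_stepBound (e := e) (lam := lam) u v q ξ
  have hAS : ∀ n, stepBound e lam u v q ξ n ≤ S n := fun n => by
    rw [hS, pathBound]; linarith [hA1 (n - 1)]
  have hAS' : ∀ n, stepBound e lam u v q ξ (n - 1) ≤ S n := fun n => by
    rw [hS, pathBound]; linarith [hA1 n]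
  have hpow : ∀ a n, 1 ≤ a → a ≤ S n → τ * (incrementConst K c T L * a ^ (L + 1)) ≤
      τ * (incrementConst K c T L * S n ^ (L + 1)) := fun a n ha han => by
    gcongr
  have hE := fun n => energy_nonneg (e := e) (lam := lam) (u n) (v n) (q n)
  have hx := fun n => sq_nonneg ‖ξ n‖
  have hlocal : ∀ n < N, |√(F Ft (u (n + 1)) + δ₀) - √(F Ft (u n) + δ₀)
      - ⟪f Ft (uHat x u n), u (n + 1) - u n⟫_ℝ / (2 * √(F Ft (uHat x u n) + δ₀))| ≤
        C * τ ^ μ * (τ * S n ^ m) := by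
    intro n hn
    refine le_trans ?_ (hrate (S n) τ (hS1 n) hτ hτT).1
    have b0 := (energy_bounds (e := e) (lam := lam) (u (n - 1)) (v (n - 1)) (q (n - 1))).1
    have b1 := (energy_bounds (e := e) (lam := lam) (u n) (v n) (q n)).1
    have b2 := (energy_bounds (e := e) (lam := lam) (u (n + 1)) (v (n + 1)) (q (n + 1))).1
    have hz := h1norm_uHat_le hl (x := x) (hu n hn.le) (hu (n - 1) (by omega))
    have hSn := hAS n
    rw [stepBound] at hSn
    have := hE (n - 1)
    have := hE n
    have := hE (n + 1)
    have := hx n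
    refine hcoef.abs_local_error_le hl hf' (by linarith) hB hc hF
      (uHat_mem_H1 (hu n hn.le) (hu (n - 1) (by omega))) (hu n hn.le) (hu (n + 1) hn)
      (by linarith [hS1 n]) (by linarith) (by linarith) (by linarith)
      ((hinc n hn).trans (hpow _ _ (hA1 n) (hAS n))) ?_
    refine (norm_sub_uHat_le x u n).trans ?_
    -- For n = 0 the convention u_{-1} = u_0 makes the previous increment zero.
    rcases Nat.eq_zero_or_pos n with rfl | hn0
    · simp only [Nat.zero_sub, sub_self, norm_zero]
      have := hS1 0
      positivity
    · have h2 := hinc (n - 1) (by omega)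
      rw [Nat.sub_add_cancel hn0] at h2
      exact h2.trans (hpow _ _ (hA1 _) (hAS' n))
  -- The errors telescope at u_i; the passage to û_j is made once, at the end. Since û_0 = u_0, the
  -- assumed initial error starts the induction.
  have htel : ∀ i ≤ N, |√(F Ft (u i) + δ₀) - q i| ≤
      |C₀| * T ^ (1 - μ) * τ ^ μ + C * τ ^ μ * (τ * ∑ n ∈ Finset.range i, S n ^ m) := by
    intro i
    induction i with
    | zero =>
      intro _
      rw [uHat_zero, abs_sub_comm] at h0
      have h3 : τ ≤ T ^ (1 - μ) * τ ^ μ := by simpa using rpow_le_mul_rpow hτ hτT hμ1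
      simp only [Finset.range_zero, Finset.sum_empty, mul_zero, add_zero]
      calc _ ≤ C₀ * τ := h0
        _ ≤ |C₀| * (T ^ (1 - μ) * τ ^ μ) := mul_le_mul (le_abs_self _) h3 hτ.le (abs_nonneg _)
        _ = _ := by ring
    | succ i ih =>
      intro hi
      have h1 := ih (by omega)
      have h2 := hlocal i hi
      have h3 : q (i + 1) = _ := (hstep i hi).1
      rw [Finset.sum_range_succ, mul_add, mul_add, ← add_assoc]
      refine le_trans ?_ (add_le_add h1 h2)
      refine le_trans (le_of_eq ?_) (abs_add_le _ _)
      rw [h3]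
      ring_nf
  have hlast : |√(F Ft (uHat x u j) + δ₀) - √(F Ft (u j) + δ₀)| ≤
      C * τ ^ μ * S (j - 1) ^ m := by
    refine le_trans ?_ (hrate (S (j - 1)) τ (hS1 _) hτ hτT).2
    have hz := h1norm_uHat_le hl (x := x) (hu j hjN) (hu (j - 1) (by omega))
    have hSn := hAS (j - 1)
    rw [stepBound, Nat.sub_add_cancel hj] at hSn
    have b0 := (energy_bounds (e := e) (lam := lam) (u (j - 1)) (v (j - 1)) (q (j - 1))).1
    have b1 := (energy_bounds (e := e) (lam := lam) (u j) (v j) (q j)).1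
    have := hE (j - 1 - 1)
    have := hE (j - 1)
    have := hE j
    have := hx (j - 1)
    refine (hcoef.abs_sqrt_F_sub_le hl hB hc hF (hu j hjN)
      (uHat_mem_H1 (x := x) (hu j hjN) (hu (j - 1) (by omega))) (M := 4 * S (j - 1))
      (by linarith [hS1 (j - 1)]) (by linarith) (by linarith)).trans ?_
    have hS0 : 0 ≤ S (j - 1) := by linarith [hS1 (j - 1)]
    gcongr
    rw [norm_sub_rev]
    refine (norm_sub_uHat_le x u j).trans ?_
    have h2 := hinc (j - 1) (by omega)
    rw [Nat.sub_add_cancel hj] at h2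
    exact h2.trans (hpow _ _ (hA1 _) (hAS _))
  have h1 := htel j hjN
  have h2 := abs_sub_le (√(F Ft (uHat x u j) + δ₀)) (√(F Ft (u j) + δ₀)) (q j)
  have hS0 : 0 ≤ S (j - 1) ^ m := by have := hS1 (j - 1); positivity
  have hsum : 0 ≤ τ * ∑ n ∈ Finset.range j, S n ^ m :=
    mul_nonneg hτ.le (Finset.sum_nonneg fun n _ => by have := hS1 n; positivity)
  have hτμ : 0 ≤ τ ^ μ := by positivity
  have hC0 : 0 ≤ |C₀| * T ^ (1 - μ) := by positivity
  have hZ : 0 ≤ 1 + S (j - 1) ^ m + τ * ∑ n ∈ Finset.range j, S n ^ m := by linarith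
  calc _ ≤ C * τ ^ μ * S (j - 1) ^ m + (|C₀| * T ^ (1 - μ) * τ ^ μ
        + C * τ ^ μ * (τ * ∑ n ∈ Finset.range j, S n ^ m)) := by linarith
    _ ≤ C * τ ^ μ * (1 + S (j - 1) ^ m + τ * ∑ n ∈ Finset.range j, S n ^ m)
        + |C₀| * T ^ (1 - μ) * τ ^ μ * (1 + S (j - 1) ^ m + τ * ∑ n ∈ Finset.range j, S n ^ m)
        + 1 * τ ^ μ * (1 + S (j - 1) ^ m + τ * ∑ n ∈ Finset.range j, S n ^ m) := by
      have i1 : 0 ≤ C * τ ^ μ := by positivity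
      have i2 : 0 ≤ |C₀| * T ^ (1 - μ) * τ ^ μ := by positivity
      have i3 := mul_nonneg i2 hS0
      have i4 := mul_nonneg i2 hsum
      have i5 := mul_nonneg hτμ hZ
      linarith
    _ = _ := by ring

end Path

/-! ### Moments of powers, averages and dominated variables. -/

section MomentCalculus

variable {Ω : Type*} [mΩ : MeasurableSpace Ω] {P : Measure Ω}

lemma HasMoments.pow {X : Ω → ℝ} {a : ℕ → ℝ} (hX : HasMoments P X a) (m : ℕ) :
    HasMoments P (fun ω => X ω ^ m) fun r => a (m * r) :=
  ⟨fun ω => pow_nonneg (hX.nonneg ω) m, hX.meas.pow m, fun r => by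
    simpa only [← pow_mul] using hX.moments (m * r)⟩

lemma hasMoments_one [IsProbabilityMeasure P] : HasMoments P (fun _ => (1 : ℝ)) fun _ => 1 :=
  ⟨fun _ => zero_le_one, aestronglyMeasurable_const, fun r => by simp⟩

/-- The power mean inequality bounds the moment of order r by (jτ)^r times a common moment, and jτ ≤
T, so summation over the steps costs no power of τ. -/
lemma HasMoments.average {X : ℕ → Ω → ℝ} {a : ℕ → ℝ} {j : ℕ} (hj : 1 ≤ j)
    (hX : ∀ n < j, HasMoments P (X n) a) {τ T : ℝ} (hτ : 0 ≤ τ) (hT : j * τ ≤ T) :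
    HasMoments P (fun ω => τ * ∑ n ∈ Finset.range j, X n ω) fun r => T ^ r * a r := by
  have hX' : ∀ n ∈ Finset.range j, HasMoments P (X n) a := fun n hn => hX n (Finset.mem_range.1 hn)
  have hnn : ∀ ω, 0 ≤ τ * ∑ n ∈ Finset.range j, X n ω := fun ω =>
    mul_nonneg hτ (Finset.sum_nonneg fun n hn => (hX' n hn).nonneg ω)
  have hmeas : AEStronglyMeasurable (fun ω => τ * ∑ n ∈ Finset.range j, X n ω) P :=
    (Finset.aestronglyMeasurable_fun_sum _ fun n hn => (hX' n hn).meas).const_mul τ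
  refine ⟨hnn, hmeas, fun r => ?_⟩
  cases r with
  | zero => simpa using (hX 0 hj).moments 0
  | succ r =>
    have hint : ∀ n ∈ Finset.range j, Integrable (fun ω => X n ω ^ (r + 1)) P := fun n hn =>
      ((hX' n hn).moments (r + 1)).1
    have hdom : Integrable (fun ω => τ ^ (r + 1) * ((j : ℝ) ^ r *
        ∑ n ∈ Finset.range j, X n ω ^ (r + 1))) P :=
      ((integrable_finsetSum _ hint).const_mul _).const_mul _
    have hle : ∀ ω, (τ * ∑ n ∈ Finset.range j, X n ω) ^ (r + 1) ≤
        τ ^ (r + 1) * ((j : ℝ) ^ r * ∑ n ∈ Finset.range j, X n ω ^ (r + 1)) := fun ω => by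
      rw [mul_pow]
      gcongr
      simpa using pow_sum_le_card_mul_sum_pow (s := Finset.range j) (f := fun n => X n ω)
        (fun n hn => (hX' n hn).nonneg ω) r
    have hI : Integrable (fun ω => (τ * ∑ n ∈ Finset.range j, X n ω) ^ (r + 1)) P := by
      refine hdom.mono' (hmeas.pow _) (ae_of_all _ fun ω => ?_)
      rw [Real.norm_of_nonneg (pow_nonneg (hnn ω) _)]
      exact hle ω
    refine ⟨hI, (integral_mono hI hdom hle).trans ?_⟩
    rw [integral_const_mul, integral_const_mul, integral_finsetSum _ hint]
    have ha : 0 ≤ a (r + 1) := le_trans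
      (integral_nonneg fun ω => pow_nonneg ((hX 0 hj).nonneg ω) _) ((hX 0 hj).moments (r + 1)).2
    calc _ ≤ τ ^ (r + 1) * ((j : ℝ) ^ r * ∑ n ∈ Finset.range j, a (r + 1)) := by
          gcongr with n hn
          exact ((hX' n hn).moments (r + 1)).2
      _ = (j * τ) ^ (r + 1) * a (r + 1) := by
          rw [Finset.sum_const, Finset.card_range, nsmul_eq_mul]; ring
      _ ≤ T ^ (r + 1) * a (r + 1) := by gcongr

/-- Moments of real order of a random variable that is dominated by `c * X`. -/
lemma HasMoments.integral_rpow_le {X Y : Ω → ℝ} {a : ℕ → ℝ} (hX : HasMoments P X a)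
    (hX1 : ∀ ω, 1 ≤ X ω) {c p : ℝ} (hc : 0 ≤ c) (hp : 0 ≤ p) (hY : AEStronglyMeasurable Y P)
    (hYX : ∀ᵐ ω ∂P, |Y ω| ≤ c * X ω) :
    Integrable (fun ω => |Y ω| ^ p) P ∧ ∫ ω, |Y ω| ^ p ∂P ≤ c ^ p * a ⌈p⌉₊ := by
  have hdom := (hX.moments ⌈p⌉₊).1.const_mul (c ^ p)
  have hle : ∀ᵐ ω ∂P, |Y ω| ^ p ≤ c ^ p * X ω ^ ⌈p⌉₊ := by
    filter_upwards [hYX] with ω hω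
    calc |Y ω| ^ p ≤ (c * X ω) ^ p := Real.rpow_le_rpow (abs_nonneg _) hω hp
      _ = c ^ p * X ω ^ p := Real.mul_rpow hc (hX.nonneg ω)
      _ ≤ c ^ p * X ω ^ ⌈p⌉₊ := by
        gcongr
        rw [← Real.rpow_natCast]
        exact Real.rpow_le_rpow_of_exponent_le (hX1 ω) (Nat.le_ceil p)
  have hI : Integrable (fun ω => |Y ω| ^ p) P := by
    refine hdom.mono'
      ((Real.continuous_rpow_const hp).comp_aestronglyMeasurable hY.norm) ?_
    filter_upwards [hle] with ω hω
    rwa [Real.norm_of_nonneg (by positivity)]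
  refine ⟨hI, (integral_mono_ae hI hdom hle).trans ?_⟩
  rw [integral_const_mul]
  gcongr
  exact (hX.moments _).2

end MomentCalculus

/-! ### Measurability of the error and moments of its prefactor. -/

section AuxiliaryError

variable {d : ℕ} {O : Opens (EuclideanSpace ℝ (Fin d))}
variable {e : HilbertBasis ℕ ℝ (L2 O)} {lam : ℕ → ℝ} {R : L2 O →L[ℝ] L2 O}
variable {Ft : ℝ → ℝ} {g : L2 O × (Fin d → L2 O) → (CM R →ₗ[ℝ] L2 O)} {k : ℕ} {δ₀ : ℝ}
variable {Ω : Type*} [mΩ : MeasurableSpace Ω] {P : Measure Ω}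
variable {ℱ : Filtration ℝ≥0 mΩ} {β : ℕ → ℝ≥0 → Ω → ℝ} {s : Scheme} {x : Extrapolation}
  {N : ℕ} {τ T : ℝ≥0} {u₀ v₀ : Ω → L2 O} {u v : ℕ → Ω → L2 O} {q : ℕ → Ω → ℝ}

lemma IsNumericalSolution.aestronglyMeasurable_error
    (hcoef : CoefficientAssumption e lam R Ft g k δ₀) (he : IsDirichletEigenbasis e lam)
    {γ K : ℝ} {L : ℕ} (hB : PolyBound e lam Ft γ K L)
    (hsol : IsNumericalSolution e lam R Ft P g δ₀ ℱ β s x N τ u₀ v₀ u v q) {j : ℕ} (hj : j ≤ N) :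
    AEStronglyMeasurable
      (fun ω => √(F Ft (uHat x (fun m => u m ω) j) + δ₀) - q j ω) P := by
  obtain ⟨U, hU, hUH, hUe⟩ := hsol.exists_version hj
  obtain ⟨V, hV, hVH, hVe⟩ := hsol.exists_version (n := j - 1) (by omega)
  -- For j = 0 the indices j and j - 1 coincide, but the versions U and V may differ; the case
  -- distinction yields one consistent family.
  set W : ℕ → Ω → L2 O := fun n => if n = j then U else V with hW
  have hWj : W j = U := if_pos rfl
  have hWj' : ∀ ω, W (j - 1) ω ∈ H1 e lam := fun ω => by
    by_cases h : j - 1 = j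
    · rw [h, hWj]; exact hUH ω
    · simp only [hW, if_neg h]; exact hVH ω
  have hWm : ∀ n, StronglyMeasurable (W n) := fun n => by
    by_cases h : n = j
    · simp only [hW, if_pos h]; exact hU.mono (ℱ.le _)
    · simp only [hW, if_neg h]; exact hV.mono (ℱ.le _)
  have hZm : StronglyMeasurable fun ω => uHat x (fun m => W m ω) j := by
    cases x with
    | constant => exact hWm j
    | linear => exact (((hWm j).const_smul (3 : ℝ)).sub (hWm (j - 1))).const_smul (2⁻¹ : ℝ)
  have hFm := (hcoef.h1Continuous_F he hB).stronglyMeasurable_comp he.pos he.mono hZm fun ω =>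
    uHat_mem_H1 (by rw [hWj]; exact hUH ω) (hWj' ω)
  have hm : StronglyMeasurable fun ω => √(F Ft (uHat x (fun m => W m ω) j) + δ₀) - q j ω :=
    (Real.continuous_sqrt.comp_stronglyMeasurable
      (hFm.add (stronglyMeasurable_const (b := δ₀)))).sub
      ((hsol.adapted_q j hj).mono (ℱ.le _) le_rfl).stronglyMeasurable
  refine hm.aestronglyMeasurable.congr ?_
  filter_upwards [hUe, hVe] with ω h1 h2
  have h3 : uHat x (fun m => W m ω) j = uHat x (fun m => u m ω) j := by
    have h4 : W j ω = u j ω := by rw [hWj, h1]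
    have h5 : W (j - 1) ω = u (j - 1) ω := by
      by_cases h : j - 1 = j
      · rw [h, h4]
      · simp only [hW, if_neg h]; exact h2.symm
    cases x with
    | constant => exact h4
    | linear => simp only [uHat, h4, h5]
  rw [h3]

variable [IsProbabilityMeasure P]

/-- Bound on the moments of `pathBound`. -/
def pathMoment (c₂ : ℝ) (T : ℝ≥0) (M : ℕ → ℝ) : ℕ → ℝ :=
  let a := addMoments (addMoments (addMoments (energyMoment c₂ T M) (energyMoment c₂ T M))
    (energyMoment c₂ T M)) (incrementMoment c₂ T M)
  addMoments a a

lemma IsNumericalSolution.hasMoments_pathBound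
    (hcoef : CoefficientAssumption e lam R Ft g k δ₀)
    (he : IsDirichletEigenbasis e lam) {c₂ : ℝ} (hc₂ : 0 < c₂)
    (hg : ∀ u ∈ H1 e lam, hsNorm e R (g (Theta u)) ≤ c₂ * (1 + h1norm e lam u))
    (hW : IsWienerFamily P ℱ β)
    (hsol : IsNumericalSolution e lam R Ft P g δ₀ ℱ β s x N τ u₀ v₀ u v q) (hN : 1 ≤ N)
    (hNT : N * τ = T) {M : ℕ → ℝ}
    (h0 : ∀ r : ℕ, Integrable (fun ω => energy e lam (u 0 ω) (v 0 ω) (q 0 ω) ^ r) P ∧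
      ∫ ω, energy e lam (u 0 ω) (v 0 ω) (q 0 ω) ^ r ∂P ≤ M r) {ξ : ℕ → Ω → L2 O}
    (hξ : ∀ n < N, IsNoiseIncrement e R P β (n * τ) ((n + 1 : ℕ) * τ)
      (fun ω => g (Theta (u n ω))) (ξ n)) {n : ℕ} (hn : n < N) :
    HasMoments P (fun ω => pathBound e lam (fun m => u m ω) (fun m => v m ω) (fun m => q m ω)
      (fun m => ξ m ω) n) (pathMoment c₂ T M) := by
  have hτT : τ ≤ T := by
    rw [← hNT]
    exact le_mul_of_one_le_left zero_le (by exact_mod_cast hN)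
  have hE : ∀ n ≤ N, HasMoments P (fun ω => energy e lam (u n ω) (v n ω) (q n ω))
      (energyMoment c₂ T M) := fun n hn =>
    ⟨fun ω => energy_nonneg _ _ _, hsol.aestronglyMeasurable_energy he hn,
      fun r => hsol.energy_moments hcoef he hc₂ hg hW hN hNT h0 hn r⟩
  have hA : ∀ n < N, HasMoments P (fun ω => stepBound e lam (fun m => u m ω) (fun m => v m ω)
      (fun m => q m ω) (fun m => ξ m ω) n) (addMoments (addMoments (addMoments
        (energyMoment c₂ T M) (energyMoment c₂ T M)) (energyMoment c₂ T M))
        (incrementMoment c₂ T M)) := fun n hn =>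
    (((hE (n - 1) (by omega)).add (hE n hn.le)).add (hE (n + 1) hn)).add
      (hsol.noise_moments hcoef he hc₂ hg hW hτT hn (hξ n hn) (hE n hn.le).moments)
  exact (hA n hn).add (hA (n - 1) (by omega))

end AuxiliaryError

end SAVWave

end

/-! ### The error estimate. -/

open SAVWave in
theorem proposition4p1 {d : ℕ} (hd : 1 ≤ d) (hd3 : d ≤ 3)
    (O : Opens (EuclideanSpace ℝ (Fin d))) (hO : IsConvexPolygonalDomain O)
    (e : HilbertBasis ℕ ℝ (L2 O)) (lam : ℕ → ℝ) (he : IsDirichletEigenbasis e lam)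
    (Q R : L2 O →L[ℝ] L2 O) (hQ : IsCovariance e Q R)
    (Ft : ℝ → ℝ) (g : L2 O × (Fin d → L2 O) → (CM R →ₗ[ℝ] L2 O)) (k : ℕ) (δ₀ : ℝ)
    (hcoef : CoefficientAssumption e lam R Ft g k δ₀)
    (hF : ∃ c : ℝ, 0 < c ∧ ∀ u ∈ H1 e lam, c ≤ F Ft u + δ₀)
    (hg : ∃ c₂ : ℝ, 0 < c₂ ∧ ∀ u ∈ H1 e lam,
      hsNorm e R (g (Theta u)) ≤ c₂ * (1 + h1norm e lam u))
    (hf' : Differentiable ℝ (deriv Ft))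
    (γ₁ : ℝ) (hγ₁ : 1 / 2 < γ₁) (b₅ : MvPolynomial (Fin 3) ℝ)
    (hb₅ : ∀ u ∈ H1 e lam, ∀ v ∈ H1 e lam, ∀ w ∈ H1 e lam,
      Integrable (fun y => deriv (deriv Ft) (u y) * v y * w y) (vol O) ∧
      |∫ y, deriv (deriv Ft) (u y) * v y * w y ∂(vol O)| ≤
        MvPolynomial.eval ![h1norm e lam u, h1norm e lam v, h1norm e lam w] b₅
          * ‖v‖ ^ γ₁ * ‖w‖ ^ γ₁)
    {Ω : Type*} [mΩ : MeasurableSpace Ω] (P : Measure Ω) [IsProbabilityMeasure P]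
    (u₀ v₀ : Ω → L2 O) (hu₀ : ∀ᵐ ω ∂P, u₀ ω ∈ H1 e lam)
    (hmom : ∀ r : ℕ, Integrable (fun ω => h1norm e lam (u₀ ω) ^ r) P ∧
      Integrable (fun ω => ‖v₀ ω‖ ^ r) P)
    (T : ℝ≥0) (hT : 0 < T) (p : ℝ) (hp : 1 ≤ p) (C₀ : ℝ) :
    ∃ C : ℝ, 0 < C ∧
      ∀ (ℱ : Filtration ℝ≥0 mΩ) (β : ℕ → ℝ≥0 → Ω → ℝ), IsWienerFamily P ℱ β →
      StronglyMeasurable[ℱ 0] u₀ → StronglyMeasurable[ℱ 0] v₀ →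
      ∀ (s : Scheme) (x : Extrapolation) (N : ℕ) (τ : ℝ≥0), 1 ≤ N → N * τ = T →
      ∀ (u v : ℕ → Ω → L2 O) (q : ℕ → Ω → ℝ),
        IsNumericalSolution e lam R Ft P g δ₀ ℱ β s x N τ u₀ v₀ u v q →
        (∀ᵐ ω ∂P, |q 0 ω - √(F Ft (uHat x (fun m => u m ω) 0) + δ₀)| ≤ C₀ * τ) →
        ∀ j ∈ Finset.Icc 1 N,
          Integrable
            (fun ω => |√(F Ft (uHat x (fun m => u m ω) j) + δ₀) - q j ω| ^ p) P ∧
          ∫ ω, |√(F Ft (uHat x (fun m => u m ω) j) + δ₀) - q j ω| ^ p ∂P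
            ≤ C * (τ : ℝ) ^ (min 1 (2 * γ₁ - 1) * p) := by
  obtain ⟨c, hc, hF⟩ := hF
  obtain ⟨c₂, hc₂, hg⟩ := hg
  obtain ⟨K, L, hB⟩ := hcoef.exists_polyBound hb₅
  obtain ⟨M, hM⟩ := exists_initial_moments hcoef he hB (fun u hu => hc.le.trans (hF u hu)) C₀
    hmom T
  obtain ⟨C, hC, m, hpath⟩ := hcoef.exists_path_error he.pos hf' hγ₁ hB hc hF
    (T := T) (by exact_mod_cast hT) C₀
  -- Moment bounds for the random prefactor 1 + S_{j-1}^m + τ∑S_n^m of the path estimate. The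
  -- summand 1 keeps it at least 1, so the real order p can be rounded up.
  set a : ℕ → ℝ := addMoments (addMoments (fun _ => 1) fun r => pathMoment c₂ T M (m * r))
    fun r => (T : ℝ) ^ r * pathMoment c₂ T M (m * r)
  refine ⟨C ^ p * (|a ⌈p⌉₊| + 1), by positivity, ?_⟩
  intro ℱ β hW _ _ s x N τ hN hNT u v q hsol hq j hj
  obtain ⟨hj1, hjN⟩ := Finset.mem_Icc.1 hj
  have hN0 : 0 < N := hN
  have hτT : τ ≤ T := by
    rw [← hNT]
    exact le_mul_of_one_le_left zero_le (by exact_mod_cast hN)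
  have hτ : 0 < τ := by
    rcases eq_or_ne τ 0 with h | h
    · rw [← hNT, h, mul_zero] at hT
      exact absurd hT (lt_irrefl _)
    · exact pos_iff_ne_zero.2 h
  have hτ' : (0 : ℝ) < τ := by exact_mod_cast hτ
  -- All noise increments are fixed before null sets are discarded, so that the path estimate holds
  -- outside a single null set.
  choose! ξ hξ hstep using hsol.step
  have hpb := fun n (hn : n < N) => (hsol.hasMoments_pathBound hcoef he hc₂ hg hW hN hNT
    (hM ℱ β s x N τ hτT u v q hsol hq) hξ hn).pow m
  have hjT : (j : ℝ) * τ ≤ T := by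
    rw [← hNT]
    push_cast
    gcongr
  have hX := (hasMoments_one.add (hpb (j - 1) (by omega))).add
    (HasMoments.average hj1 (fun n hn => hpb n (by omega)) hτ'.le hjT)
  have hmem : ∀ᵐ ω ∂P, ∀ n ≤ N, u n ω ∈ H1 e lam :=
    ae_all_iff.2 fun n => eventually_imp_distrib_left.2 (hsol.mem_H1 n)
  have hst := ae_all_iff.2 fun n => eventually_imp_distrib_left.2 (hstep n)
  obtain ⟨h1, h2⟩ := hX.integral_rpow_le (c := C * (τ : ℝ) ^ min 1 (2 * γ₁ - 1)) (p := p)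
    (fun ω => by
      have i1 : ∀ n, 1 ≤ pathBound e lam (fun m => u m ω) (fun m => v m ω) (fun m => q m ω)
        (fun m => ξ m ω) n := fun n => one_le_pathBound _ _ _ _ n
      have i2 : ∀ n, 0 ≤ pathBound e lam (fun m => u m ω) (fun m => v m ω) (fun m => q m ω)
        (fun m => ξ m ω) n ^ m := fun n => pow_nonneg (zero_le_one.trans (i1 n)) m
      have i3 := mul_nonneg hτ'.le (Finset.sum_nonneg fun n (_ : n ∈ Finset.range j) => i2 n)
      linarith [i2 (j - 1)])
    (by positivity) (by linarith) (hsol.aestronglyMeasurable_error hcoef he hB hjN) (by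
      filter_upwards [hmem, hst, hq] with ω a1 a2 a3
      exact hpath s x N τ hτ' (by exact_mod_cast hτT) (fun m => u m ω) (fun m => v m ω)
        (fun m => ξ m ω) (fun m => q m ω) a1 a2 a3 j hj1 hjN)
  refine ⟨h1, h2.trans ?_⟩
  rw [Real.mul_rpow hC.le (by positivity), ← Real.rpow_mul hτ'.le, mul_assoc, mul_assoc,
    mul_comm _ (a ⌈p⌉₊)]
  gcongr
  linarith [le_abs_self (a ⌈p⌉₊)]
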